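/- Let $n,\alpha,r_0>0$, $\rho\in(0,\infty]$ and $c_A,c_T>0$ be given. Then there are a radius $R_0>0$, a constant $C_\tau$ and a function $C_G(\cdot,\cdot)$ with finite values, all depending only on $n,\alpha,r_0,\rho,c_A,c_T$, such that the following holds. Let $(X,d)$ be a metric space in which all bounded closed sets are compact, and let $m$ be a locally finite Borel measure on $X$ with full support. Write $B(x,r)=\{y:d(x,y)<r\}$. Let $X_t$ and $\hat X_t$ be Hunt processes on $X$ (possibly with finite lifetime; functions on $X$ are extended by $0$ to the cemetery point), both Feller and strong Feller, which are dual with respect to $m$: with $T_t f(x)=\mathbb E_x f(X_t)$ and $\hat T_t f(x)=\hat{\mathbb E}_x f(\hat X_t)$, for every $\beta>0$ there is a jointly measurable $U_\beta:X\times X\to[0,\infty]$ such that $$\int_0^\infty e^{-\beta t}T_tf(x)\,dt=\int_X U_\beta(x,y)f(y)\,m(dy),\qquad \int_0^\infty e^{-\beta t}\hat T_tf(y)\,dt=\int_X U_\beta(x,y)f(x)\,m(dx)$$ for all Borel $f\ge0$ and all $x$, respectively all $y$, in $X$, where $x\mapsto U_\beta(x,y)$ is $\beta$-excessive for $T_t$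 and $y\mapsto U_\beta(x,y)$ is $\beta$-excessive for $\hat T_t$. Assume that (a) $c_A^{-1}r^n\le m(B(x,r))\le c_A r^n$ for all $x\in X$ and $0<r<\rho$; (b) $X_t$ has a transition density $T_t(x,y)$ with respect to $m$, and for all $t\in(0,r_0^\alpha)$ and all $x,y\in X$ with $d(x,y)<r_0$, $$\frac1{c_T}\min\Big(t^{-n/\alpha},\frac{t}{d(x,y)^{n+\alpha}}\Big)\le T_t(x,y)\le c_T\min\Big(t^{-n/\alpha},\frac{t}{d(x,y)^{n+\alpha}}\Big),$$ where the minimum is $t^{-n/\alpha}$ if $x=y$. For open $D\subset X$ let $\tau_D$ and $\hat\tau_D$ be the first exit times from $D$ of $X_t$ and $\hat X_t$, and put $T^D_tf(x)=\mathbb E_x[f(X_t);\,t<\tau_D]$ and $\hat T^D_tf(x)=\hat{\mathbb E}_x[f(\hat X_t);\,t<\hat\tau_D]$. A Green function of $D$ is a jointly measurable $G_D:X\times X\to[0,\infty]$, equal to $0$ outside $D\times D$, with $$\int_X G_D(x,y)f(y)\,m(dy)=\int_0^\infty T^D_tf(x)\,dt,\qquad \int_X G_D(x,y)f(x)\,m(dx)=\int_0^\infty\hat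 T^D_tf(y)\,dt$$ for all Borel $f\ge0$ and all $x$, respectively all $y$, in $X$, such that for all $x,y\in D$, as functions on $D$, $G_D(\cdot,y)$ is excessive for $T^D_t$ and $G_D(x,\cdot)$ is excessive for $\hat T^D_t$. Put $\hat G_D(x,y)=G_D(y,x)$. Then: 1. $X\setminus B(x,2r)\neq\varnothing$ for all $x\in X$ and $0<r<R_0$. 2. For all $x_0\in X$ and $0<r<R_0$, with $B=B(x_0,r)$, $$\sup_{x\in B}\max\big(\mathbb E_x\tau_B,\ \hat{\mathbb E}_x\hat\tau_B\big)\le C_\tau\,r^\alpha .$$ 3. For all $x_0\in X$ and $0<R<R_0$, the ball $B=B(x_0,R)$ has a Green function, and for every Green function $G_B$ of $B$ and all $0<r<p<R$, $$\sup_{x\in B(x_0,r)}\ \sup_{y\in X\setminus B(x_0,p)}\max\big(G_B(x,y),\hat G_B(x,y)\big)\le C_G\Big(\frac rR,\frac pR\Big)R^{\alpha-n}<\infty .$$ -/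

import Mathlib

universe u v w

open MeasureTheory Filter Topology Set
open scoped NNReal ENNReal

noncomputable section

/-- A function `f` on `X` extended to the one-point compactification by `f ∂ = 0`; here the
cemetery `∂` is the point `∞` of `OnePoint X` (an isolated point when `X` is compact). -/
def extendZero {X Y : Type*} [Zero Y] (f : X → Y) (z : OnePoint X) : Y := z.elim 0 f

/-- A Hunt process `(X_t, ζ, 𝓜_t, P_x)` with state space `X` and sample space `Ω`. The lifetime is
`ζ = inf {t : X_t = ∂}`. The filtration may be any right-continuous filtration to which the
process is adapted and with respect to which it is strong Markov and quasi-left-continuous. -/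
structure HuntProcess (X Ω : Type*) [TopologicalSpace X] [MeasurableSpace X]
    [mΩ : MeasurableSpace Ω] where
  /-- The position `X_t`, in `X ∪ {∂}`. -/
  path : ℝ≥0 → Ω → OnePoint X
  /-- The filtration `𝓜_t`. -/
  filt : Filtration ℝ≥0 mΩ
  /-- The law `P_x` of the process started at `x`. -/
  prob : X → Measure Ω
  rightCont_filt : filt.IsRightContinuous
  isProbability : ∀ x, IsProbabilityMeasure (prob x)
  adapted : ∀ (t : ℝ≥0) (E : Set X), MeasurableSet E →
    MeasurableSet[filt t] (path t ⁻¹' ((↑) '' E))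
  measurable_prob : ∀ (t : ℝ≥0) (E : Set X), MeasurableSet E →
    Measurable fun x => prob x (path t ⁻¹' ((↑) '' E))
  start : ∀ x : X, ∀ᵐ ω ∂prob x, path 0 ω = (x : OnePoint X)
  absorbed : ∀ ω s t, s ≤ t → path s ω = OnePoint.infty → path t ω = OnePoint.infty
  rightCont_path : ∀ ω t, ContinuousWithinAt (fun s => path s ω) (Ici t) t
  leftLimits : ∀ x, ∀ᵐ ω ∂prob x, ∀ t : ℝ≥0, 0 < t →
    ∃ l : OnePoint X, Tendsto (fun s => path s ω) (𝓝[<] t) (𝓝 l)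
  /-- Strong Markov property: `E_x [f (X_{T+s}); A ∩ {T < ∞}] = E_x [(T_s f)(X_T); A ∩ {T < ∞}]`
  for every stopping time `T` and every `A ∈ 𝓜_T`. -/
  strongMarkov : ∀ (T : Ω → WithTop ℝ≥0) (hT : IsStoppingTime filt T) (A : Set Ω),
    MeasurableSet[hT.measurableSpace] A → ∀ (s : ℝ≥0) (f : X → ℝ≥0∞), Measurable f → ∀ x : X,
    ∫⁻ ω in A ∩ {ω | T ω < ⊤},
        extendZero f (stoppedValue path (fun ω => T ω + (s : WithTop ℝ≥0)) ω) ∂prob x =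
      ∫⁻ ω in A ∩ {ω | T ω < ⊤},
        extendZero (fun z => ∫⁻ ω', extendZero f (path s ω') ∂prob z)
          (stoppedValue path T ω) ∂prob x
  /-- Quasi-left-continuity: if stopping times `T_k` increase to `T`, then `X_{T_k} → X_T`
  almost surely on `{T < ∞}`. -/
  quasiLeftCont : ∀ (T : ℕ → Ω → WithTop ℝ≥0) (S : Ω → WithTop ℝ≥0),
    (∀ k, IsStoppingTime filt (T k)) → (∀ ω, Monotone fun k => T k ω) →
    (∀ ω, IsLUB (range fun k => T k ω) (S ω)) → ∀ x, ∀ᵐ ω ∂prob x, S ω < ⊤ →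
      Tendsto (fun k => stoppedValue path (T k) ω) atTop (𝓝 (stoppedValue path S ω))

namespace HuntProcess

variable {X Ω : Type*} [TopologicalSpace X] [MeasurableSpace X] [MeasurableSpace Ω]

/-- The transition operators `T_t f (x) = E_x f (X_t)`, for `f ≥ 0`. -/
def semigroup (H : HuntProcess X Ω) (t : ℝ≥0) (f : X → ℝ≥0∞) (x : X) : ℝ≥0∞ :=
  ∫⁻ ω, extendZero f (H.path t ω) ∂H.prob x

/-- `T_t f (x) = E_x f (X_t)`, for real-valued bounded `f`. -/
def realSemigroup (H : HuntProcess X Ω) (t : ℝ≥0) (f : X → ℝ) (x : X) : ℝ :=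
  ∫ ω, extendZero f (H.path t ω) ∂H.prob x

/-- Feller property: `T_t` maps `C_0 (X)` into `C_0 (X)`. -/
def IsFeller (H : HuntProcess X Ω) : Prop :=
  ∀ (t : ℝ≥0) (f : ZeroAtInftyContinuousMap X ℝ), ∃ g : ZeroAtInftyContinuousMap X ℝ,
    ∀ x, g x = H.realSemigroup t (fun z => f z) x

/-- Strong Feller property: for `t > 0`, `T_t` maps bounded Borel functions to continuous ones. -/
def IsStrongFeller (H : HuntProcess X Ω) : Prop :=
  ∀ (t : ℝ≥0) (f : X → ℝ), 0 < t → Measurable f → (∃ M : ℝ, ∀ x, |f x| ≤ M) →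
    Continuous (H.realSemigroup t f)

/-- The first exit time `τ_D = inf {t ≥ 0 : X_t ∉ D}`, with `inf ∅ = ∞`. -/
def exitTime (H : HuntProcess X Ω) (D : Set X) (ω : Ω) : ℝ≥0∞ :=
  ⨅ (t : ℝ≥0) (_ : H.path t ω ∉ ((↑) '' D : Set (OnePoint X))), (t : ℝ≥0∞)

/-- The mean exit time `E_x τ_D`. -/
def meanExitTime (H : HuntProcess X Ω) (D : Set X) (x : X) : ℝ≥0∞ :=
  ∫⁻ ω, H.exitTime D ω ∂H.prob x

/-- The transition operators `T^D_t f (x) = E_x [f (X_t); t < τ_D]` of the process killed at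
`τ_D`. -/
def killedSemigroup (H : HuntProcess X Ω) (D : Set X) (t : ℝ≥0) (f : X → ℝ≥0∞) (x : X) : ℝ≥0∞ :=
  ∫⁻ ω, {ω | (t : ℝ≥0∞) < H.exitTime D ω}.indicator (fun ω => extendZero f (H.path t ω)) ω
    ∂H.prob x

/-- `p t x y` is a transition density: `T_t (x, dy) = p t x y m(dy)` for all `t > 0` and `x`. -/
def IsTransitionDensity (H : HuntProcess X Ω) (m : Measure X) (p : ℝ≥0 → X → X → ℝ≥0∞) : Prop :=
  ∀ (t : ℝ≥0) (x : X), 0 < t → Measurable (p t x) ∧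
    ∀ f : X → ℝ≥0∞, Measurable f → H.semigroup t f x = ∫⁻ y, p t x y * f y ∂m

end HuntProcess

section Potential

variable {X : Type*}

/-- The `β`-potential operator `∫_0^∞ e^{-βt} S_t f (x) dt` of a semigroup `S`. -/
def potentialOp (S : ℝ≥0 → (X → ℝ≥0∞) → X → ℝ≥0∞) (β : ℝ) (f : X → ℝ≥0∞) (x : X) : ℝ≥0∞ :=
  ∫⁻ t in Ioi (0 : ℝ), ENNReal.ofReal (Real.exp (-β * t)) * S t.toNNReal f x

/-- `f ≥ 0` is `β`-excessive on `D` for the semigroup `S` of a process with state space `D`: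
`e^{-βt} S_t f ≤ f` for `t > 0`, and `e^{-βt} S_t f → f` pointwise as `t → 0+`. -/
def IsExcessiveOn (S : ℝ≥0 → (X → ℝ≥0∞) → X → ℝ≥0∞) (β : ℝ) (D : Set X) (f : X → ℝ≥0∞) : Prop :=
  ∀ x ∈ D,
    (∀ t : ℝ≥0, 0 < t → ENNReal.ofReal (Real.exp (-β * t)) * S t f x ≤ f x) ∧
    Tendsto (fun t : ℝ≥0 => ENNReal.ofReal (Real.exp (-β * t)) * S t f x) (𝓝[>] 0) (𝓝 (f x))

/-- `u` is the `β`-potential kernel of two processes with state space `D` and semigroups `S`, `S'`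
in duality with respect to `m`: `u x y` is the density of the potential operator of `S` and
`u y x` that of the potential operator of `S'`, `x ↦ u x y` is `β`-excessive for `S`, and
`y ↦ u x y` is `β`-excessive for `S'`. The kernel is extended by `0` outside `D × D`. -/
structure IsPotentialKernel [MeasurableSpace X] (m : Measure X)
    (S S' : ℝ≥0 → (X → ℝ≥0∞) → X → ℝ≥0∞) (β : ℝ) (D : Set X) (u : X → X → ℝ≥0∞) : Prop where
  measurable : Measurable (Function.uncurry u)
  eq_zero : ∀ x y, x ∉ D ∨ y ∉ D → u x y = 0
  potential : ∀ f : X → ℝ≥0∞, Measurable f → ∀ x, ∫⁻ y, u x y * f y ∂m = potentialOp S β f x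
  dual_potential : ∀ f : X → ℝ≥0∞, Measurable f → ∀ y,
    ∫⁻ x, u x y * f x ∂m = potentialOp S' β f y
  excessive : ∀ y ∈ D, IsExcessiveOn S β D fun x => u x y
  dual_excessive : ∀ x ∈ D, IsExcessiveOn S' β D fun y => u x y

end Potential

section Duality

variable {X Ω Ω' : Type*} [TopologicalSpace X] [MeasurableSpace X] [MeasurableSpace Ω]
  [MeasurableSpace Ω']

/-- The processes are dual with respect to `m`: for every `β > 0` there is a `β`-potential kernel
`U_β (x, y) = Û_β (y, x)`, which is `β`-excessive in `x` and `β`-co-excessive in `y`. -/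
def AreDual (m : Measure X) (H : HuntProcess X Ω) (H' : HuntProcess X Ω') : Prop :=
  ∀ β : ℝ, 0 < β → ∃ u : X → X → ℝ≥0∞, IsPotentialKernel m H.semigroup H'.semigroup β univ u

/-- `G` is the Green function of the open set `D` for the process `H` with dual `H'`: the potential
kernel of the dual pair of processes killed upon leaving `D`. The Green function of `D` for `H'`
is `(x, y) ↦ G y x`. -/
def IsGreenFunction (m : Measure X) (H : HuntProcess X Ω) (H' : HuntProcess X Ω') (D : Set X)
    (G : X → X → ℝ≥0∞) : Prop :=
  IsPotentialKernel m (H.killedSemigroup D) (H'.killedSemigroup D) 0 D G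

end Duality

section Scaling

variable {X : Type*} [MetricSpace X] [MeasurableSpace X]

/-- `X` is locally an Ahlfors regular `n`-space, with constant `c` and up to radius `ρ ≤ ∞`. -/
def IsLocallyAhlforsRegular (m : Measure X) (n : ℝ) (c : ℝ≥0) (ρ : ℝ≥0∞) : Prop :=
  ∀ (x : X) (r : ℝ), 0 < r → ENNReal.ofReal r < ρ →
    (c : ℝ≥0∞)⁻¹ * ENNReal.ofReal r ^ n ≤ m (Metric.ball x r) ∧
      m (Metric.ball x r) ≤ (c : ℝ≥0∞) * ENNReal.ofReal r ^ n

/-- `min (t^{-n/α}, t / d(x,y)^{n+α})`, computed in `[0, ∞]`; on the diagonal, for `t > 0`, the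
second term is `∞`, so that the minimum is `t^{-n/α}`. -/
def stableKernel (n α : ℝ) (t : ℝ≥0) (x y : X) : ℝ≥0∞ :=
  min ((t : ℝ≥0∞) ^ (-n / α)) ((t : ℝ≥0∞) / edist x y ^ (n + α))

/-- Two-sided bounds of `p` by the stable kernel with constant `c`, for `d (x, y) < r₀` and
`0 < t < r₀ ^ α`. -/
def HasStableBounds (n α : ℝ) (c : ℝ≥0) (r₀ : ℝ) (p : ℝ≥0 → X → X → ℝ≥0∞) : Prop :=
  ∀ (t : ℝ≥0) (x y : X), 0 < t → (t : ℝ) < r₀ ^ α → dist x y < r₀ →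
    (c : ℝ≥0∞)⁻¹ * stableKernel n α t x y ≤ p t x y ∧
      p t x y ≤ (c : ℝ≥0∞) * stableKernel n α t x y

/-- `sup_{x ∈ B(x₀, r)} max (E_x τ_B, Ê_x τ̂_B)`, where `B = B(x₀, r)`. -/
def exitConstant {Ω Ω' : Type*} [MeasurableSpace Ω] [MeasurableSpace Ω']
    (H : HuntProcess X Ω) (H' : HuntProcess X Ω') (x₀ : X) (r : ℝ) : ℝ≥0∞ :=
  ⨆ x ∈ Metric.ball x₀ r,
    max (H.meanExitTime (Metric.ball x₀ r) x) (H'.meanExitTime (Metric.ball x₀ r) x)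

/-- `sup_{x ∈ B(x₀, r)} sup_{y ∈ X ∖ B(x₀, p)} max (G(x, y), Ĝ(x, y))`, where `Ĝ(x, y) = G(y, x)`. -/
def greenConstant (G : X → X → ℝ≥0∞) (x₀ : X) (r p : ℝ) : ℝ≥0∞ :=
  ⨆ x ∈ Metric.ball x₀ r, ⨆ y ∈ (Metric.ball x₀ p)ᶜ, max (G x y) (G y x)

end Scaling

end

noncomputable section

open ProbabilityTheory

set_option linter.unusedSectionVars false

/-! The estimates rest on two bounds for the transition kernel: `T_t(x, A) ≤ c t^{-n/α} m(A)` for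
`A` near `x`, and `T_t(x, A) ≤ c t (a/2)^{-(n+α)} m(A)` for `A` at distance at least `a` from `x`.
The dual process inherits them (`hasUpperBounds_dual`): duality gives the bound at `m`-almost every
starting point, the strong Feller property of the dual makes the kernel continuous in the starting
point, and `m` charges every open set.

Exit times: for a ball `B` of radius `R` and `t₁ = κ R^α` with a suitable `κ`, the first bound and
Ahlfors regularity give `T_{t₁}(x, B) ≤ 1/2` for `x` in `B`. By the Markov property the process is
still in `B` at all of `0, t₁, ..., k t₁` with probability at most `2^{-k}`, so the mean exit time
is at most `2 t₁` (`meanExitTime_le`). The complement of a small ball is nonempty because the two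
sides of the Ahlfors condition at different radii are otherwise incompatible.

Green function bound (`green_le`): to bound the mean time spent in a set `A` at distance `η` from
`x`, split at `t₁`. Before `t₁` the second bound applies; after it, the first bound applies to the
last stretch of length `t₁`, and survival up to its start has integral at most `2 t₁`. Hence `G(x,
·) ≤ M` almost everywhere away from `x`. To pass to every `y`, write `G(x, y)` as the limit of
`T̂^B_t G(x, ·)(y)` as `t → 0`: near `y` the integrand is at most `M` almost everywhere, and the
part far from `y` has size `O(t)`.

Existence (`exists_isGreenFunction`): uniqueness of Laplace transforms and right-continuity turn
duality of the potentials into duality of `T_t` and `T̂_t` for each `t` (`kernel_dual`). For a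
compact set `F` the operators `(1_F T_h)^N 1_F` are then dual to their counterparts, and dyadic
refinement gives duality of the processes confined to `F`. Exhausting `B` by compact sets gives the
killed processes; quasi-left-continuity shows that nothing is lost (`ae_lt_exitTime_iff`). Dual
absolutely continuous semigroups have a common density that satisfies the Chapman-Kolmogorov
equation at every point (`exists_dual_density`), and its time integral is excessive in each
variable. -/

/-! ### Uniqueness of moments and Laplace transforms -/

/-- By Weierstrass, polynomials approximate every bounded continuous function uniformly on `[0, 1]`,
and their integrals are determined by the moments. -/
theorem ext_of_moments_Icc {μ ν : Measure ℝ} [IsFiniteMeasure μ] [IsFiniteMeasure ν]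
    (hμ : ∀ᵐ x ∂μ, x ∈ Icc (0 : ℝ) 1) (hν : ∀ᵐ x ∂ν, x ∈ Icc (0 : ℝ) 1)
    (h : ∀ k : ℕ, ∫ x, x ^ k ∂μ = ∫ x, x ^ k ∂ν) : μ = ν := by
  have hint : ∀ (ξ : Measure ℝ) [IsFiniteMeasure ξ], (∀ᵐ x ∂ξ, x ∈ Icc (0 : ℝ) 1) →
      ∀ g : ℝ → ℝ, Continuous g → Integrable g ξ := by
    intro ξ _ hξ g hg
    obtain ⟨C, hC⟩ := (isCompact_Icc (a := (0 : ℝ)) (b := 1)).exists_bound_of_continuousOn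
      hg.continuousOn
    exact Integrable.of_bound hg.aestronglyMeasurable C (hξ.mono fun x hx => hC x hx)
  have hpoly : ∀ q : Polynomial ℝ, ∫ x, q.eval x ∂μ = ∫ x, q.eval x ∂ν := by
    intro q
    simp_rw [Polynomial.eval_eq_sum_range]
    rw [integral_finsetSum _ fun i _ => hint μ hμ _ (by fun_prop),
      integral_finsetSum _ fun i _ => hint ν hν _ (by fun_prop)]
    simp_rw [integral_const_mul, h]
  refine ext_of_forall_integral_eq_of_IsFiniteMeasure fun f => ?_
  refine eq_of_forall_dist_le fun ε hε => ?_
  rw [Real.dist_eq]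
  set M : ℝ := μ.real univ + ν.real univ + 1 with hM
  have hMpos : 0 < M := by positivity
  obtain ⟨q, hq⟩ := exists_polynomial_near_of_continuousOn 0 1 f f.continuous.continuousOn (ε / M)
    (by positivity)
  have hq' : ∀ (ξ : Measure ℝ) [IsFiniteMeasure ξ], (∀ᵐ x ∂ξ, x ∈ Icc (0 : ℝ) 1) →
      |∫ x, q.eval x ∂ξ - ∫ x, f x ∂ξ| ≤ ε / M * ξ.real univ := by
    intro ξ _ hξ
    rw [← integral_sub (hint ξ hξ _ q.continuous) (hint ξ hξ _ f.continuous)]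
    exact norm_integral_le_of_norm_le_const (f := fun x => q.eval x - f x)
      (hξ.mono fun x hx => (hq x hx).le)
  have h1 := hq' μ hμ
  have h2 := hq' ν hν
  rw [hpoly q] at h1
  have h3 : ε / M * μ.real univ + ε / M * ν.real univ ≤ ε := by
    rw [← mul_add, div_mul_eq_mul_div, div_le_iff₀ hMpos]
    exact mul_le_mul_of_nonneg_left (by linarith) hε.le
  rw [abs_le] at h1 h2 ⊢
  constructor <;> linarith [h1.1, h1.2, h2.1, h2.2]

/-- Under `t ↦ e^{-t}` the measure `e^{-t} a(t) dt` becomes a finite measure on `[0, 1]` whose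
`k`-th moment is the Laplace transform of `a` at `k + 1`. The moments determine this measure, hence
its density almost everywhere. -/
theorem ae_eq_of_laplace_eq {a b : ℝ → ℝ≥0∞} (ha : Measurable a) (hb : Measurable b)
    {C : ℝ≥0} (haC : ∀ t, a t ≤ C) (hbC : ∀ t, b t ≤ C)
    (h : ∀ β : ℝ, 0 < β → ∫⁻ t in Ioi (0 : ℝ), ENNReal.ofReal (Real.exp (-β * t)) * a t =
      ∫⁻ t in Ioi (0 : ℝ), ENNReal.ofReal (Real.exp (-β * t)) * b t) :
    ∀ᵐ t ∂volume.restrict (Ioi (0 : ℝ)), a t = b t := by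
  set ν : Measure ℝ := volume.restrict (Ioi (0 : ℝ)) with hν
  have hexp : Measurable fun t : ℝ => ENNReal.ofReal (Real.exp (-t)) := by fun_prop
  have hfin : ∀ c : ℝ → ℝ≥0∞, (∀ t, c t ≤ C) →
      ∫⁻ t, ENNReal.ofReal (Real.exp (-t)) * c t ∂ν ≠ ∞ := by
    intro c hc
    have h1 : ∫⁻ t, ENNReal.ofReal (Real.exp (-t)) ∂ν = 1 := by
      rw [← ofReal_integral_eq_lintegral_ofReal (integrableOn_exp_neg_Ioi 0)
        (ae_of_all _ fun t => (Real.exp_pos _).le), integral_exp_neg_Ioi]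
      simp
    refine ne_top_of_le_ne_top (b := (C : ℝ≥0∞)) ENNReal.coe_ne_top ?_
    calc _ ≤ ∫⁻ t, ENNReal.ofReal (Real.exp (-t)) * C ∂ν :=
          lintegral_mono fun t => mul_le_mul_right (hc t) _
      _ = C := by rw [lintegral_mul_const _ hexp, h1, one_mul]
  let M : (ℝ → ℝ≥0∞) → Measure ℝ := fun c =>
    ν.withDensity fun t => ENNReal.ofReal (Real.exp (-t)) * c t
  have hMf : ∀ c : ℝ → ℝ≥0∞, (∀ t, c t ≤ C) → IsFiniteMeasure (M c) := fun c hc =>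
    isFiniteMeasure_withDensity (hfin c hc)
  have hE : Measurable fun t : ℝ => Real.exp (-t) := by fun_prop
  have hsupp : ∀ c : ℝ → ℝ≥0∞, ∀ᵐ x ∂(M c).map fun t : ℝ => Real.exp (-t),
      x ∈ Icc (0 : ℝ) 1 := by
    intro c
    refine (ae_map_iff hE.aemeasurable measurableSet_Icc).2 ?_
    refine (withDensity_absolutelyContinuous _ _).ae_le ?_
    filter_upwards [ae_restrict_mem (measurableSet_Ioi (a := (0 : ℝ)))] with t ht
    exact ⟨(Real.exp_pos _).le, Real.exp_le_one_iff.2 (by simpa using ht.le)⟩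
  have hmom : ∀ c : ℝ → ℝ≥0∞, Measurable c → ∀ k : ℕ,
      ∫ x, x ^ k ∂(M c).map (fun t : ℝ => Real.exp (-t)) =
      (∫⁻ t in Ioi (0 : ℝ), ENNReal.ofReal (Real.exp (-((k : ℝ) + 1) * t)) * c t).toReal := by
    intro c hc k
    rw [integral_map hE.aemeasurable (by fun_prop), integral_eq_lintegral_of_nonneg_ae
      (ae_of_all _ fun t => by positivity) (by fun_prop)]
    congr 1
    refine (lintegral_withDensity_eq_lintegral_mul ν (hexp.mul hc) (by fun_prop)).trans ?_
    refine lintegral_congr fun t => ?_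
    simp only [Pi.mul_apply]
    rw [mul_right_comm, ← ENNReal.ofReal_mul (Real.exp_pos _).le, ← Real.exp_nat_mul, ← Real.exp_add]
    congr 3
    ring
  have hmap : (M a).map (fun t : ℝ => Real.exp (-t)) = (M b).map fun t : ℝ => Real.exp (-t) := by
    have := hMf a haC
    have := hMf b hbC
    refine ext_of_moments_Icc (hsupp a) (hsupp b) fun k => ?_
    rw [hmom a ha, hmom b hb, h _ (by positivity)]
  have hMM : M a = M b := by
    have h2 := congrArg (fun ξ : Measure ℝ => ξ.map fun x => -Real.log x) hmap
    beta_reduce at h2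
    rw [Measure.map_map (by fun_prop) hE, Measure.map_map (by fun_prop) hE] at h2
    have h3 : ((fun x => -Real.log x) ∘ fun t : ℝ => Real.exp (-t)) = id := by
      funext t; simp
    simpa [h3] using h2
  have h4 := (withDensity_eq_iff (hexp.mul ha).aemeasurable (hexp.mul hb).aemeasurable
    (hfin a haC)).1 hMM
  filter_upwards [h4] with t ht
  have h5 : ENNReal.ofReal (Real.exp (-t)) ≠ 0 := by simp [Real.exp_pos]
  exact (ENNReal.mul_right_inj h5 ENNReal.ofReal_ne_top).1 ht

/-! ### Joint measurability in time and space -/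

theorem measurable_apply_countable_index {X : Type*} [MeasurableSpace X]
    {φ : ℝ≥0 → X → ℝ≥0∞} (hm : ∀ t, Measurable (φ t)) (e : ℕ → ℝ≥0) {g : ℝ≥0 → ℕ}
    (hg : Measurable g) : Measurable fun z : ℝ≥0 × X => φ (e (g z.1)) z.2 := by
  have h1 : Measurable (fun q : ℕ × X => φ (e q.1) q.2) :=
    measurable_from_prod_countable_right fun i => hm (e i)
  have h2 : Measurable fun z : ℝ≥0 × X => (g z.1, z.2) :=
    (hg.comp measurable_fst).prodMk measurable_snd
  exact h1.comp h2

/-- A function which is right-continuous in `t` and measurable in `x` is jointly measurable. -/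
theorem measurable_uncurry_of_rightCont {X : Type*} [MeasurableSpace X]
    {φ : ℝ≥0 → X → ℝ≥0∞} (hm : ∀ t, Measurable (φ t))
    (hr : ∀ x t, ContinuousWithinAt (fun s => φ s x) (Ioi t) t) :
    Measurable (Function.uncurry φ) := by
  -- `d k t` is the first multiple of `1 / (k + 1)` strictly above `t`: it takes countably many
  -- values and tends to `t` from the right.
  let d : ℕ → ℝ≥0 → ℝ≥0 := fun k t => ((⌊t * (k + 1)⌋₊ : ℝ≥0) + 1) / (k + 1)
  have hd : ∀ t, Tendsto (fun k => d k t) atTop (𝓝[>] t) := by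
    intro t
    have hlt : ∀ k, t < d k t := fun k => by
      rw [lt_div_iff₀ (by positivity)]
      exact Nat.lt_floor_add_one _
    refine tendsto_nhdsWithin_iff.2 ⟨?_, Eventually.of_forall hlt⟩
    have hle : ∀ k, d k t ≤ t + 1 / ((k : ℝ≥0) + 1) := fun k => by
      rw [div_le_iff₀ (by positivity), add_mul, one_div, inv_mul_cancel₀ (by positivity)]
      gcongr
      exact Nat.floor_le (by positivity)
    refine tendsto_of_tendsto_of_tendsto_of_le_of_le tendsto_const_nhds ?_ (fun k => (hlt k).le) hle
    have : Tendsto (fun k : ℕ => 1 / ((k : ℝ≥0) + 1)) atTop (𝓝 0) :=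
      tendsto_one_div_add_atTop_nhds_zero_nat
    simpa using this.const_add t
  have hmeas : ∀ k, Measurable fun z : ℝ≥0 × X => φ (d k z.1) z.2 :=
    fun k => measurable_apply_countable_index hm (fun i : ℕ => ((i : ℝ≥0) + 1) / (k + 1))
      (g := fun t : ℝ≥0 => ⌊t * (k + 1)⌋₊) (Nat.measurable_floor.comp (measurable_id.mul_const _))
  refine measurable_of_tendsto_metrizable hmeas (tendsto_pi_nhds.2 fun z => ?_)
  exact (hr z.2 z.1).tendsto.comp (hd z.1)

/-- Closed sets form a generating π-system, and the indicator of a closed set is a limit of bounded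
continuous functions. -/
theorem measurable_of_lintegral_boundedContinuous {A X : Type*} [MeasurableSpace A]
    [TopologicalSpace X] [MeasurableSpace X] [HasOuterApproxClosed X] [BorelSpace X]
    {κ : A → Measure X} [∀ a, IsFiniteMeasure (κ a)]
    (h : ∀ f : BoundedContinuousFunction X ℝ≥0, Measurable fun a => ∫⁻ x, f x ∂κ a) :
    Measurable κ := by
  have hcl : ∀ F : Set X, IsClosed F → Measurable fun a => κ a F := by
    intro F hF
    refine measurable_of_tendsto_metrizable (fun n => h (hF.apprSeq n)) (tendsto_pi_nhds.2 fun a => ?_)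
    exact HasOuterApproxClosed.tendsto_lintegral_apprSeq hF (κ a)
  refine Measurable.measure_of_isPiSystem ?_ isPiSystem_isClosed (fun s hs => hcl s hs)
    (hcl _ isClosed_univ)
  rw [BorelSpace.measurable_eq (α := X), borel_eq_generateFrom_isClosed]

/-! ### Measures and dual kernels tested on functions with bounded support -/

section Metric

variable {X : Type*} [MetricSpace X] [MeasurableSpace X] [BorelSpace X]

/-- A measure is determined by its values on bounded measurable sets. -/
theorem measure_ext_of_subset_ball {ν ξ : Measure X}  (x₀ : X)
    (h : ∀ (N : ℕ) (E : Set X), MeasurableSet E → E ⊆ Metric.ball x₀ N → ν E = ξ E) : ν = ξ := by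
  refine Measure.ext fun E hE => ?_
  have hmono : Monotone fun N : ℕ => E ∩ Metric.ball x₀ N := fun a b hab =>
    inter_subset_inter_right _ (Metric.ball_subset_ball (by exact_mod_cast hab))
  have hU : E = ⋃ N : ℕ, E ∩ Metric.ball x₀ N := by
    rw [← inter_iUnion, Metric.iUnion_ball_nat, inter_univ]
  rw [hU, hmono.measure_iUnion, hmono.measure_iUnion]
  exact iSup_congr fun N => h N _ (hE.inter measurableSet_ball) inter_subset_right

/-- A finite measure is determined by the integrals of bounded continuous functions with bounded
support. -/
theorem measure_ext_of_boundedSupport {ν ξ : Measure X} [IsFiniteMeasure ν] (x₀ : X)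
    (h : ∀ f : BoundedContinuousFunction X ℝ≥0,
      (∃ N : ℕ, ∀ x, x ∉ Metric.ball x₀ N → f x = 0) → ∫⁻ x, f x ∂ν = ∫⁻ x, f x ∂ξ) : ν = ξ := by
  refine measure_ext_of_subset_ball x₀ fun N E hE hEN => ?_
  -- A cutoff equal to `1` on the ball of radius `N` and `0` outside the ball of radius `N + 1`.
  -- After multiplication by `φ`, every bounded continuous test function has bounded support.
  let φ : BoundedContinuousFunction X ℝ≥0 := thickenedIndicator zero_lt_one (Metric.ball x₀ N)
  have hφm : Measurable fun x => (φ x : ℝ≥0∞) := φ.continuous.measurable.coe_nnreal_ennreal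
  have hφ : ν.withDensity (fun x => (φ x : ℝ≥0∞)) = ξ.withDensity fun x => (φ x : ℝ≥0∞) := by
    have : IsFiniteMeasure (ν.withDensity fun x => (φ x : ℝ≥0∞)) :=
      isFiniteMeasure_withDensity (BoundedContinuousFunction.lintegral_lt_top_of_nnreal ν φ).ne
    refine ext_of_forall_lintegral_eq_of_IsFiniteMeasure fun f => ?_
    have hfm : Measurable fun x => (f x : ℝ≥0∞) := f.continuous.measurable.coe_nnreal_ennreal
    rw [lintegral_withDensity_eq_lintegral_mul _ hφm hfm,
      lintegral_withDensity_eq_lintegral_mul _ hφm hfm]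
    have := h (φ * f) ⟨N + 1, fun x hx => ?_⟩
    · simpa using this
    · have : φ x = 0 := thickenedIndicator_zero zero_lt_one _ fun hx' => hx <| by
        push_cast
        rw [add_comm]
        exact Metric.thickening_ball _ _ _ hx'
      simp [this]
  have hval : ∀ ζ : Measure X, ζ.withDensity (fun x => (φ x : ℝ≥0∞)) E = ζ E := by
    intro ζ
    rw [withDensity_apply _ hE, setLIntegral_congr_fun (g := fun _ => 1) hE, setLIntegral_one]
    intro x hx
    have : φ x = 1 := thickenedIndicator_one zero_lt_one _ (hEN hx)
    simp [this]
  rw [← hval ν, hφ, hval ξ]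

theorem lintegral_lt_top_of_boundedSupport [ProperSpace X] (m : Measure X)
    [IsLocallyFiniteMeasure m] {x₀ : X} {f : BoundedContinuousFunction X ℝ≥0} {N : ℕ}
    (hN : ∀ x, x ∉ Metric.ball x₀ N → f x = 0) : ∫⁻ x, f x ∂m < ∞ := by
  have : IsFiniteMeasure (m.restrict (Metric.ball x₀ N)) := ⟨by
    simpa using measure_ball_lt_top⟩
  have h := BoundedContinuousFunction.lintegral_lt_top_of_nnreal (m.restrict (Metric.ball x₀ N)) f
  rwa [setLIntegral_eq_of_support_subset] at h
  intro x hx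
  by_contra hx'
  exact hx (by simp [hN x hx'])

/-- Duality of two kernels extends from continuous functions with bounded support to all
measurable functions. -/
theorem duality_of_boundedSupport [ProperSpace X] (m : Measure X)
    [IsLocallyFiniteMeasure m] (x₀ : X) (κ κ' : Kernel X X) [IsFiniteKernel κ] [IsFiniteKernel κ']
    (h : ∀ f g : BoundedContinuousFunction X ℝ≥0,
      (∃ N : ℕ, ∀ x, x ∉ Metric.ball x₀ N → f x = 0) →
      (∃ N : ℕ, ∀ x, x ∉ Metric.ball x₀ N → g x = 0) →
      ∫⁻ x, f x * ∫⁻ y, g y ∂κ x ∂m = ∫⁻ y, g y * ∫⁻ x, f x ∂κ' y ∂m)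
    {f g : X → ℝ≥0∞} (hf : Measurable f) (hg : Measurable g) :
    ∫⁻ x, f x * ∫⁻ y, g y ∂κ x ∂m = ∫⁻ y, g y * ∫⁻ x, f x ∂κ' y ∂m := by
  have hb : ∀ (P : Kernel X X) (f g : X → ℝ≥0∞), Measurable f → Measurable g →
      ∫⁻ y, g y ∂(m.withDensity f).bind P = ∫⁻ x, f x * ∫⁻ y, g y ∂P x ∂m := by
    intro P f g hf hg
    rw [Measure.lintegral_bind P.aemeasurable hg.aemeasurable,
      lintegral_withDensity_eq_lintegral_mul _ hf hg.lintegral_kernel]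
    rfl
  have hd : ∀ (P : Kernel X X) (f g : X → ℝ≥0∞), Measurable f → Measurable g →
      ∫⁻ y, g y ∂m.withDensity (fun y => ∫⁻ x, f x ∂P y) = ∫⁻ y, g y * ∫⁻ x, f x ∂P y ∂m := by
    intro P f g hf hg
    rw [lintegral_withDensity_eq_lintegral_mul _ hf.lintegral_kernel hg]
    simp_rw [Pi.mul_apply, mul_comm]
  have hfin : ∀ (P : Kernel X X) [IsFiniteKernel P] (f : X → ℝ≥0∞), Measurable f →
      ∫⁻ x, f x ∂m < ∞ → IsFiniteMeasure ((m.withDensity f).bind P) := by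
    intro P _ f hf hff
    have := isFiniteMeasure_withDensity hff.ne
    infer_instance
  -- For fixed `f` of bounded support both sides are integrals of `g` against measures, one of them
  -- finite; these agree on test functions, so `g` may be arbitrary.
  have hA : ∀ (f : BoundedContinuousFunction X ℝ≥0), (∃ N : ℕ, ∀ x, x ∉ Metric.ball x₀ N → f x = 0) →
      ∀ g : X → ℝ≥0∞, Measurable g →
      ∫⁻ x, f x * ∫⁻ y, g y ∂κ x ∂m = ∫⁻ y, g y * ∫⁻ x, f x ∂κ' y ∂m := by
    rintro f ⟨N, hN⟩ g hg
    have hfm : Measurable fun x => (f x : ℝ≥0∞) := f.continuous.measurable.coe_nnreal_ennreal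
    have := hfin κ (fun x => (f x : ℝ≥0∞)) hfm (lintegral_lt_top_of_boundedSupport m hN)
    rw [← hb κ _ _ hfm hg, ← hd κ' _ _ hfm hg]
    congr 1
    refine measure_ext_of_boundedSupport x₀ fun g hgN => ?_
    have hgm : Measurable fun x => (g x : ℝ≥0∞) := g.continuous.measurable.coe_nnreal_ennreal
    rw [hb κ _ _ hfm hgm, hd κ' _ _ hfm hgm, h f g ⟨N, hN⟩ hgN]
  -- The same argument with the roles exchanged: `1_E` with `E` bounded makes the dual measure
  -- finite, which frees `f`.
  have hB : ∀ (N : ℕ) (E : Set X), MeasurableSet E → E ⊆ Metric.ball x₀ N →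
      ∀ f : X → ℝ≥0∞, Measurable f → ∫⁻ x, f x * κ x E ∂m = ∫⁻ y in E, ∫⁻ x, f x ∂κ' y ∂m := by
    intro N E hE hEN f hf
    have hEm : Measurable (E.indicator (1 : X → ℝ≥0∞)) := measurable_one.indicator hE
    have : IsFiniteMeasure ((m.withDensity (E.indicator 1)).bind κ') := by
      refine hfin κ' _ hEm ?_
      rw [lintegral_indicator_one hE]
      exact (measure_mono hEN).trans_lt measure_ball_lt_top
    have key : (m.withDensity (E.indicator 1)).bind κ' =
        m.withDensity fun x => ∫⁻ y, E.indicator 1 y ∂κ x := by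
      refine measure_ext_of_boundedSupport x₀ fun f hfN => ?_
      have hfm : Measurable fun x => (f x : ℝ≥0∞) := f.continuous.measurable.coe_nnreal_ennreal
      rw [hb κ' _ _ hEm hfm, hd κ _ _ hEm hfm, hA f hfN _ hEm]
    have h2 := hd κ _ _ hEm hf
    rw [← key, hb κ' _ _ hEm hf] at h2
    simp_rw [lintegral_indicator_one hE] at h2
    rw [← h2, ← lintegral_indicator hE]
    refine lintegral_congr fun x => ?_
    by_cases hx : x ∈ E <;> simp [hx]
  rw [← hb κ _ _ hf hg, ← hd κ' _ _ hf hg]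
  congr 1
  refine measure_ext_of_subset_ball x₀ fun N E hE hEN => ?_
  have hEm : Measurable (E.indicator (1 : X → ℝ≥0∞)) := measurable_one.indicator hE
  rw [← lintegral_indicator_one hE, hb κ _ _ hf hEm, withDensity_apply _ hE]
  simp_rw [lintegral_indicator_one hE]
  exact hB N E hE hEN f hf

end Metric

/-! ### A common density for two semigroups in duality -/

section Density

variable {X : Type*} [MeasurableSpace X] {μ : Measure X}

/-- The convolution of two densities, which is a version of the density of `κ (s + u, ·)`. -/
def convDensity (μ : Measure X) (q q' : ℝ≥0 → X → X → ℝ≥0∞) (s u : ℝ≥0) (x y : X) : ℝ≥0∞ :=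
  ∫⁻ z, q s x z * q' u y z ∂μ

theorem convDensity_swap (q q' : ℝ≥0 → X → X → ℝ≥0∞) (s u : ℝ≥0) (x y : X) :
    convDensity μ q q' s u x y = convDensity μ q' q u s y x := by
  simp_rw [convDensity, mul_comm]

variable [IsFiniteMeasure μ] {κ κ' : Kernel (ℝ≥0 × X) X}

/-- By duality, `y ↦ q' u y z` is a density of `κ (u, z)` for almost every `z`. The exceptional set
of `z` is harmless because `κ (s, x)` has a density, and the semigroup property concludes. -/
theorem lintegral_convDensity {q q' : ℝ≥0 → X → X → ℝ≥0∞}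
    (hq : Measurable fun z : (ℝ≥0 × X) × X => q z.1.1 z.1.2 z.2)
    (hq' : Measurable fun z : (ℝ≥0 × X) × X => q' z.1.1 z.1.2 z.2)
    (hκ : ∀ t : ℝ≥0, 0 < t → ∀ x (f : X → ℝ≥0∞), Measurable f →
      ∫⁻ y, f y ∂κ (t, x) = ∫⁻ y, q t x y * f y ∂μ)
    (hκ' : ∀ t : ℝ≥0, 0 < t → ∀ x (f : X → ℝ≥0∞), Measurable f →
      ∫⁻ y, f y ∂κ' (t, x) = ∫⁻ y, q' t x y * f y ∂μ)
    (hsg : ∀ s t : ℝ≥0, 0 < s → 0 < t → ∀ x (f : X → ℝ≥0∞), Measurable f →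
      ∫⁻ y, f y ∂κ (s + t, x) = ∫⁻ z, ∫⁻ y, f y ∂κ (t, z) ∂κ (s, x))
    (hdual : ∀ t : ℝ≥0, 0 < t → ∀ f g : X → ℝ≥0∞, Measurable f → Measurable g →
      ∫⁻ x, f x * ∫⁻ y, g y ∂κ (t, x) ∂μ = ∫⁻ y, g y * ∫⁻ x, f x ∂κ' (t, y) ∂μ)
    {s u : ℝ≥0} (hs : 0 < s) (hu : 0 < u) (x : X) {f : X → ℝ≥0∞} (hf : Measurable f) :
    ∫⁻ y, convDensity μ q q' s u x y * f y ∂μ = ∫⁻ y, f y ∂κ (s + u, x) := by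
  have hq1 : Measurable (q s x) :=
    hq.comp (f := fun z => ((s, x), z)) (measurable_const.prodMk measurable_id)
  have hq1' : Measurable fun z : X × X => q' u z.1 z.2 :=
    hq'.comp (f := fun z : X × X => ((u, z.1), z.2))
      ((measurable_const.prodMk measurable_fst).prodMk measurable_snd)
  have hq2' : ∀ y, Measurable (q' u y) := fun y =>
    hq1'.comp (measurable_const.prodMk measurable_id)
  have hq3' : ∀ z, Measurable fun y => q' u y z := fun z =>
    hq1'.comp (measurable_id.prodMk measurable_const)
  have hκm : Measurable fun z => ∫⁻ y, f y ∂κ (u, z) :=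
    hf.lintegral_kernel.comp (measurable_const.prodMk measurable_id)
  have hqf : Measurable fun z : X × X => q' u z.2 z.1 * f z.2 :=
    (hq1'.comp measurable_swap).mul (hf.comp measurable_snd)
  have hae : ∀ᵐ z ∂μ, ∫⁻ y, q' u y z * f y ∂μ = ∫⁻ y, f y ∂κ (u, z) := by
    refine ae_eq_of_forall_setLIntegral_eq_of_sigmaFinite hqf.lintegral_prod_right' hκm
      fun A hA _ => ?_
    have hA1 : Measurable (A.indicator (1 : X → ℝ≥0∞)) := measurable_one.indicator hA
    have h1 := hdual u hu (A.indicator 1) f hA1 hf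
    have h2 : ∫⁻ z, A.indicator 1 z * ∫⁻ y, f y ∂κ (u, z) ∂μ =
        ∫⁻ z in A, ∫⁻ y, f y ∂κ (u, z) ∂μ := by
      rw [← lintegral_indicator hA]
      refine lintegral_congr fun z => ?_
      by_cases hz : z ∈ A <;> simp [hz]
    rw [← h2, h1, lintegral_lintegral_swap hqf.aemeasurable]
    refine lintegral_congr fun y => ?_
    rw [hκ' u hu y _ hA1, lintegral_mul_const _ (hq2' y), mul_comm, ← lintegral_indicator hA]
    congr 1
    refine lintegral_congr fun z => ?_
    by_cases hz : z ∈ A <;> simp [hz]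
  calc ∫⁻ y, convDensity μ q q' s u x y * f y ∂μ
      = ∫⁻ y, ∫⁻ z, q s x z * (q' u y z * f y) ∂μ ∂μ := by
        refine lintegral_congr fun y => ?_
        have hm : Measurable fun z => q s x z * q' u y z := hq1.mul (hq2' y)
        rw [convDensity, ← lintegral_mul_const _ hm]
        simp_rw [mul_assoc]
    _ = ∫⁻ z, ∫⁻ y, q s x z * (q' u y z * f y) ∂μ ∂μ := by
        rw [lintegral_lintegral_swap]
        exact ((hq1.comp measurable_snd).mul (hqf.comp measurable_swap)).aemeasurable
    _ = ∫⁻ z, q s x z * ∫⁻ y, f y ∂κ (u, z) ∂μ := by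
        refine lintegral_congr_ae (hae.mono fun z hz => ?_)
        have hm : Measurable fun y => q' u y z * f y := (hq3' z).mul hf
        beta_reduce
        rw [lintegral_const_mul _ hm, hz]
    _ = ∫⁻ y, f y ∂κ (s + u, x) := by rw [hsg s u hs hu x f hf, hκ s hs x _ hκm]

/-- Two absolutely continuous semigroups in duality have a common transition density, which
satisfies the Chapman-Kolmogorov equation everywhere. -/
theorem exists_dual_density [MeasurableSpace.CountablyGenerated X] [IsFiniteKernel κ]
    [IsFiniteKernel κ']
    (hac : ∀ t : ℝ≥0, 0 < t → ∀ x, κ (t, x) ≪ μ) (hac' : ∀ t : ℝ≥0, 0 < t → ∀ x, κ' (t, x) ≪ μ)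
    (hsg : ∀ s t : ℝ≥0, 0 < s → 0 < t → ∀ x (f : X → ℝ≥0∞), Measurable f →
      ∫⁻ y, f y ∂κ (s + t, x) = ∫⁻ z, ∫⁻ y, f y ∂κ (t, z) ∂κ (s, x))
    (hsg' : ∀ s t : ℝ≥0, 0 < s → 0 < t → ∀ x (f : X → ℝ≥0∞), Measurable f →
      ∫⁻ y, f y ∂κ' (s + t, x) = ∫⁻ z, ∫⁻ y, f y ∂κ' (t, z) ∂κ' (s, x))
    (hdual : ∀ t : ℝ≥0, 0 < t → ∀ f g : X → ℝ≥0∞, Measurable f → Measurable g →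
      ∫⁻ x, f x * ∫⁻ y, g y ∂κ (t, x) ∂μ = ∫⁻ y, g y * ∫⁻ x, f x ∂κ' (t, y) ∂μ) :
    ∃ p : ℝ≥0 → X → X → ℝ≥0∞, Measurable (fun z : ℝ≥0 × X × X => p z.1 z.2.1 z.2.2) ∧
      (∀ t : ℝ≥0, 0 < t → ∀ x (f : X → ℝ≥0∞), Measurable f →
        ∫⁻ y, p t x y * f y ∂μ = ∫⁻ y, f y ∂κ (t, x)) ∧
      (∀ t : ℝ≥0, 0 < t → ∀ y (f : X → ℝ≥0∞), Measurable f →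
        ∫⁻ x, p t x y * f x ∂μ = ∫⁻ x, f x ∂κ' (t, y)) ∧
      ∀ s t : ℝ≥0, 0 < s → 0 < t → ∀ x y, ∫⁻ z, p s x z * p t z y ∂μ = p (s + t) x y := by
  have hex : ∀ (ξ : Kernel (ℝ≥0 × X) X) [IsFiniteKernel ξ],
      (∀ t : ℝ≥0, 0 < t → ∀ x, ξ (t, x) ≪ μ) → ∃ q : ℝ≥0 → X → X → ℝ≥0∞,
      Measurable (fun z : (ℝ≥0 × X) × X => q z.1.1 z.1.2 z.2) ∧
      ∀ t : ℝ≥0, 0 < t → ∀ x (f : X → ℝ≥0∞), Measurable f →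
      ∫⁻ y, f y ∂ξ (t, x) = ∫⁻ y, q t x y * f y ∂μ := by
    intro ξ _ hξ
    have hm := Kernel.measurable_rnDeriv ξ (Kernel.const (ℝ≥0 × X) μ)
    refine ⟨fun t x y => ξ.rnDeriv (Kernel.const _ μ) (t, x) y, hm, fun t ht x f hf => ?_⟩
    have h1 := Kernel.withDensity_rnDeriv_eq (κ := ξ) (η := Kernel.const (ℝ≥0 × X) μ) (a := (t, x))
      (by simpa using hξ t ht x)
    rw [Kernel.withDensity_apply _ hm, Kernel.const_apply] at h1
    conv_lhs => rw [← h1]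
    rw [lintegral_withDensity_eq_lintegral_mul _
      (Kernel.measurable_rnDeriv_right ξ (Kernel.const (ℝ≥0 × X) μ) (t, x)) hf]
    rfl
  obtain ⟨q, hq, hκ⟩ := hex κ hac
  obtain ⟨q', hq', hκ'⟩ := hex κ' hac'
  have hdual' : ∀ t : ℝ≥0, 0 < t → ∀ f g : X → ℝ≥0∞, Measurable f → Measurable g →
      ∫⁻ x, f x * ∫⁻ y, g y ∂κ' (t, x) ∂μ = ∫⁻ y, g y * ∫⁻ x, f x ∂κ (t, y) ∂μ :=
    fun t ht f g hf hg => (hdual t ht g f hg hf).symm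
  have hD : ∀ {s u : ℝ≥0}, 0 < s → 0 < u → ∀ x {f : X → ℝ≥0∞}, Measurable f →
      ∫⁻ y, convDensity μ q q' s u x y * f y ∂μ = ∫⁻ y, f y ∂κ (s + u, x) :=
    fun hs hu x f hf => lintegral_convDensity hq hq' hκ hκ' hsg hdual hs hu x hf
  have hD' : ∀ {s u : ℝ≥0}, 0 < s → 0 < u → ∀ y {f : X → ℝ≥0∞}, Measurable f →
      ∫⁻ x, convDensity μ q q' s u x y * f x ∂μ = ∫⁻ x, f x ∂κ' (u + s, y) := by
    intro s u hs hu y f hf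
    simp_rw [convDensity_swap (μ := μ) q q']
    exact lintegral_convDensity hq' hq hκ' hκ hsg' hdual' hu hs y hf
  have hqx : ∀ t x, Measurable (q t x) := fun t x =>
    hq.comp (f := fun z => ((t, x), z)) (measurable_const.prodMk measurable_id)
  have hqx' : ∀ t x, Measurable (q' t x) := fun t x =>
    hq'.comp (f := fun z => ((t, x), z)) (measurable_const.prodMk measurable_id)
  have hcm : Measurable fun z : (ℝ≥0 × ℝ≥0) × X × X =>
      convDensity μ q q' z.1.1 z.1.2 z.2.1 z.2.2 := by
    refine Measurable.lintegral_prod_right' (f := fun w : ((ℝ≥0 × ℝ≥0) × X × X) × X =>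
      q w.1.1.1 w.1.2.1 w.2 * q' w.1.1.2 w.1.2.2 w.2) ?_
    exact (hq.comp (f := fun w : ((ℝ≥0 × ℝ≥0) × X × X) × X => ((w.1.1.1, w.1.2.1), w.2))
      (by fun_prop)).mul
      (hq'.comp (f := fun w : ((ℝ≥0 × ℝ≥0) × X × X) × X => ((w.1.1.2, w.1.2.2), w.2))
      (by fun_prop))
  have hcl : ∀ s u y, Measurable fun x => convDensity μ q q' s u x y := fun s u y =>
    hcm.comp (f := fun x => ((s, u), x, y)) (by fun_prop)
  -- A piece `v` of the time can be moved from the second factor to the first. Read `q'` as a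
  -- density of `κ'` at time `u + v`, exchange it for the version `convDensity v u`, then absorb the
  -- step of length `v` into `κ`. Consequently `convDensity s u` depends on `s + u` alone, at every
  -- point and not just almost everywhere.
  have hshift : ∀ s u v : ℝ≥0, 0 < s → 0 < u → 0 < v → ∀ x y,
      convDensity μ q q' s (u + v) x y = convDensity μ q q' (s + v) u x y := by
    intro s u v hs hu hv x y
    calc convDensity μ q q' s (u + v) x y = ∫⁻ z, q s x z ∂κ' (u + v, y) := by
          rw [hκ' _ (by positivity) _ _ (hqx s x), convDensity]
          simp_rw [mul_comm]
      _ = ∫⁻ z, q s x z * convDensity μ q q' v u z y ∂μ := by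
          rw [← hD' hv hu y (hqx s x)]
          simp_rw [mul_comm]
      _ = ∫⁻ z, ∫⁻ w, q' u y w ∂κ (v, z) ∂κ (s, x) := by
          rw [← hκ s hs x _ (hcl v u y)]
          refine lintegral_congr fun z => ?_
          rw [hκ v hv z _ (hqx' u y), convDensity]
      _ = convDensity μ q q' (s + v) u x y := by
          rw [← hsg s v hs hv x _ (hqx' u y), hκ _ (by positivity) _ _ (hqx' u y), convDensity]
  have hindep : ∀ s u s' u' : ℝ≥0, 0 < s → 0 < u → 0 < s' → 0 < u' → s + u = s' + u' → ∀ x y,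
      convDensity μ q q' s u x y = convDensity μ q q' s' u' x y := by
    have aux : ∀ s u s' u' : ℝ≥0, 0 < s → 0 < u → 0 < s' → 0 < u' → s + u = s' + u' → s ≤ s' →
        ∀ x y, convDensity μ q q' s u x y = convDensity μ q q' s' u' x y := by
      intro s u s' u' hs hu hs' hu' h hle x y
      obtain ⟨v, rfl⟩ := exists_add_of_le hle
      have hu2 : u = u' + v := by
        rw [add_assoc] at h
        rw [add_left_cancel h, add_comm]
      subst hu2
      rcases eq_or_lt_of_le (zero_le (a := v)) with rfl | hv
      · simp
      · exact hshift s u' v hs hu' hv x y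
    intro s u s' u' hs hu hs' hu' h x y
    rcases le_total s s' with hle | hle
    · exact aux s u s' u' hs hu hs' hu' h hle x y
    · exact (aux s' u' s u hs' hu' hs hu h.symm hle x y).symm
  -- Any splitting of `t` into two positive times would serve; halves make the choice canonical and
  -- jointly measurable.
  refine ⟨fun t x y => convDensity μ q q' (t / 2) (t / 2) x y, ?_, ?_, ?_, ?_⟩
  · exact hcm.comp (f := fun z : ℝ≥0 × X × X => ((z.1 / 2, z.1 / 2), z.2.1, z.2.2)) (by fun_prop)
  · intro t ht x f hf
    rw [hD (half_pos ht) (half_pos ht) x hf, add_halves]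
  · intro t ht y f hf
    rw [hD' (half_pos ht) (half_pos ht) y hf, add_halves]
  · intro s t hs ht x y
    have hs2 := half_pos hs
    have ht2 := half_pos ht
    have hst : 0 < (s + t) / 2 := by positivity
    have h1 : Measurable fun z => convDensity μ q q' (t / 2) (t / 2) z y := hcl _ _ y
    -- The left factor is a density of `κ (s, x)` and may be replaced by `q s x`; the right one is a
    -- density of `κ' (t, y)` and may be replaced by `q' t y`. What remains is `convDensity s t`.
    rw [hD hs2 hs2 x h1, add_halves, hκ s hs x _ h1]
    simp_rw [mul_comm (q s x _)]
    rw [hD' ht2 ht2 y (hqx s x), add_halves, hκ' t ht y _ (hqx s x)]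
    simp_rw [mul_comm (q' t y _)]
    exact hindep s t _ _ hs ht hst hst (by rw [add_halves]) x y

end Density

/-! ### Transition kernels and the Markov property on a time grid -/

@[simp] theorem extendZero_coe {X Y : Type*} [Zero Y] (f : X → Y) (x : X) :
    extendZero f (x : OnePoint X) = f x := rfl

@[simp] theorem extendZero_infty {X Y : Type*} [Zero Y] (f : X → Y) :
    extendZero f (OnePoint.infty : OnePoint X) = 0 := rfl

namespace HuntProcess

variable {X Ω : Type*} [TopologicalSpace X] [MeasurableSpace X] [mΩ : MeasurableSpace Ω]
  (H : HuntProcess X Ω)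

instance (x : X) : IsProbabilityMeasure (H.prob x) := H.isProbability x

/-- The position at time `t`, with the cemetery replaced by `x`. -/
def pos (x : X) (t : ℝ≥0) (ω : Ω) : X := (H.path t ω).elim x id

/-- The event that the process is alive at time `t`. -/
def living (t : ℝ≥0) : Set Ω := H.path t ⁻¹' ((↑) '' (univ : Set X))

theorem measurableSet_living (t : ℝ≥0) : MeasurableSet[H.filt t] (H.living t) :=
  H.adapted t _ MeasurableSet.univ

theorem mem_living {t : ℝ≥0} {ω : Ω} : ω ∈ H.living t ↔ H.path t ω ≠ OnePoint.infty := by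
  simp [living, OnePoint.ne_infty_iff_exists]

theorem living_cases (t : ℝ≥0) (ω : Ω) :
    (ω ∉ H.living t ∧ H.path t ω = OnePoint.infty) ∨
      ω ∈ H.living t ∧ ∃ y : X, H.path t ω = y ∧ ∀ x, H.pos x t ω = y := by
  by_cases h : ω ∈ H.living t
  · right
    refine ⟨h, ?_⟩
    obtain ⟨y, -, hy⟩ := h
    exact ⟨y, hy.symm, fun x => by rw [pos, ← hy]; rfl⟩
  · left
    exact ⟨h, by simpa [mem_living] using h⟩

theorem mem_preimage_path {t : ℝ≥0} {ω : Ω} {y : X} (h : H.path t ω = y) (E : Set X) :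
    ω ∈ H.path t ⁻¹' ((↑) '' E) ↔ y ∈ E := by
  rw [mem_preimage, h, OnePoint.coe_injective.mem_set_image]

theorem measurable_pos (x : X) (t : ℝ≥0) : Measurable[H.filt t] (H.pos x t) := by
  intro E hE
  have h1 : H.pos x t ⁻¹' E = H.path t ⁻¹' ((↑) '' E) ∪ ((H.living t)ᶜ ∩ {_ω | x ∈ E}) := by
    ext ω
    rcases H.living_cases t ω with ⟨hl, h⟩ | ⟨hl, y, h, hy⟩
    · have : H.pos x t ω = x := by rw [pos, h]; rfl
      simp [this, hl, h]
    · simp [hy x, hl, h]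
  rw [h1]
  exact (H.adapted t E hE).union ((H.measurableSet_living t).compl.inter (MeasurableSet.const _))

theorem extendZero_path (x : X) (t : ℝ≥0) (f : X → ℝ≥0∞) (ω : Ω) :
    extendZero f (H.path t ω) = (H.living t).indicator (fun ω => f (H.pos x t ω)) ω := by
  rcases H.living_cases t ω with ⟨hl, h⟩ | ⟨hl, y, h, hy⟩
  · simp [hl, h]
  · simp [hl, h, hy x]

theorem measurable_extendZero_path_filt (x : X) (t : ℝ≥0) {f : X → ℝ≥0∞} (hf : Measurable f) :
    Measurable[H.filt t] fun ω => extendZero f (H.path t ω) := by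
  simp_rw [H.extendZero_path x]
  exact Measurable.indicator (m := H.filt t) (hf.comp (H.measurable_pos x t))
    (H.measurableSet_living t)

theorem measurable_extendZero_path [Nonempty X] (t : ℝ≥0) {f : X → ℝ≥0∞} (hf : Measurable f) :
    Measurable fun ω => extendZero f (H.path t ω) :=
  (H.measurable_extendZero_path_filt (Classical.arbitrary X) t hf).mono (H.filt.le t) le_rfl

/-- The law of `X_t` on the event `A`, under `P_x`. -/
def law (x : X) (t : ℝ≥0) (A : Set Ω) : Measure X :=
  ((H.prob x).restrict (A ∩ H.living t)).map (H.pos x t)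

theorem lintegral_law (x : X) (t : ℝ≥0) {A : Set Ω} {f : X → ℝ≥0∞}
    (hf : Measurable f) :
    ∫⁻ y, f y ∂H.law x t A = ∫⁻ ω in A, extendZero f (H.path t ω) ∂H.prob x := by
  have hl : MeasurableSet (H.living t) := H.filt.le t _ (H.measurableSet_living t)
  have hp : Measurable (H.pos x t) := (H.measurable_pos x t).mono (H.filt.le t) le_rfl
  rw [law, lintegral_map hf hp]
  simp_rw [H.extendZero_path x]
  rw [lintegral_indicator hl, Measure.restrict_restrict hl, inter_comm]

theorem law_apply (x : X) (t : ℝ≥0) {A : Set Ω} {E : Set X}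
    (hE : MeasurableSet E) : H.law x t A E = H.prob x (A ∩ H.path t ⁻¹' ((↑) '' E)) := by
  have hp : MeasurableSet (H.path t ⁻¹' ((↑) '' E)) := H.filt.le t _ (H.adapted t E hE)
  rw [← lintegral_indicator_one hE, H.lintegral_law x t (measurable_one.indicator hE),
    inter_comm, ← Measure.restrict_apply hp, ← lintegral_indicator_one hp]
  refine lintegral_congr fun ω => ?_
  rcases H.living_cases t ω with ⟨hl, h⟩ | ⟨hl, y, h, hy⟩
  · simp [h, indicator]
  · have hm := H.mem_preimage_path h E
    by_cases hyE : y ∈ E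
    · rw [indicator_of_mem (hm.2 hyE)]
      simp [h, hyE]
    · rw [indicator_of_notMem fun h' => hyE (hm.1 h')]
      simp [h, hyE]

instance (x : X) (t : ℝ≥0) (A : Set Ω) : IsFiniteMeasure (H.law x t A) := by
  unfold law; infer_instance

theorem law_le_one (x : X) (t : ℝ≥0) (A : Set Ω) : H.law x t A univ ≤ 1 := by
  have hp : Measurable (H.pos x t) := (H.measurable_pos x t).mono (H.filt.le t) le_rfl
  rw [law, Measure.map_apply hp MeasurableSet.univ]
  exact (Measure.restrict_le_self _).trans prob_le_one

/-- The transition kernel `T_t (x, dy)`. -/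
def kernel (t : ℝ≥0) : Kernel X X where
  toFun x := H.law x t univ
  measurable' := by
    refine Measure.measurable_of_measurable_coe _ fun E hE => ?_
    simp_rw [H.law_apply _ t hE, univ_inter]
    exact H.measurable_prob t E hE

theorem kernel_apply (t : ℝ≥0) (x : X) : H.kernel t x = H.law x t univ := rfl

instance (t : ℝ≥0) : IsFiniteKernel (H.kernel t) :=
  ⟨⟨1, ENNReal.one_lt_top, fun x => H.law_le_one x t univ⟩⟩

theorem semigroup_eq (t : ℝ≥0) {f : X → ℝ≥0∞} (hf : Measurable f) (x : X) :
    H.semigroup t f x = ∫⁻ y, f y ∂H.kernel t x := by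
  rw [kernel_apply, H.lintegral_law x t hf, setLIntegral_univ, semigroup]

theorem markov (a s : ℝ≥0) {A : Set Ω} (hA : MeasurableSet[H.filt a] A) {f : X → ℝ≥0∞}
    (hf : Measurable f) (x : X) :
    ∫⁻ ω in A, extendZero f (H.path (a + s) ω) ∂H.prob x =
      ∫⁻ ω in A, extendZero (fun z => ∫⁻ y, f y ∂H.kernel s z) (H.path a ω) ∂H.prob x := by
  have hT : IsStoppingTime H.filt fun _ => (a : WithTop ℝ≥0) := isStoppingTime_const _ a
  have hA' : MeasurableSet[hT.measurableSpace] A := by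
    rw [IsStoppingTime.measurableSpace_const]
    exact hA
  have h := H.strongMarkov (fun _ => (a : WithTop ℝ≥0)) hT A hA' s f hf x
  have h2 : (fun z => ∫⁻ y, f y ∂H.kernel s z) =
      fun z => ∫⁻ ω', extendZero f (H.path s ω') ∂H.prob z := by
    funext z
    rw [← H.semigroup_eq s hf, semigroup]
  have h3 : ({ω : Ω | (a : WithTop ℝ≥0) < ⊤} : Set Ω) = univ := by
    exact eq_univ_of_forall fun _ => WithTop.coe_lt_top a
  rw [h3, inter_univ, ← h2] at h
  exact h

/-- The event that the process stays in `F` during `[a, a + t]`. -/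
def stays (F : Set X) (a t : ℝ≥0) : Set Ω :=
  {ω | ∀ s ≤ t, H.path (a + s) ω ∈ ((↑) '' F : Set (OnePoint X))}

/-- The event that the process is in `F` at the times `a + i h`, `i ≤ N`. -/
def grid (F : Set X) (a h : ℝ≥0) (N : ℕ) : Set Ω :=
  {ω | ∀ i ≤ N, H.path (a + i * h) ω ∈ ((↑) '' F : Set (OnePoint X))}

theorem measurableSet_grid {F : Set X} (hF : MeasurableSet F) (a h : ℝ≥0) (N : ℕ) :
    MeasurableSet[H.filt (a + N * h)] (H.grid F a h N) := by
  have : H.grid F a h N = ⋂ i : ℕ, ⋂ (_ : i ≤ N), H.path (a + i * h) ⁻¹' ((↑) '' F) := by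
    ext; simp [grid]
  rw [this]
  refine MeasurableSet.iInter fun i => MeasurableSet.iInter fun hi => ?_
  refine H.filt.mono ?_ _ (H.adapted _ F hF)
  gcongr

/-- The operator `(1_F T_h)^N 1_F`. -/
def gridOp (F : Set X) (h : ℝ≥0) : ℕ → (X → ℝ≥0∞) → X → ℝ≥0∞
  | 0, f => F.indicator f
  | N + 1, f => F.indicator fun x => ∫⁻ y, gridOp F h N f y ∂H.kernel h x

theorem measurable_gridOp {F : Set X} (hF : MeasurableSet F) (h : ℝ≥0) (N : ℕ) {f : X → ℝ≥0∞}
    (hf : Measurable f) : Measurable (H.gridOp F h N f) := by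
  induction N with
  | zero => exact hf.indicator hF
  | succ N ih => exact ih.lintegral_kernel.indicator hF

/-- The definition of `gridOp` peels off the first step. Conditioning at the last grid time, and
passing to the adjoint, require peeling off the last one. -/
theorem gridOp_succ' (F : Set X) (h : ℝ≥0) (N : ℕ) (f : X → ℝ≥0∞) :
    H.gridOp F h (N + 1) f = H.gridOp F h N fun x => ∫⁻ y, F.indicator f y ∂H.kernel h x := by
  induction N with
  | zero => rfl
  | succ N ih => rw [gridOp, ih]; rfl

theorem gridOp_le {F : Set X} (h : ℝ≥0) (N : ℕ) {f : X → ℝ≥0∞} {C : ℝ≥0∞} (hC : ∀ x, f x ≤ C)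
    (x : X) : H.gridOp F h N f x ≤ F.indicator (fun _ => C) x := by
  induction N generalizing x with
  | zero => exact indicator_le_indicator (hC x)
  | succ N ih =>
    refine indicator_le_indicator ?_
    calc _ ≤ ∫⁻ _, C ∂H.kernel h x :=
          lintegral_mono fun y => (ih y).trans (indicator_le_self _ _ _)
      _ ≤ C := by
          rw [lintegral_const]
          exact mul_le_of_le_one_right' (H.law_le_one x h univ)

/-- Induction on the number of steps, with the Markov property applied at the last grid time but
one. The event `A` from the past of `a` is carried along so that the identity survives as a Markov
property of the confined process. -/
theorem lintegral_grid [Nonempty X] {F : Set X} (hF : MeasurableSet F) (a h : ℝ≥0) (N : ℕ)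
    {A : Set Ω} (hA : MeasurableSet[H.filt a] A) {f : X → ℝ≥0∞} (hf : Measurable f) (x : X) :
    ∫⁻ ω in A ∩ H.grid F a h N, extendZero f (H.path (a + N * h) ω) ∂H.prob x =
      ∫⁻ ω in A, extendZero (H.gridOp F h N f) (H.path a ω) ∂H.prob x := by
  have hstep : ∀ (B : Set Ω) (b : ℝ≥0) (g : X → ℝ≥0∞), MeasurableSet B →
      ∫⁻ ω in B ∩ H.path b ⁻¹' ((↑) '' F), extendZero g (H.path b ω) ∂H.prob x =
      ∫⁻ ω in B, extendZero (F.indicator g) (H.path b ω) ∂H.prob x := by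
    intro B b g hB
    have hb : MeasurableSet (H.path b ⁻¹' ((↑) '' F)) := H.filt.le b _ (H.adapted b F hF)
    rw [inter_comm, ← Measure.restrict_restrict hb, ← lintegral_indicator hb]
    refine lintegral_congr fun ω => ?_
    rcases H.living_cases b ω with ⟨hl, h⟩ | ⟨hl, y, h, hy⟩
    · simp [h, indicator]
    · have hm := H.mem_preimage_path h F
      by_cases hyE : y ∈ F
      · rw [indicator_of_mem (hm.2 hyE)]
        simp [h, hyE]
      · rw [indicator_of_notMem fun h' => hyE (hm.1 h')]
        simp [h, hyE]
  induction N generalizing f with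
  | zero =>
    have : H.grid F a h 0 = H.path a ⁻¹' ((↑) '' F) := by ext; simp [grid]
    rw [this]
    simpa [gridOp] using hstep A a f (H.filt.le a _ hA)
  | succ N ih =>
    have h1 : A ∩ H.grid F a h (N + 1) =
        (A ∩ H.grid F a h N) ∩ H.path (a + (N + 1 : ℕ) * h) ⁻¹' ((↑) '' F) := by
      ext ω
      refine ⟨fun hω => ⟨⟨hω.1, fun i hi => hω.2 i (by omega)⟩, hω.2 _ le_rfl⟩,
        fun hω => ⟨hω.1.1, fun i hi => ?_⟩⟩
      rcases Nat.le_succ_iff.1 hi with hi | rfl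
      · exact hω.1.2 i hi
      · exact hω.2
    have hA2 : MeasurableSet[H.filt (a + N * h)] (A ∩ H.grid F a h N) :=
      MeasurableSet.inter (H.filt.mono le_self_add _ hA) (H.measurableSet_grid hF a h N)
    have h2 : a + (N + 1 : ℕ) * h = a + N * h + h := by push_cast; ring
    rw [h1, hstep _ _ _ (H.filt.le _ _ hA2), h2, H.markov _ h hA2 (hf.indicator hF),
      ih (hf.indicator hF).lintegral_kernel, gridOp_succ']

end HuntProcess

/-! ### The process confined to a compact set -/

theorem tendsto_extendZero {X ι : Type*} {l : Filter ι} {u : ι → X → ℝ≥0∞} {f : X → ℝ≥0∞}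
    (h : ∀ x, Tendsto (fun i => u i x) l (𝓝 (f x))) (z : OnePoint X) :
    Tendsto (fun i => extendZero (u i) z) l (𝓝 (extendZero f z)) := by
  induction z using OnePoint.rec with
  | infty => exact tendsto_const_nhds
  | coe x => exact h x

theorem extendZero_le {X : Type*} {f : X → ℝ≥0∞} {C : ℝ≥0∞} (h : ∀ x, f x ≤ C) (z : OnePoint X) :
    extendZero f z ≤ C := by
  induction z using OnePoint.rec with
  | infty => exact zero_le
  | coe x => exact h x

namespace HuntProcess

variable {X Ω Ω' : Type*} [MetricSpace X] [ProperSpace X] [MeasurableSpace X] [BorelSpace X]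
  [mΩ : MeasurableSpace Ω] [MeasurableSpace Ω'] (H : HuntProcess X Ω) (H' : HuntProcess X Ω')

/-- Rounding `s` up to the dyadic grid of `[0, t]` approximates it from the right, the side on which
paths are continuous. -/
theorem exists_dyadic_above {s t : ℝ≥0} (ht : 0 < t) (hst : s ≤ t) :
    ∃ i : ℕ → ℕ, (∀ j, i j ≤ 2 ^ j) ∧ (∀ j, s ≤ i j * (t / 2 ^ j)) ∧
      Tendsto (fun j => (i j : ℝ≥0) * (t / 2 ^ j)) atTop (𝓝 s) := by
  have hpos : ∀ j : ℕ, 0 < t / 2 ^ j := fun j => by positivity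
  have hlow : ∀ j : ℕ, s ≤ ⌈s / (t / 2 ^ j)⌉₊ * (t / 2 ^ j) := fun j => by
    rw [← div_le_iff₀ (hpos j)]
    exact Nat.le_ceil _
  refine ⟨fun j => ⌈s / (t / 2 ^ j)⌉₊, fun j => ?_, hlow, ?_⟩
  · rw [Nat.ceil_le, div_le_iff₀ (hpos j)]
    push_cast
    rw [mul_div_cancel₀ _ (by positivity)]
    exact hst
  · refine tendsto_of_tendsto_of_tendsto_of_le_of_le tendsto_const_nhds
      (h := fun j : ℕ => s + t / 2 ^ j) ?_ hlow fun j => ?_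
    · have h1 : Tendsto (fun j : ℕ => t * (1 / 2 : ℝ≥0) ^ j) atTop (𝓝 (t * 0)) :=
        (NNReal.tendsto_pow_atTop_nhds_zero_of_lt_one (by
          rw [one_div]; exact inv_lt_one_of_one_lt₀ one_lt_two)).const_mul t
      have h2 : (fun j : ℕ => s + t / 2 ^ j) = fun j => s + t * (1 / 2 : ℝ≥0) ^ j := by
        funext j
        rw [one_div, inv_pow, div_eq_mul_inv]
      rw [h2]
      simpa using h1.const_add s
    · have h3 : (⌈s / (t / 2 ^ j)⌉₊ : ℝ≥0) ≤ s / (t / 2 ^ j) + 1 := (Nat.ceil_lt_add_one zero_le).le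
      calc (⌈s / (t / 2 ^ j)⌉₊ : ℝ≥0) * (t / 2 ^ j) ≤ (s / (t / 2 ^ j) + 1) * (t / 2 ^ j) := by gcongr
        _ = s + t / 2 ^ j := by rw [add_mul, one_mul, div_mul_cancel₀ _ (hpos j).ne']

theorem isClosed_coe_image {F : Set X} (hF : IsCompact F) :
    IsClosed ((↑) '' F : Set (OnePoint X)) :=
  (hF.image OnePoint.continuous_coe).isClosed

/-- A compact `F` is closed in `OnePoint X`, so by right-continuity a path in `F` at all dyadic
times is in `F` at all times. -/
theorem stays_eq_iInter_grid {F : Set X} (hF : IsCompact F) (a t : ℝ≥0) :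
    H.stays F a t = ⋂ j : ℕ, H.grid F a (t / 2 ^ j) (2 ^ j) := by
  ext ω
  simp only [mem_iInter]
  constructor
  · intro h j i hi
    refine h _ ?_
    rw [mul_div_left_comm]
    refine mul_le_of_le_one_right' ?_
    rw [div_le_one (by positivity)]
    exact_mod_cast hi
  · intro h s hs
    rcases eq_or_lt_of_le (zero_le (a := t)) with rfl | ht
    · have hs0 : s = 0 := le_antisymm hs zero_le
      simpa [hs0] using h 0 0 (by simp)
    obtain ⟨i, hi, hlow, hlim⟩ := exists_dyadic_above ht hs
    refine (isClosed_coe_image hF).mem_of_tendsto (b := atTop)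
      (f := fun j => H.path (a + i j * (t / 2 ^ j)) ω) ?_
      (Eventually.of_forall fun j => h j (i j) (hi j))
    refine (H.rightCont_path ω (a + s)).tendsto.comp (tendsto_nhdsWithin_iff.2 ⟨?_, ?_⟩)
    · exact hlim.const_add a
    · exact Eventually.of_forall fun j => add_le_add_right (hlow j) a

theorem antitone_grid (F : Set X) (a t : ℝ≥0) :
    Antitone fun j : ℕ => H.grid F a (t / 2 ^ j) (2 ^ j) := by
  refine antitone_nat_of_succ_le fun j ω h i hi => ?_
  have := h (2 * i) (by rw [pow_succ]; omega)
  have h2 : ((2 * i : ℕ) : ℝ≥0) * (t / 2 ^ (j + 1)) = i * (t / 2 ^ j) := by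
    push_cast
    rw [pow_succ]
    field_simp
  rwa [h2] at this

theorem two_pow_mul_div (t : ℝ≥0) (j : ℕ) : ((2 ^ j : ℕ) : ℝ≥0) * (t / 2 ^ j) = t := by
  push_cast
  rw [mul_div_cancel₀ _ (by positivity)]

theorem measurableSet_stays_filt {F : Set X} (hF : IsCompact F) (a t : ℝ≥0) :
    MeasurableSet[H.filt (a + t)] (H.stays F a t) := by
  rw [H.stays_eq_iInter_grid hF]
  refine MeasurableSet.iInter fun j => ?_
  have := H.measurableSet_grid hF.isClosed.measurableSet a (t / 2 ^ j) (2 ^ j)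
  rwa [two_pow_mul_div] at this

theorem measurableSet_stays {F : Set X} (hF : IsCompact F) (a t : ℝ≥0) :
    MeasurableSet (H.stays F a t) :=
  H.filt.le _ _ (H.measurableSet_stays_filt hF a t)

/-- The grid events decrease to `stays`; this is continuity from above of the finite measure with
density `f (X_{a+t})` on `A`. -/
theorem tendsto_lintegral_grid {F : Set X} (hF : IsCompact F) (a t : ℝ≥0) {A : Set Ω}
    {f : X → ℝ≥0∞} (hf : Measurable f) {C : ℝ≥0}
    (hC : ∀ x, f x ≤ C) (x : X) :
    Tendsto (fun j : ℕ => ∫⁻ ω in A ∩ H.grid F a (t / 2 ^ j) (2 ^ j),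
      extendZero f (H.path (a + t) ω) ∂H.prob x) atTop
      (𝓝 (∫⁻ ω in A ∩ H.stays F a t, extendZero f (H.path (a + t) ω) ∂H.prob x)) := by
  have : Nonempty X := ⟨x⟩
  have hm : Measurable fun ω => extendZero f (H.path (a + t) ω) := H.measurable_extendZero_path _ hf
  set ν : Measure Ω := ((H.prob x).restrict A).withDensity
    fun ω => extendZero f (H.path (a + t) ω) with hν
  have hfin : IsFiniteMeasure ν := by
    refine isFiniteMeasure_withDensity (ne_top_of_le_ne_top (b := C * (H.prob x) A) (by finiteness) ?_)
    calc _ ≤ ∫⁻ _ in A, (C : ℝ≥0∞) ∂H.prob x := lintegral_mono fun ω => extendZero_le hC _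
      _ = _ := by rw [lintegral_const, Measure.restrict_apply_univ]
  have hg : ∀ j : ℕ, MeasurableSet (H.grid F a (t / 2 ^ j) (2 ^ j)) := fun j =>
    H.filt.le _ _ (H.measurableSet_grid hF.isClosed.measurableSet _ _ _)
  have hval : ∀ S : Set Ω, MeasurableSet S →
      ν S = ∫⁻ ω in A ∩ S, extendZero f (H.path (a + t) ω) ∂H.prob x := by
    intro S hS
    rw [hν, withDensity_apply _ hS, Measure.restrict_restrict hS, inter_comm]
  have h := tendsto_measure_iInter_atTop (μ := ν) (fun j => (hg j).nullMeasurableSet)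
    (H.antitone_grid F a t) ⟨0, measure_ne_top _ _⟩
  rw [← H.stays_eq_iInter_grid hF, hval _ (H.measurableSet_stays hF a t)] at h
  refine h.congr fun j => ?_
  exact hval _ (hg j)

/-- `E_x [f (X_t); X_s ∈ F for all s ≤ t]`. -/
def stayOp (F : Set X) (t : ℝ≥0) (f : X → ℝ≥0∞) (x : X) : ℝ≥0∞ :=
  ∫⁻ ω in H.stays F 0 t, extendZero f (H.path t ω) ∂H.prob x

theorem tendsto_gridOp {F : Set X} (hF : IsCompact F) (t : ℝ≥0) {f : X → ℝ≥0∞} (hf : Measurable f)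
    {C : ℝ≥0} (hC : ∀ x, f x ≤ C) (x : X) :
    Tendsto (fun j : ℕ => H.gridOp F (t / 2 ^ j) (2 ^ j) f x) atTop (𝓝 (H.stayOp F t f x)) := by
  have : Nonempty X := ⟨x⟩
  have h := H.tendsto_lintegral_grid hF 0 t (A := univ) hf hC x
  simp only [univ_inter, zero_add] at h
  refine h.congr fun j => ?_
  have h2 := H.lintegral_grid hF.isClosed.measurableSet 0 (t / 2 ^ j) (2 ^ j)
    (A := univ) MeasurableSet.univ hf x
  simp only [univ_inter, two_pow_mul_div, zero_add, setLIntegral_univ] at h2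
  rw [h2, lintegral_congr_ae (g := fun _ => H.gridOp F (t / 2 ^ j) (2 ^ j) f x)]
  · simp
  · filter_upwards [H.start x] with ω hω
    rw [hω, extendZero_coe]

theorem measurable_stayOp {F : Set X} (hF : IsCompact F) (t : ℝ≥0) {f : X → ℝ≥0∞}
    (hf : Measurable f) {C : ℝ≥0} (hC : ∀ x, f x ≤ C) : Measurable (H.stayOp F t f) :=
  measurable_of_tendsto_metrizable
    (fun j : ℕ => H.measurable_gridOp hF.isClosed.measurableSet (t / 2 ^ j) (2 ^ j) hf)
    (tendsto_pi_nhds.2 fun x => H.tendsto_gridOp hF t hf hC x)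

theorem markov_stays {F : Set X} (hF : IsCompact F) (a s : ℝ≥0) {A : Set Ω}
    (hA : MeasurableSet[H.filt a] A) {f : X → ℝ≥0∞} (hf : Measurable f) {C : ℝ≥0}
    (hC : ∀ x, f x ≤ C) (x : X) :
    ∫⁻ ω in A ∩ H.stays F a s, extendZero f (H.path (a + s) ω) ∂H.prob x =
      ∫⁻ ω in A, extendZero (H.stayOp F s f) (H.path a ω) ∂H.prob x := by
  have : Nonempty X := ⟨x⟩
  refine tendsto_nhds_unique (H.tendsto_lintegral_grid hF a s hf hC x) ?_
  have h2 : ∀ j : ℕ, ∫⁻ ω in A ∩ H.grid F a (s / 2 ^ j) (2 ^ j),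
      extendZero f (H.path (a + s) ω) ∂H.prob x =
      ∫⁻ ω in A, extendZero (H.gridOp F (s / 2 ^ j) (2 ^ j) f) (H.path a ω) ∂H.prob x := by
    intro j
    have := H.lintegral_grid hF.isClosed.measurableSet a (s / 2 ^ j) (2 ^ j) hA hf x
    rwa [two_pow_mul_div] at this
  simp_rw [h2]
  refine tendsto_lintegral_of_dominated_convergence (fun _ => (C : ℝ≥0∞)) (fun j => ?_)
    (fun j => ae_of_all _ fun ω => ?_) (by simp; finiteness) (ae_of_all _ fun ω => ?_)
  · exact H.measurable_extendZero_path _ (H.measurable_gridOp hF.isClosed.measurableSet _ _ hf)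
  · exact extendZero_le (fun z => (H.gridOp_le _ _ hC z).trans (indicator_le_self _ _ _)) _
  · exact tendsto_extendZero (fun z => H.tendsto_gridOp hF s hf hC z) _

theorem stays_add (F : Set X) (s t : ℝ≥0) :
    H.stays F 0 (s + t) = H.stays F 0 s ∩ H.stays F s t := by
  ext ω
  simp only [stays, zero_add]
  constructor
  · exact fun h => ⟨fun u hu => h u (hu.trans le_self_add), fun u hu => h _ (by gcongr)⟩
  · rintro ⟨h1, h2⟩ u hu
    rcases le_total u s with hus | hus
    · exact h1 u hus
    · obtain ⟨v, rfl⟩ := exists_add_of_le hus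
      exact h2 v (le_of_add_le_add_left hu)

theorem stayOp_add {F : Set X} (hF : IsCompact F) (s t : ℝ≥0) {f : X → ℝ≥0∞} (hf : Measurable f)
    {C : ℝ≥0} (hC : ∀ x, f x ≤ C) (x : X) :
    H.stayOp F (s + t) f x = H.stayOp F s (H.stayOp F t f) x := by
  rw [stayOp, stays_add, H.markov_stays hF s t _ hf hC, stayOp]
  have := H.measurableSet_stays_filt hF 0 s
  rwa [zero_add] at this

theorem tendsto_lintegral_gridOp {m : Measure X} {F : Set X} (hF : IsCompact F) (hmF : m F ≠ ∞)
    (t : ℝ≥0) {f g : X → ℝ≥0∞} (hf : Measurable f) (hg : Measurable g) {C : ℝ≥0}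
    (hfC : ∀ x, f x ≤ C) (hgC : ∀ x, g x ≤ C) :
    Tendsto (fun j : ℕ => ∫⁻ x, f x * H.gridOp F (t / 2 ^ j) (2 ^ j) g x ∂m) atTop
      (𝓝 (∫⁻ x, f x * H.stayOp F t g x ∂m)) := by
  have hFm := hF.isClosed.measurableSet
  refine tendsto_lintegral_of_dominated_convergence
    (fun x => F.indicator (fun _ => (C * C : ℝ≥0∞)) x) (fun j => ?_)
    (fun j => ae_of_all _ fun x => ?_) ?_ (ae_of_all _ fun x => ?_)
  · exact hf.mul (H.measurable_gridOp hFm _ _ hg)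
  · refine (mul_le_mul' (hfC x) (H.gridOp_le _ _ hgC x)).trans ?_
    by_cases hx : x ∈ F <;> simp [hx]
  · rw [lintegral_indicator_const hFm]
    finiteness
  · exact ENNReal.Tendsto.const_mul (H.tendsto_gridOp hF t hg hgC x)
      (Or.inr (ne_top_of_le_ne_top ENNReal.coe_ne_top (hfC x)))

section Dual

variable {H H'} {m : Measure X}

/-- The word `1_F T_h 1_F ... T_h 1_F` is a palindrome, so its adjoint is the same word in `T̂_h`.
-/
theorem gridOp_dual {h : ℝ≥0} (hdual : ∀ f g : X → ℝ≥0∞, Measurable f → Measurable g →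
      ∫⁻ x, f x * ∫⁻ y, g y ∂H.kernel h x ∂m = ∫⁻ y, g y * ∫⁻ x, f x ∂H'.kernel h y ∂m)
    {F : Set X} (hF : MeasurableSet F) (N : ℕ) {f g : X → ℝ≥0∞} (hf : Measurable f)
    (hg : Measurable g) :
    ∫⁻ x, f x * H.gridOp F h N g x ∂m = ∫⁻ y, g y * H'.gridOp F h N f y ∂m := by
  have hmove : ∀ u v : X → ℝ≥0∞, ∀ x, u x * F.indicator v x = F.indicator u x * v x := by
    intro u v x
    by_cases hx : x ∈ F <;> simp [hx]
  induction N generalizing f with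
  | zero =>
    refine lintegral_congr fun x => ?_
    rw [gridOp, gridOp, hmove, mul_comm]
  | succ N ih =>
    rw [H'.gridOp_succ', ← ih (hf.indicator hF).lintegral_kernel]
    simp_rw [gridOp, hmove]
    rw [hdual _ _ (hf.indicator hF) (H.measurable_gridOp hF h N hg)]
    simp_rw [mul_comm]

theorem stayOp_dual (hdual : ∀ h : ℝ≥0, 0 < h → ∀ f g : X → ℝ≥0∞, Measurable f → Measurable g →
      ∫⁻ x, f x * ∫⁻ y, g y ∂H.kernel h x ∂m = ∫⁻ y, g y * ∫⁻ x, f x ∂H'.kernel h y ∂m)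
    {F : Set X} (hF : IsCompact F) (hmF : m F ≠ ∞) {t : ℝ≥0} (ht : 0 < t) {f g : X → ℝ≥0∞}
    (hf : Measurable f) (hg : Measurable g) {C : ℝ≥0} (hC : ∀ x, f x ≤ C) (hC' : ∀ x, g x ≤ C) :
    ∫⁻ x, f x * H.stayOp F t g x ∂m = ∫⁻ y, g y * H'.stayOp F t f y ∂m := by
  refine tendsto_nhds_unique (H.tendsto_lintegral_gridOp hF hmF t hf hg hC hC')
    ((H'.tendsto_lintegral_gridOp hF hmF t hg hf hC' hC).congr fun j => ?_)
  exact (gridOp_dual (hdual _ (by positivity)) hF.isClosed.measurableSet _ hf hg).symm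

end Dual

end HuntProcess

/-! ### Exhaustion by compact sets and the killed kernel -/

/-- An increasing sequence of compact sets exhausting the open set `D`. -/
structure IsExhaustion {X : Type*} [TopologicalSpace X] (F : ℕ → Set X) (D : Set X) : Prop where
  isCompact : ∀ k, IsCompact (F k)
  subset_interior : ∀ k, F k ⊆ interior (F (k + 1))
  iUnion_eq : ⋃ k, F k = D

namespace IsExhaustion

variable {X : Type*} [TopologicalSpace X] {F : ℕ → Set X} {D : Set X}

theorem monotone (h : IsExhaustion F D) : Monotone F :=
  monotone_nat_of_le_succ fun k => (h.subset_interior k).trans interior_subset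

theorem subset (h : IsExhaustion F D) (k : ℕ) : F k ⊆ D := by
  rw [← h.iUnion_eq]
  exact subset_iUnion F k

end IsExhaustion

/-- Duality of two kernels extends from indicators to all measurable functions. -/
theorem duality_of_sets {X : Type*} [MeasurableSpace X] {m : Measure X} {κ κ' : Kernel X X}
    (h : ∀ A E : Set X, MeasurableSet A → MeasurableSet E →
      ∫⁻ x in A, κ x E ∂m = ∫⁻ y in E, κ' y A ∂m) {f g : X → ℝ≥0∞} (hf : Measurable f)
    (hg : Measurable g) :
    ∫⁻ x, f x * ∫⁻ y, g y ∂κ x ∂m = ∫⁻ y, g y * ∫⁻ x, f x ∂κ' y ∂m := by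
  have h1 : ∀ A : Set X, MeasurableSet A → ∀ g : X → ℝ≥0∞, Measurable g →
      ∫⁻ x in A, ∫⁻ y, g y ∂κ x ∂m = ∫⁻ y, g y * κ' y A ∂m := by
    intro A hA g hg
    have : (m.restrict A).bind κ = m.withDensity fun y => κ' y A := by
      refine Measure.ext fun E hE => ?_
      rw [Measure.bind_apply hE κ.aemeasurable, withDensity_apply _ hE, h A E hA hE]
    rw [← Measure.lintegral_bind κ.aemeasurable hg.aemeasurable, this,
      lintegral_withDensity_eq_lintegral_mul _ (κ'.measurable_coe hA) hg]
    simp_rw [Pi.mul_apply, mul_comm]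
  have h2 : m.withDensity (fun x => ∫⁻ y, g y ∂κ x) = (m.withDensity g).bind κ' := by
    refine Measure.ext fun A hA => ?_
    rw [Measure.bind_apply hA κ'.aemeasurable, withDensity_apply _ hA, h1 A hA g hg,
      lintegral_withDensity_eq_lintegral_mul _ hg (κ'.measurable_coe hA)]
    rfl
  have h3 := congrArg (fun ν : Measure X => ∫⁻ x, f x ∂ν) h2
  beta_reduce at h3
  rw [Measure.lintegral_bind κ'.aemeasurable hf.aemeasurable,
    lintegral_withDensity_eq_lintegral_mul _ hg.lintegral_kernel hf,
    lintegral_withDensity_eq_lintegral_mul _ hg hf.lintegral_kernel] at h3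
  simpa [mul_comm] using h3

namespace HuntProcess

variable {X Ω Ω' : Type*} [MetricSpace X] [ProperSpace X] [MeasurableSpace X] [BorelSpace X]
  [mΩ : MeasurableSpace Ω] [MeasurableSpace Ω'] (H : HuntProcess X Ω) (H' : HuntProcess X Ω')
  {F : ℕ → Set X} {D : Set X}

/-- The event that the process stays in some `F k` up to time `t`. -/
def alive (F : ℕ → Set X) (t : ℝ≥0) : Set Ω := ⋃ k, H.stays (F k) 0 t

theorem measurableSet_alive (hF : IsExhaustion F D) (t : ℝ≥0) : MeasurableSet (H.alive F t) :=
  MeasurableSet.iUnion fun k => H.measurableSet_stays (hF.isCompact k) 0 t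

theorem monotone_stays (hF : IsExhaustion F D) (t : ℝ≥0) : Monotone fun k => H.stays (F k) 0 t :=
  fun _ _ hab _ hω s hs => image_mono (hF.monotone hab) (hω s hs)

/-- The law of the process killed upon leaving `D`. -/
def killedLaw (F : ℕ → Set X) (t : ℝ≥0) (x : X) : Measure X := H.law x t (H.alive F t)

instance (F : ℕ → Set X) (t : ℝ≥0) (x : X) : IsFiniteMeasure (H.killedLaw F t x) := by
  unfold killedLaw; infer_instance

theorem lintegral_killedLaw (t : ℝ≥0) (x : X) {f : X → ℝ≥0∞} (hf : Measurable f) :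
    ∫⁻ y, f y ∂H.killedLaw F t x = ∫⁻ ω in H.alive F t, extendZero f (H.path t ω) ∂H.prob x :=
  H.lintegral_law x t hf

theorem lintegral_killedLaw_eq_iSup (hF : IsExhaustion F D) (t : ℝ≥0) (x : X) {f : X → ℝ≥0∞}
    (hf : Measurable f) :
    ∫⁻ y, f y ∂H.killedLaw F t x = ⨆ k, H.stayOp (F k) t f x := by
  rw [H.lintegral_killedLaw t x hf, alive,
    setLIntegral_iUnion_of_directed _ (H.monotone_stays hF t).directed_le]
  rfl

theorem stayOp_eq_lintegral_law (A : Set X) (t : ℝ≥0) (x : X) {f : X → ℝ≥0∞} (hf : Measurable f) :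
    H.stayOp A t f x = ∫⁻ y, f y ∂H.law x t (H.stays A 0 t) :=
  (H.lintegral_law x t hf).symm

theorem stayOp_mono_fun (A : Set X) (t : ℝ≥0) {f g : X → ℝ≥0∞} (hfg : ∀ x, f x ≤ g x) (x : X) :
    H.stayOp A t f x ≤ H.stayOp A t g x := by
  refine lintegral_mono fun ω => ?_
  generalize H.path t ω = z
  induction z using OnePoint.rec with
  | infty => exact le_rfl
  | coe y => exact hfg y

theorem stayOp_mono_set {A B : Set X} (hAB : A ⊆ B) (t : ℝ≥0) (f : X → ℝ≥0∞) (x : X) :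
    H.stayOp A t f x ≤ H.stayOp B t f x :=
  lintegral_mono_set fun _ hω s hs => image_mono hAB (hω s hs)

theorem killedLaw_add (hF : IsExhaustion F D) (s t : ℝ≥0) (x : X) {f : X → ℝ≥0∞}
    (hf : Measurable f) {C : ℝ≥0} (hC : ∀ x, f x ≤ C) :
    ∫⁻ y, f y ∂H.killedLaw F (s + t) x = ∫⁻ z, ∫⁻ y, f y ∂H.killedLaw F t z ∂H.killedLaw F s x := by
  have hm : ∀ k, Measurable (H.stayOp (F k) t f) := fun k =>
    H.measurable_stayOp (hF.isCompact k) t hf hC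
  simp_rw [H.lintegral_killedLaw_eq_iSup hF _ _ hf]
  rw [H.lintegral_killedLaw_eq_iSup hF s x (Measurable.iSup hm)]
  have h1 : ∀ k, H.stayOp (F k) s (fun z => ⨆ l, H.stayOp (F l) t f z) x =
      ⨆ l, H.stayOp (F k) s (H.stayOp (F l) t f) x := by
    intro k
    rw [H.stayOp_eq_lintegral_law _ _ _ (Measurable.iSup hm), lintegral_iSup hm
      fun a b hab z => H.stayOp_mono_set (hF.monotone hab) t f z]
    exact iSup_congr fun l => (H.stayOp_eq_lintegral_law _ _ _ (hm l)).symm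
  simp_rw [h1, H.stayOp_add (hF.isCompact _) s t hf hC]
  -- `stayOp` increases with the set, so the double supremum is attained along the diagonal.
  refine le_antisymm (iSup_le fun k => le_iSup₂_of_le k k le_rfl) (iSup₂_le fun k l => ?_)
  refine le_iSup_of_le (max k l) ?_
  exact (H.stayOp_mono_set (hF.monotone (le_max_left k l)) s _ x).trans
    (H.stayOp_mono_fun _ s (fun z => H.stayOp_mono_set (hF.monotone (le_max_right k l)) t f z) x)

theorem alive_antitone (F : ℕ → Set X) {s t : ℝ≥0} (hst : s ≤ t) : H.alive F t ⊆ H.alive F s :=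
  iUnion_mono fun _ _ hω u hu => hω u (hu.trans hst)

/-- Since `F k` lies in the interior of `F (k + 1)`, right-continuity keeps the path in the larger
set for a short while after `t`. -/
theorem eventually_stays (hF : IsExhaustion F D) {k : ℕ} {t : ℝ≥0} {ω : Ω}
    (hω : ω ∈ H.stays (F k) 0 t) : ∀ᶠ s in 𝓝[≥] t, ω ∈ H.stays (F (k + 1)) 0 s := by
  have ho : IsOpen ((↑) '' interior (F (k + 1)) : Set (OnePoint X)) :=
    OnePoint.isOpenEmbedding_coe.isOpenMap _ isOpen_interior
  have ht : H.path t ω ∈ ((↑) '' interior (F (k + 1)) : Set (OnePoint X)) := by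
    have := hω t le_rfl
    rw [zero_add] at this
    exact image_mono (hF.subset_interior k) this
  have h1 := (H.rightCont_path ω t).tendsto.eventually (ho.mem_nhds ht)
  obtain ⟨u, hu, h2⟩ := (mem_nhdsGE_iff_exists_Ico_subset (a := t)).1 h1
  filter_upwards [Ico_mem_nhdsGE hu] with s hs v hv
  rcases lt_or_ge v t with hvt | hvt
  · exact image_mono (hF.monotone (Nat.le_succ k)) (hω v hvt.le)
  · rw [zero_add]
    exact image_mono interior_subset (h2 ⟨hvt, hv.trans_lt hs.2⟩)

theorem continuous_extendZero {f : X → ℝ≥0∞} (hf : Continuous f) (y : X) :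
    ContinuousAt (extendZero f) (y : OnePoint X) := by
  rw [OnePoint.continuousAt_coe]
  exact hf.continuousAt

/-- Along each path the integrand is right-continuous: a path alive at `t` stays alive a little
longer, one that is dead remains dead. Dominated convergence does the rest. -/
theorem rightCont_killedLaw (hF : IsExhaustion F D) (f : BoundedContinuousFunction X ℝ≥0) (x : X)
    (t : ℝ≥0) :
    ContinuousWithinAt (fun s => ∫⁻ y, f y ∂H.killedLaw F s x) (Ioi t) t := by
  have : Nonempty X := ⟨x⟩
  have hfm : Measurable fun x => (f x : ℝ≥0∞) := f.continuous.measurable.coe_nnreal_ennreal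
  have hfc : Continuous fun x => (f x : ℝ≥0∞) := ENNReal.continuous_coe.comp f.continuous
  have hC : ∀ x, (f x : ℝ≥0∞) ≤ (nndist f 0 : ℝ≥0) := fun x => by
    exact_mod_cast BoundedContinuousFunction.NNReal.upper_bound f x
  simp_rw [H.lintegral_killedLaw _ _ hfm, ← lintegral_indicator (H.measurableSet_alive hF _)]
  refine ContinuousWithinAt.mono (t := Ici t) ?_ Ioi_subset_Ici_self
  refine tendsto_lintegral_filter_of_dominated_convergence (fun _ => ((nndist f 0 : ℝ≥0) : ℝ≥0∞))
    (Eventually.of_forall fun s => ?_) (Eventually.of_forall fun s => ae_of_all _ fun ω => ?_)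
    (by simp) (ae_of_all _ fun ω => ?_)
  · exact (H.measurable_extendZero_path s hfm).indicator (H.measurableSet_alive hF s)
  · exact (indicator_le_self _ _ _).trans (extendZero_le hC _)
  · by_cases hω : ω ∈ H.alive F t
    · obtain ⟨k, hk⟩ := mem_iUnion.1 hω
      have h1 : ∀ᶠ s in 𝓝[≥] t, ω ∈ H.alive F s :=
        (H.eventually_stays hF hk).mono fun s hs => mem_iUnion.2 ⟨k + 1, hs⟩
      rw [indicator_of_mem hω]
      refine Tendsto.congr' (f₁ := fun s => extendZero (fun x => (f x : ℝ≥0∞)) (H.path s ω))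
        (h1.mono fun s hs => by simp only [indicator_of_mem hs]) ?_
      obtain ⟨y, -, hy⟩ := hk t le_rfl
      rw [zero_add] at hy
      have h2 := continuous_extendZero hfc y
      rw [hy] at h2
      exact h2.tendsto.comp (H.rightCont_path ω t)
    · rw [indicator_of_notMem hω]
      refine tendsto_const_nhds.congr' ?_
      filter_upwards [self_mem_nhdsWithin] with s hs
      rw [indicator_of_notMem fun h => hω (H.alive_antitone F hs h)]

theorem measurable_killedLaw (hF : IsExhaustion F D) :
    Measurable fun z : ℝ≥0 × X => H.killedLaw F z.1 z.2 := by
  refine measurable_of_lintegral_boundedContinuous fun f => ?_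
  have hfm : Measurable fun x => (f x : ℝ≥0∞) := f.continuous.measurable.coe_nnreal_ennreal
  have hC : ∀ x, (f x : ℝ≥0∞) ≤ (nndist f 0 : ℝ≥0) := fun x => by
    exact_mod_cast BoundedContinuousFunction.NNReal.upper_bound f x
  refine measurable_uncurry_of_rightCont (φ := fun t x => ∫⁻ y, f y ∂H.killedLaw F t x)
    (fun t => ?_) fun x t => H.rightCont_killedLaw hF f x t
  simp_rw [H.lintegral_killedLaw_eq_iSup hF t _ hfm]
  exact Measurable.iSup fun k => H.measurable_stayOp (hF.isCompact k) t hfm hC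

/-- The transition kernel of the process killed upon leaving `D`, jointly in time and space. -/
def killedKernel (hF : IsExhaustion F D) : Kernel (ℝ≥0 × X) X where
  toFun z := H.killedLaw F z.1 z.2
  measurable' := H.measurable_killedLaw hF

theorem killedKernel_apply (hF : IsExhaustion F D) (t : ℝ≥0) (x : X) :
    H.killedKernel hF (t, x) = H.killedLaw F t x := rfl

instance (hF : IsExhaustion F D) : IsFiniteKernel (H.killedKernel hF) :=
  ⟨⟨1, ENNReal.one_lt_top, fun z => H.law_le_one z.2 z.1 _⟩⟩

theorem killedKernel_add (hF : IsExhaustion F D) (s t : ℝ≥0) (x : X) {f : X → ℝ≥0∞}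
    (hf : Measurable f) :
    ∫⁻ y, f y ∂H.killedKernel hF (s + t, x) =
      ∫⁻ z, ∫⁻ y, f y ∂H.killedKernel hF (t, z) ∂H.killedKernel hF (s, x) := by
  have hsec : Measurable fun z => H.killedKernel hF (t, z) :=
    (H.killedKernel hF).measurable.comp measurable_prodMk_left
  have h : H.killedKernel hF (s + t, x) =
      (H.killedKernel hF (s, x)).bind fun z => H.killedKernel hF (t, z) := by
    refine Measure.ext fun E hE => ?_
    rw [Measure.bind_apply hE hsec.aemeasurable, ← lintegral_indicator_one hE]
    simp_rw [← lintegral_indicator_one hE]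
    refine H.killedLaw_add hF s t x (measurable_one.indicator hE) (C := 1) fun z => ?_
    exact (indicator_le_self _ _ _)
  rw [h, Measure.lintegral_bind hsec.aemeasurable hf.aemeasurable]

theorem killedKernel_le_kernel (hF : IsExhaustion F D) (t : ℝ≥0) (x : X) :
    H.killedKernel hF (t, x) ≤ H.kernel t x := by
  rw [killedKernel_apply, kernel_apply, killedLaw, law, law]
  exact Measure.map_mono (Measure.restrict_mono (by simp) le_rfl)
    ((H.measurable_pos x t).mono (H.filt.le t) le_rfl)

theorem killedKernel_dual {H : HuntProcess X Ω} {H' : HuntProcess X Ω'} {m : Measure X} [IsLocallyFiniteMeasure m]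
    (hF : IsExhaustion F D)
    (hdual : ∀ h : ℝ≥0, 0 < h → ∀ f g : X → ℝ≥0∞, Measurable f → Measurable g →
      ∫⁻ x, f x * ∫⁻ y, g y ∂H.kernel h x ∂m = ∫⁻ y, g y * ∫⁻ x, f x ∂H'.kernel h y ∂m)
    {t : ℝ≥0} (ht : 0 < t) {f g : X → ℝ≥0∞} (hf : Measurable f) (hg : Measurable g) :
    ∫⁻ x, f x * ∫⁻ y, g y ∂H.killedKernel hF (t, x) ∂m =
      ∫⁻ y, g y * ∫⁻ x, f x ∂H'.killedKernel hF (t, y) ∂m := by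
  refine duality_of_sets (κ := (H.killedKernel hF).comap (fun x => (t, x)) measurable_prodMk_left)
    (κ' := (H'.killedKernel hF).comap (fun x => (t, x)) measurable_prodMk_left)
    (fun A E hA hE => ?_) hf hg
  have hA1 : Measurable (A.indicator (1 : X → ℝ≥0∞)) := measurable_one.indicator hA
  have hE1 : Measurable (E.indicator (1 : X → ℝ≥0∞)) := measurable_one.indicator hE
  have hb : ∀ (S : Set X) x, S.indicator (1 : X → ℝ≥0∞) x ≤ (1 : ℝ≥0) := fun S x =>
    indicator_le_self _ _ _
  have hconv : ∀ (S : Set X) (u : X → ℝ≥0∞), MeasurableSet S →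
      ∫⁻ x in S, u x ∂m = ∫⁻ x, S.indicator 1 x * u x ∂m := by
    intro S u hS
    rw [← lintegral_indicator hS]
    refine lintegral_congr fun x => ?_
    by_cases hx : x ∈ S <;> simp [hx]
  simp_rw [Kernel.comap_apply, killedKernel_apply, ← lintegral_indicator_one hA,
    ← lintegral_indicator_one hE]
  simp_rw [H.lintegral_killedLaw_eq_iSup hF t _ hE1, H'.lintegral_killedLaw_eq_iSup hF t _ hA1]
  rw [hconv A _ hA, hconv E _ hE]
  simp_rw [ENNReal.mul_iSup]
  rw [lintegral_iSup, lintegral_iSup]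
  · refine iSup_congr fun k => ?_
    exact stayOp_dual hdual (hF.isCompact k) (hF.isCompact k).measure_lt_top.ne ht hA1 hE1
      (hb A) (hb E)
  · exact fun k => hE1.mul (H'.measurable_stayOp (hF.isCompact k) t hA1 (hb A))
  · exact fun a b hab x => mul_le_mul_right (H'.stayOp_mono_set (hF.monotone hab) t _ x) _
  · exact fun k => hA1.mul (H.measurable_stayOp (hF.isCompact k) t hE1 (hb E))
  · exact fun a b hab x => mul_le_mul_right (H.stayOp_mono_set (hF.monotone hab) t _ x) _

end HuntProcess

/-! ### Exit times and the killed semigroup -/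

namespace HuntProcess

variable {X Ω Ω' : Type*} [MetricSpace X] [ProperSpace X] [MeasurableSpace X] [BorelSpace X]
  [mΩ : MeasurableSpace Ω] [MeasurableSpace Ω'] (H : HuntProcess X Ω) (H' : HuntProcess X Ω')
  {F : ℕ → Set X} {D : Set X}

open Classical in
/-- The first exit time from `A`, as a random time with values in `[0, ∞]`. -/
def exit (A : Set X) (ω : Ω) : WithTop ℝ≥0 :=
  if ∃ s, H.path s ω ∉ ((↑) '' A : Set (OnePoint X)) then
    ((sInf {s | H.path s ω ∉ ((↑) '' A : Set (OnePoint X))} : ℝ≥0) : WithTop ℝ≥0) else ⊤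

theorem exit_lt_iff {A : Set X} {ω : Ω} {t : ℝ≥0} :
    H.exit A ω < t ↔ ∃ s < t, H.path s ω ∉ ((↑) '' A : Set (OnePoint X)) := by
  unfold exit
  split_ifs with h
  · have hne : {s | H.path s ω ∉ ((↑) '' A : Set (OnePoint X))}.Nonempty := h
    rw [WithTop.coe_lt_coe, csInf_lt_iff (OrderBot.bddBelow _) hne]
    exact ⟨fun ⟨s, hs, hst⟩ => ⟨s, hst, hs⟩, fun ⟨s, hst, hs⟩ => ⟨s, hs, hst⟩⟩
  · exact ⟨fun h' => absurd h' not_top_lt, fun ⟨s, _, hs⟩ => absurd ⟨s, hs⟩ h⟩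

/-- The complement of `A` is open in `OnePoint X`, so by right-continuity a visit to it before `t`
entails a visit at one of countably many times before `t`. Right-continuity of the filtration makes
it enough to treat the events `exit < t`. -/
theorem isStoppingTime_exit {A : Set X} (hA : IsCompact A) : IsStoppingTime H.filt (H.exit A) := by
  have := H.rightCont_filt
  refine isStoppingTime_of_measurableSet_lt_of_isRightContinuous fun t => ?_
  have ho : IsOpen ((↑) '' A : Set (OnePoint X))ᶜ := (isClosed_coe_image hA).isOpen_compl
  obtain ⟨Q, hQc, hQd⟩ := TopologicalSpace.exists_countable_dense ℝ≥0
  have h : {ω | H.exit A ω < t} =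
      ⋃ q ∈ Q ∩ Iio t, (H.path q ⁻¹' ((↑) '' A : Set (OnePoint X)))ᶜ := by
    ext ω
    simp only [mem_ofPred_eq, H.exit_lt_iff, mem_iUnion, mem_inter_iff, mem_Iio, mem_compl_iff,
      mem_preimage, exists_prop]
    constructor
    · rintro ⟨s, hst, hs⟩
      have h1 := (H.rightCont_path ω s).tendsto.eventually (ho.mem_nhds hs)
      obtain ⟨u, hu, h2⟩ := (mem_nhdsGE_iff_exists_Ico_subset (a := s)).1 h1
      obtain ⟨q, hqQ, hq⟩ := hQd.exists_mem_open (isOpen_Ioo (a := s) (b := min u t))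
        (nonempty_Ioo.2 (lt_min hu hst))
      exact ⟨q, ⟨hqQ, hq.2.trans_le (min_le_right _ _)⟩,
        h2 ⟨hq.1.le, hq.2.trans_le (min_le_left _ _)⟩⟩
    · rintro ⟨q, ⟨-, hqt⟩, hq⟩
      exact ⟨q, hqt, hq⟩
  rw [h]
  refine MeasurableSet.biUnion (hQc.mono inter_subset_left) fun q hq => ?_
  exact (H.filt.mono (le_of_lt hq.2) _ (H.adapted q A hA.isClosed.measurableSet)).compl

theorem exit_mono {A B : Set X} (hAB : A ⊆ B) (ω : Ω) : H.exit A ω ≤ H.exit B ω := by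
  by_contra h
  obtain ⟨t, h1, h2⟩ := exists_between (not_le.1 h)
  lift t to ℝ≥0 using h2.ne_top
  obtain ⟨s, hs, hsB⟩ := H.exit_lt_iff.1 h1
  exact h2.not_gt (H.exit_lt_iff.2 ⟨s, hs, fun h => hsB (image_mono hAB h)⟩)

theorem exit_le {A : Set X} {ω : Ω} {s : ℝ≥0} (hs : H.path s ω ∉ ((↑) '' A : Set (OnePoint X))) :
    H.exit A ω ≤ s := by
  rw [exit, if_pos ⟨s, hs⟩]
  exact WithTop.coe_le_coe.2 (csInf_le (OrderBot.bddBelow _) hs)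

/-- If the path were in the interior at its exit time, right-continuity would keep it in `A` for
longer. -/
theorem path_exit_notMem {A : Set X} {ω : Ω} {e : ℝ≥0} (he : H.exit A ω = e) :
    H.path e ω ∉ ((↑) '' interior A : Set (OnePoint X)) := by
  intro hmem
  have ho : IsOpen ((↑) '' interior A : Set (OnePoint X)) :=
    OnePoint.isOpenEmbedding_coe.isOpenMap _ isOpen_interior
  have h1 := (H.rightCont_path ω e).tendsto.eventually (ho.mem_nhds hmem)
  obtain ⟨u, hu, h2⟩ := (mem_nhdsGE_iff_exists_Ico_subset (a := e)).1 h1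
  have h3 : H.exit A ω < u := by
    rw [he]
    exact WithTop.coe_lt_coe.2 hu
  obtain ⟨s, hsu, hs⟩ := H.exit_lt_iff.1 h3
  refine hs ?_
  rcases lt_or_ge s e with hse | hse
  · by_contra hs'
    exact (H.exit_le hs').not_gt (by rw [he]; exact WithTop.coe_lt_coe.2 hse)
  · exact image_mono interior_subset (h2 ⟨hse, hsu⟩)

theorem lt_exitTime_of_mem_alive (hF : IsExhaustion F D) {t : ℝ≥0} {ω : Ω}
    (hω : ω ∈ H.alive F t) : (t : ℝ≥0∞) < H.exitTime D ω := by
  obtain ⟨k, hk⟩ := mem_iUnion.1 hω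
  obtain ⟨u, hu, h2⟩ := (mem_nhdsGE_iff_exists_Ico_subset (a := t)).1 (H.eventually_stays hF hk)
  obtain ⟨s, hts, hsu⟩ := exists_between (mem_Ioi.1 hu)
  have h3 := h2 ⟨hts.le, hsu⟩
  refine lt_of_lt_of_le (ENNReal.coe_lt_coe.2 hts) (le_iInf₂ fun v hv => ?_)
  rw [ENNReal.coe_le_coe]
  by_contra hvs
  refine hv (image_mono (hF.subset (k + 1)) ?_)
  simpa using h3 v (not_le.1 hvs).le

/-- The danger is a path whose left limit at some time `σ` lies outside `D` although `X_σ` is in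
`D`: it leaves every `F k` before `σ` without leaving `D`. Quasi-left-continuity excludes this. If
the exit times of the `F k` increase to `σ ≤ t`, the exit positions converge to `X_σ`; a limit in
`D` would be interior to some `F (j + 1)`, whereas late exit positions avoid that interior. So `X_σ`
is outside `D` and `τ_D ≤ σ ≤ t`. -/
theorem ae_lt_exitTime_iff (hF : IsExhaustion F D) (x : X) :
    ∀ᵐ ω ∂H.prob x, ∀ t : ℝ≥0, (t : ℝ≥0∞) < H.exitTime D ω ↔ ω ∈ H.alive F t := by
  filter_upwards [H.quasiLeftCont (fun k => H.exit (F k)) (fun ω => ⨆ k, H.exit (F k) ω)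
    (fun k => H.isStoppingTime_exit (hF.isCompact k))
    (fun ω a b hab => H.exit_mono (hF.monotone hab) ω) (fun ω => isLUB_iSup) x] with ω hω t
  refine ⟨fun ht => ?_, H.lt_exitTime_of_mem_alive hF⟩
  by_contra hal
  have hle : ∀ k, H.exit (F k) ω ≤ t := by
    intro k
    have : ω ∉ H.stays (F k) 0 t := fun h => hal (mem_iUnion.2 ⟨k, h⟩)
    simp only [stays, mem_ofPred_eq, not_forall, zero_add] at this
    obtain ⟨s, hst, hs⟩ := this
    exact (H.exit_le hs).trans (WithTop.coe_le_coe.2 hst)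
  have hSle : ⨆ k, H.exit (F k) ω ≤ t := iSup_le hle
  have hlim := hω (hSle.trans_lt (WithTop.coe_lt_top t))
  obtain ⟨σ, hσ⟩ := WithTop.ne_top_iff_exists.1 (hSle.trans_lt (WithTop.coe_lt_top t)).ne
  have hσt : σ ≤ t := by
    rw [← hσ] at hSle
    exact WithTop.coe_le_coe.1 hSle
  have hpath : stoppedValue H.path (fun ω => ⨆ k, H.exit (F k) ω) ω = H.path σ ω := by
    rw [stoppedValue, ← hσ]
    rfl
  rw [hpath] at hlim
  have hnot : H.path σ ω ∉ ((↑) '' D : Set (OnePoint X)) := by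
    rw [← hF.iUnion_eq]
    rintro ⟨y, hy, hyσ⟩
    obtain ⟨j, hj⟩ := mem_iUnion.1 hy
    have ho : IsOpen ((↑) '' interior (F (j + 1)) : Set (OnePoint X)) :=
      OnePoint.isOpenEmbedding_coe.isOpenMap _ isOpen_interior
    have hmem : H.path σ ω ∈ ((↑) '' interior (F (j + 1)) : Set (OnePoint X)) :=
      ⟨y, hF.subset_interior j hj, hyσ⟩
    obtain ⟨k, hk, hkj⟩ :=
      ((hlim.eventually (ho.mem_nhds hmem)).and (eventually_ge_atTop (j + 1))).exists
    obtain ⟨e, he⟩ := WithTop.ne_top_iff_exists.1 ((hle k).trans_lt (WithTop.coe_lt_top t)).ne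
    have hpe : stoppedValue H.path (H.exit (F k)) ω = H.path e ω := by
      rw [stoppedValue, ← he]
      rfl
    rw [hpe] at hk
    exact H.path_exit_notMem he.symm (image_mono (interior_mono (hF.monotone hkj)) hk)
  have : H.exitTime D ω ≤ t := (iInf₂_le σ hnot).trans (ENNReal.coe_le_coe.2 hσt)
  exact this.not_gt ht

theorem killedSemigroup_eq (hF : IsExhaustion F D) (t : ℝ≥0) {f : X → ℝ≥0∞} (hf : Measurable f)
    (x : X) : H.killedSemigroup D t f x = ∫⁻ y, f y ∂H.killedKernel hF (t, x) := by
  rw [killedKernel_apply, H.lintegral_killedLaw t x hf,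
    ← lintegral_indicator (H.measurableSet_alive hF t), killedSemigroup]
  refine lintegral_congr_ae ?_
  filter_upwards [H.ae_lt_exitTime_iff hF x] with ω hω
  have hiff : ω ∈ {ω | (t : ℝ≥0∞) < H.exitTime D ω} ↔ ω ∈ H.alive F t := hω t
  by_cases h : ω ∈ H.alive F t
  · rw [indicator_of_mem h, indicator_of_mem (hiff.2 h)]
  · rw [indicator_of_notMem h, indicator_of_notMem fun h' => h (hiff.1 h')]

theorem killedKernel_compl (hF : IsExhaustion F D) (hD : MeasurableSet D) (t : ℝ≥0) (x : X) :
    H.killedKernel hF (t, x) Dᶜ = 0 := by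
  rw [killedKernel_apply, killedLaw, H.law_apply _ _ hD.compl]
  refine measure_mono_null (t := ∅) ?_ measure_empty
  rintro ω ⟨h1, y, hy, h2⟩
  obtain ⟨k, hk⟩ := mem_iUnion.1 h1
  obtain ⟨z, hz, h3⟩ := hk t le_rfl
  rw [zero_add, ← h2] at h3
  rw [OnePoint.coe_injective h3] at hz
  exact hy (hF.subset k hz)

theorem killedKernel_eq_zero (hF : IsExhaustion F D) (t : ℝ≥0) {x : X} (hx : x ∉ D) :
    H.killedKernel hF (t, x) = 0 := by
  have h0 : H.prob x (H.alive F t) = 0 := by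
    refine measure_mono_null (t := {ω | ¬ H.path 0 ω = x}) ?_ (ae_iff.1 (H.start x))
    intro ω h1 h2
    obtain ⟨k, hk⟩ := mem_iUnion.1 h1
    obtain ⟨z, hz, h3⟩ := hk 0 zero_le
    rw [zero_add, h2] at h3
    rw [OnePoint.coe_injective h3] at hz
    exact hx (hF.subset k hz)
  rw [killedKernel_apply, killedLaw, law, Measure.restrict_eq_zero.2, Measure.map_zero]
  exact measure_mono_null inter_subset_left h0

end HuntProcess

/-! ### Construction of the Green function -/

theorem setLIntegral_Ioi_shift (h : ℝ → ℝ≥0∞) (t : ℝ) :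
    ∫⁻ s in Ioi (0 : ℝ), h (t + s) = ∫⁻ s in Ioi t, h s := by
  have := (measurePreserving_add_left volume t).setLIntegral_comp_preimage_emb
    (measurableEmbedding_addLeft t) h (Ioi t)
  rw [← this]
  simp

theorem tendsto_setLIntegral_Ioi (h : ℝ → ℝ≥0∞) :
    Tendsto (fun t : ℝ≥0 => ∫⁻ s in Ioi (t : ℝ), h s) (𝓝[>] 0) (𝓝 (∫⁻ s in Ioi (0 : ℝ), h s)) := by
  have hle : ∀ t : ℝ≥0, ∫⁻ s in Ioi (t : ℝ), h s ≤ ∫⁻ s in Ioi (0 : ℝ), h s := fun t =>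
    lintegral_mono_set (Ioi_subset_Ioi t.2)
  refine tendsto_order.2 ⟨fun a ha => ?_, fun a ha => Eventually.of_forall fun t => (hle t).trans_lt ha⟩
  have hU : Ioi (0 : ℝ) = ⋃ n : ℕ, Ioi (((1 : ℝ≥0) / (n + 1) : ℝ≥0) : ℝ) := by
    ext s
    simp only [mem_Ioi, mem_iUnion]
    constructor
    · intro hs
      obtain ⟨n, hn⟩ := exists_nat_one_div_lt hs
      exact ⟨n, by simpa using hn⟩
    · rintro ⟨n, hn⟩
      exact lt_of_le_of_lt (NNReal.coe_nonneg _) hn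
  have hmono : Monotone fun n : ℕ => Ioi (((1 : ℝ≥0) / (n + 1) : ℝ≥0) : ℝ) := by
    intro a b hab
    refine Ioi_subset_Ioi (NNReal.coe_le_coe.2 ?_)
    gcongr
  rw [hU, setLIntegral_iUnion_of_directed _ hmono.directed_le] at ha
  obtain ⟨n, hn⟩ := lt_iSup_iff.1 ha
  filter_upwards [nhdsWithin_le_nhds (Iio_mem_nhds (show (0 : ℝ≥0) < 1 / (n + 1) by positivity))]
    with t ht
  exact hn.trans_le (lintegral_mono_set (Ioi_subset_Ioi (NNReal.coe_le_coe.2 (le_of_lt ht))))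

/-- The Green function of `D` obtained by integrating a transition density in time. -/
def greenOf {X : Type*} (D : Set X) (p : ℝ≥0 → X → X → ℝ≥0∞) (x y : X) : ℝ≥0∞ :=
  D.indicator (fun x => D.indicator (fun y => ∫⁻ t in Ioi (0 : ℝ), p t.toNNReal x y) y) x

theorem greenOf_swap {X : Type*} (D : Set X) (p : ℝ≥0 → X → X → ℝ≥0∞) (x y : X) :
    greenOf D (fun t x y => p t y x) x y = greenOf D p y x := by
  by_cases hx : x ∈ D <;> by_cases hy : y ∈ D <;> simp [greenOf, hx, hy]

theorem measurable_greenOf {X : Type*} [MeasurableSpace X] {D : Set X} (hD : MeasurableSet D)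
    {p : ℝ≥0 → X → X → ℝ≥0∞} (hp : Measurable fun z : ℝ≥0 × X × X => p z.1 z.2.1 z.2.2) :
    Measurable (Function.uncurry (greenOf D p)) := by
  have h1 : Measurable fun w : X × X => ∫⁻ t in Ioi (0 : ℝ), p t.toNNReal w.1 w.2 := by
    refine Measurable.lintegral_prod_right' (f := fun w : (X × X) × ℝ =>
      p w.2.toNNReal w.1.1 w.1.2) ?_
    exact hp.comp (f := fun w : (X × X) × ℝ => (w.2.toNNReal, w.1.1, w.1.2)) (by fun_prop)
  have h2 : Function.uncurry (greenOf D p) =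
      (D ×ˢ D).indicator fun w : X × X => ∫⁻ t in Ioi (0 : ℝ), p t.toNNReal w.1 w.2 := by
    ext ⟨x, y⟩
    by_cases hx : x ∈ D <;> by_cases hy : y ∈ D <;> simp [greenOf, hx, hy]
  rw [h2]
  exact h1.indicator (hD.prod hD)

namespace HuntProcess

variable {X Ω Ω' : Type*} [MetricSpace X] [ProperSpace X] [MeasurableSpace X] [BorelSpace X]
  [mΩ : MeasurableSpace Ω] [MeasurableSpace Ω'] (H : HuntProcess X Ω) (H' : HuntProcess X Ω')
  {F : ℕ → Set X} {D : Set X} {m : Measure X} {p : ℝ≥0 → X → X → ℝ≥0∞}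

theorem potentialOp_killedSemigroup (hF : IsExhaustion F D) {f : X → ℝ≥0∞} (hf : Measurable f)
    (x : X) : potentialOp (H.killedSemigroup D) 0 f x =
      ∫⁻ t in Ioi (0 : ℝ), ∫⁻ y, f y ∂H.killedKernel hF (t.toNNReal, x) := by
  simp [potentialOp, H.killedSemigroup_eq hF _ hf]

theorem lintegral_greenOf [SFinite m] (hF : IsExhaustion F D) (hD : MeasurableSet D)
    (hp : Measurable fun z : ℝ≥0 × X × X => p z.1 z.2.1 z.2.2)
    (hpκ : ∀ t : ℝ≥0, 0 < t → ∀ x (f : X → ℝ≥0∞), Measurable f →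
        ∫⁻ y, p t x y * f y ∂m.restrict D = ∫⁻ y, f y ∂H.killedKernel hF (t, x))
    {f : X → ℝ≥0∞} (hf : Measurable f) (x : X) :
    ∫⁻ y, greenOf D p x y * f y ∂m = potentialOp (H.killedSemigroup D) 0 f x := by
  rw [H.potentialOp_killedSemigroup hF hf]
  by_cases hx : x ∈ D
  · have hpx : Measurable fun w : X × ℝ => p w.2.toNNReal x w.1 :=
      hp.comp (f := fun w : X × ℝ => (w.2.toNNReal, x, w.1)) (by fun_prop)
    calc ∫⁻ y, greenOf D p x y * f y ∂m
        = ∫⁻ y in D, (∫⁻ t in Ioi (0 : ℝ), p t.toNNReal x y * f y) ∂m := by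
          rw [← lintegral_indicator hD]
          refine lintegral_congr fun y => ?_
          by_cases hy : y ∈ D
          · have hm : Measurable fun t : ℝ => p t.toNNReal x y :=
              hpx.comp measurable_prodMk_left
            simp only [greenOf, hx, hy, indicator_of_mem]
            rw [lintegral_mul_const _ hm]
          · simp [greenOf, hx, hy]
      _ = ∫⁻ t in Ioi (0 : ℝ), ∫⁻ y in D, p t.toNNReal x y * f y ∂m := by
          rw [lintegral_lintegral_swap]
          exact (hpx.mul (hf.comp measurable_fst)).aemeasurable
      _ = _ := by
          refine setLIntegral_congr_fun measurableSet_Ioi fun t ht => ?_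
          exact hpκ _ (Real.toNNReal_pos.2 ht) x f hf
  · simp [greenOf, hx, H.killedKernel_eq_zero hF _ hx]

/-- By Chapman-Kolmogorov, `T^D_t G(·, y)(x)` is the integral of `p s x y` over `s > t`, which
increases to `G(x, y)` as `t` decreases to `0`. Excessiveness is a statement about every `x` and
`y`, which is why the equation is needed pointwise. -/
theorem isExcessiveOn_greenOf [SFinite m] (hF : IsExhaustion F D) (hD : MeasurableSet D)
    (hp : Measurable fun z : ℝ≥0 × X × X => p z.1 z.2.1 z.2.2)
    (hpκ : ∀ t : ℝ≥0, 0 < t → ∀ x (f : X → ℝ≥0∞), Measurable f →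
        ∫⁻ y, p t x y * f y ∂m.restrict D = ∫⁻ y, f y ∂H.killedKernel hF (t, x))
    (hCK : ∀ s t : ℝ≥0, 0 < s → 0 < t → ∀ x y,
      ∫⁻ z, p s x z * p t z y ∂m.restrict D = p (s + t) x y) {y : X} (hy : y ∈ D) :
    IsExcessiveOn (H.killedSemigroup D) 0 D fun x => greenOf D p x y := by
  have hGm : Measurable fun x => greenOf D p x y :=
    (measurable_greenOf hD hp).comp (f := fun x : X => (x, y)) (by fun_prop)
  intro x hx
  have hval : ∀ t : ℝ≥0, 0 < t → ENNReal.ofReal (Real.exp (-0 * t)) *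
      H.killedSemigroup D t (fun x => greenOf D p x y) x =
      ∫⁻ s in Ioi (t : ℝ), p s.toNNReal x y := by
    intro t ht
    have hpx : Measurable (p t x) :=
      hp.comp (f := fun z : X => (t, x, z)) (by fun_prop)
    have hpy : Measurable fun w : X × ℝ => p w.2.toNNReal w.1 y :=
      hp.comp (f := fun w : X × ℝ => (w.2.toNNReal, w.1, y)) (by fun_prop)
    rw [H.killedSemigroup_eq hF _ hGm, ← hpκ t ht x _ hGm]
    simp only [neg_zero, zero_mul, Real.exp_zero, ENNReal.ofReal_one, one_mul]
    calc ∫⁻ z in D, p t x z * greenOf D p z y ∂m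
        = ∫⁻ z in D, (∫⁻ s in Ioi (0 : ℝ), p t x z * p s.toNNReal z y) ∂m := by
          refine setLIntegral_congr_fun hD fun z hz => ?_
          have hm : Measurable fun s : ℝ => p s.toNNReal z y := hpy.comp measurable_prodMk_left
          simp only [greenOf, hz, hy, indicator_of_mem]
          rw [lintegral_const_mul _ hm]
      _ = ∫⁻ s in Ioi (0 : ℝ), ∫⁻ z in D, p t x z * p s.toNNReal z y ∂m := by
          rw [lintegral_lintegral_swap]
          exact ((hpx.comp measurable_fst).mul hpy).aemeasurable
      _ = ∫⁻ s in Ioi (0 : ℝ), p (t + s : ℝ).toNNReal x y := by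
          refine setLIntegral_congr_fun measurableSet_Ioi fun s hs => ?_
          rw [hCK t _ ht (Real.toNNReal_pos.2 hs), Real.toNNReal_add t.coe_nonneg (le_of_lt hs),
            Real.toNNReal_coe]
      _ = _ := setLIntegral_Ioi_shift (fun s => p s.toNNReal x y) t
  have hG : greenOf D p x y = ∫⁻ s in Ioi (0 : ℝ), p s.toNNReal x y := by simp [greenOf, hx, hy]
  refine ⟨fun t ht => ?_, ?_⟩
  · rw [hval t ht]
    beta_reduce
    rw [hG]
    exact lintegral_mono_set (Ioi_subset_Ioi t.2)
  · beta_reduce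
    rw [hG]
    refine (tendsto_setLIntegral_Ioi _).congr' ?_
    filter_upwards [self_mem_nhdsWithin] with t ht
    exact (hval t ht).symm

/-- The Green function of a relatively compact set exists for dual processes with absolutely
continuous transition kernels. -/
theorem exists_isGreenFunction [IsLocallyFiniteMeasure m] (hF : IsExhaustion F D)
    (hD : MeasurableSet D) (hmD : m D ≠ ∞)
    (hac : ∀ t : ℝ≥0, 0 < t → ∀ x, H.kernel t x ≪ m)
    (hac' : ∀ t : ℝ≥0, 0 < t → ∀ x, H'.kernel t x ≪ m)
    (hdual : ∀ h : ℝ≥0, 0 < h → ∀ f g : X → ℝ≥0∞, Measurable f → Measurable g →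
      ∫⁻ x, f x * ∫⁻ y, g y ∂H.kernel h x ∂m = ∫⁻ y, g y * ∫⁻ x, f x ∂H'.kernel h y ∂m) :
    ∃ G : X → X → ℝ≥0∞, IsGreenFunction m H H' D G := by
  have hfin : IsFiniteMeasure (m.restrict D) := ⟨by simpa using hmD.lt_top⟩
  -- The killed kernels do not charge the complement of `D`, so the finite measure `m.restrict D`
  -- can serve as reference measure.
  have hacD : ∀ (κ : Measure X), κ ≪ m → κ Dᶜ = 0 → κ ≪ m.restrict D := by
    intro κ h1 h2
    refine Measure.AbsolutelyContinuous.mk fun N hN hN0 => ?_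
    rw [Measure.restrict_apply hN] at hN0
    refine measure_mono_null (t := (N ∩ D) ∪ Dᶜ) (fun z hz => ?_) (measure_union_null (h1 hN0) h2)
    by_cases hzD : z ∈ D
    · exact Or.inl ⟨hz, hzD⟩
    · exact Or.inr hzD
  obtain ⟨p, hp, hpκ, hpκ', hCK⟩ := exists_dual_density (μ := m.restrict D)
    (κ := H.killedKernel hF) (κ' := H'.killedKernel hF)
    (fun t ht x => hacD _ ((Measure.absolutelyContinuous_of_le
      (H.killedKernel_le_kernel hF t x)).trans (hac t ht x)) (H.killedKernel_compl hF hD t x))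
    (fun t ht x => hacD _ ((Measure.absolutelyContinuous_of_le
      (H'.killedKernel_le_kernel hF t x)).trans (hac' t ht x)) (H'.killedKernel_compl hF hD t x))
    (fun s t _ _ x f hf => H.killedKernel_add hF s t x hf)
    (fun s t _ _ x f hf => H'.killedKernel_add hF s t x hf)
    (by
      intro t ht f g hf hg
      rw [setLIntegral_eq_of_support_subset, setLIntegral_eq_of_support_subset]
      · exact killedKernel_dual hF hdual ht hf hg
      · intro x hx
        by_contra hxD
        exact hx (by simp [H'.killedKernel_eq_zero hF t hxD])
      · intro x hx
        by_contra hxD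
        exact hx (by simp [H.killedKernel_eq_zero hF t hxD]))
  have hp' : Measurable fun z : ℝ≥0 × X × X => p z.1 z.2.2 z.2.1 :=
    hp.comp (f := fun z : ℝ≥0 × X × X => (z.1, z.2.2, z.2.1)) (by fun_prop)
  have hCK' : ∀ s t : ℝ≥0, 0 < s → 0 < t → ∀ x y,
      ∫⁻ z, p s z x * p t y z ∂m.restrict D = p (s + t) y x := by
    intro s t hs ht x y
    simp_rw [mul_comm (p s _ _)]
    rw [hCK t s ht hs, add_comm]
  refine ⟨greenOf D p, ?_, ?_, ?_, ?_, ?_, ?_⟩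
  · exact measurable_greenOf hD hp
  · rintro x y (h | h)
    · simp [greenOf, h]
    · simp [greenOf, h]
  · exact fun f hf x => H.lintegral_greenOf hF hD hp hpκ hf x
  · intro f hf y
    have := H'.lintegral_greenOf (p := fun t x y => p t y x) hF hD hp' hpκ' hf y
    simpa only [greenOf_swap] using this
  · exact fun y hy => H.isExcessiveOn_greenOf hF hD hp hpκ hCK hy
  · intro x hx
    have := H'.isExcessiveOn_greenOf (p := fun t x y => p t y x) hF hD hp' hpκ' hCK' hx
    simpa only [greenOf_swap] using this

end HuntProcess

/-! ### Duality of the semigroups and its consequences for the dual kernel -/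

namespace HuntProcess

variable {X Ω Ω' : Type*} [MetricSpace X] [ProperSpace X] [MeasurableSpace X] [BorelSpace X]
  [mΩ : MeasurableSpace Ω] [MeasurableSpace Ω'] (H : HuntProcess X Ω) (H' : HuntProcess X Ω')
  {m : Measure X}

theorem kernel_lintegral_le (f : BoundedContinuousFunction X ℝ≥0) (t : ℝ≥0) (x : X) :
    ∫⁻ y, f y ∂H.kernel t x ≤ (nndist f 0 : ℝ≥0) := by
  calc ∫⁻ y, f y ∂H.kernel t x ≤ ∫⁻ _, (nndist f 0 : ℝ≥0) ∂H.kernel t x :=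
        lintegral_mono fun y =>
          ENNReal.coe_le_coe.2 (BoundedContinuousFunction.NNReal.upper_bound f y)
    _ ≤ (nndist f 0 : ℝ≥0) := by
        rw [lintegral_const]
        exact mul_le_of_le_one_right' (H.law_le_one x t univ)

theorem rightCont_kernel (f : BoundedContinuousFunction X ℝ≥0) (x : X) (t : ℝ≥0) :
    ContinuousWithinAt (fun s => ∫⁻ y, f y ∂H.kernel s x) (Ioi t) t := by
  have : Nonempty X := ⟨x⟩
  have hfm : Measurable fun x => (f x : ℝ≥0∞) := f.continuous.measurable.coe_nnreal_ennreal
  have hfc : Continuous fun x => (f x : ℝ≥0∞) := ENNReal.continuous_coe.comp f.continuous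
  have hC : ∀ x, (f x : ℝ≥0∞) ≤ (nndist f 0 : ℝ≥0) := fun x => by
    exact_mod_cast BoundedContinuousFunction.NNReal.upper_bound f x
  simp_rw [← H.semigroup_eq _ hfm, semigroup]
  refine ContinuousWithinAt.mono (t := Ici t) ?_ Ioi_subset_Ici_self
  refine tendsto_lintegral_filter_of_dominated_convergence (fun _ => ((nndist f 0 : ℝ≥0) : ℝ≥0∞))
    (Eventually.of_forall fun s => H.measurable_extendZero_path s hfm)
    (Eventually.of_forall fun s => ae_of_all _ fun ω => extendZero_le hC _)
    (by simp) (ae_of_all _ fun ω => ?_)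
  rcases H.living_cases t ω with ⟨-, h⟩ | ⟨-, y, h, -⟩
  · refine tendsto_const_nhds.congr' ?_
    filter_upwards [self_mem_nhdsWithin] with s hs
    rw [h, H.absorbed ω t s hs h]
  · have h2 := continuous_extendZero hfc y
    rw [← h] at h2
    exact h2.tendsto.comp (H.rightCont_path ω t)

theorem measurable_kernel_lintegral (f : BoundedContinuousFunction X ℝ≥0) :
    Measurable fun z : ℝ≥0 × X => ∫⁻ y, f y ∂H.kernel z.1 z.2 :=
  measurable_uncurry_of_rightCont (φ := fun t x => ∫⁻ y, f y ∂H.kernel t x)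
    (fun _ => f.continuous.measurable.coe_nnreal_ennreal.lintegral_kernel)
    fun x t => H.rightCont_kernel f x t

/-- The function `t ↦ ∫ f T_t g dm`. -/
def pairing (m : Measure X) (f g : BoundedContinuousFunction X ℝ≥0) (t : ℝ) : ℝ≥0∞ :=
  ∫⁻ x, f x * ∫⁻ y, g y ∂H.kernel t.toNNReal x ∂m

theorem measurable_pairing [SFinite m] (f g : BoundedContinuousFunction X ℝ≥0) :
    Measurable (H.pairing m f g) := by
  refine Measurable.lintegral_prod_right' (f := fun w : ℝ × X =>
    (f w.2 : ℝ≥0∞) * ∫⁻ y, g y ∂H.kernel w.1.toNNReal w.2) ?_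
  have hfm : Measurable fun x => (f x : ℝ≥0∞) := f.continuous.measurable.coe_nnreal_ennreal
  exact (hfm.comp measurable_snd).mul ((H.measurable_kernel_lintegral g).comp
    (f := fun w : ℝ × X => (w.1.toNNReal, w.2)) (by fun_prop))

theorem pairing_le (f g : BoundedContinuousFunction X ℝ≥0) (t : ℝ) :
    H.pairing m f g t ≤ (∫⁻ x, f x ∂m) * (nndist g 0 : ℝ≥0) := by
  have hfm : Measurable fun x => (f x : ℝ≥0∞) := f.continuous.measurable.coe_nnreal_ennreal
  rw [← lintegral_mul_const _ hfm]
  exact lintegral_mono fun x => mul_le_mul_right (H.kernel_lintegral_le g _ x) _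

theorem rightCont_pairing {f g : BoundedContinuousFunction X ℝ≥0} (hf : ∫⁻ x, f x ∂m ≠ ∞) {t : ℝ}
    (ht : 0 ≤ t) : ContinuousWithinAt (H.pairing m f g) (Ioi t) t := by
  have hfm : Measurable fun x => (f x : ℝ≥0∞) := f.continuous.measurable.coe_nnreal_ennreal
  have hgm : Measurable fun x => (g x : ℝ≥0∞) := g.continuous.measurable.coe_nnreal_ennreal
  refine tendsto_lintegral_filter_of_dominated_convergence
    (fun x => (f x : ℝ≥0∞) * (nndist g 0 : ℝ≥0))
    (Eventually.of_forall fun s => hfm.mul hgm.lintegral_kernel)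
    (Eventually.of_forall fun s => ae_of_all _ fun x =>
      mul_le_mul_right (H.kernel_lintegral_le g _ x) _) ?_ (ae_of_all _ fun x => ?_)
  · rw [lintegral_mul_const _ hfm]
    finiteness
  · refine ENNReal.Tendsto.const_mul ?_ (Or.inr ENNReal.coe_ne_top)
    refine (H.rightCont_kernel g x t.toNNReal).tendsto.comp (tendsto_nhdsWithin_iff.2 ⟨?_, ?_⟩)
    · exact (continuous_real_toNNReal.tendsto t).mono_left nhdsWithin_le_nhds
    · filter_upwards [self_mem_nhdsWithin] with s hs
      exact (Real.toNNReal_lt_toNNReal_iff (ht.trans_lt hs)).2 hs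

theorem laplace_pairing [SFinite m] (f g : BoundedContinuousFunction X ℝ≥0) (β : ℝ) :
    ∫⁻ t in Ioi (0 : ℝ), ENNReal.ofReal (Real.exp (-β * t)) * H.pairing m f g t =
      ∫⁻ x, f x * potentialOp H.semigroup β (fun y => g y) x ∂m := by
  have hfm : Measurable fun x => (f x : ℝ≥0∞) := f.continuous.measurable.coe_nnreal_ennreal
  have hgm : Measurable fun x => (g x : ℝ≥0∞) := g.continuous.measurable.coe_nnreal_ennreal
  have hK : Measurable fun w : ℝ × X => ∫⁻ y, g y ∂H.kernel w.1.toNNReal w.2 :=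
    (H.measurable_kernel_lintegral g).comp (f := fun w : ℝ × X => (w.1.toNNReal, w.2))
      (by fun_prop)
  have hKx : ∀ t : ℝ, Measurable fun x => ∫⁻ y, g y ∂H.kernel t.toNNReal x := fun t =>
    hgm.lintegral_kernel
  have hKt : ∀ x : X, Measurable fun t : ℝ => ∫⁻ y, g y ∂H.kernel t.toNNReal x := fun x =>
    hK.comp (f := fun t : ℝ => (t, x)) (by fun_prop)
  have he : Measurable fun t : ℝ => ENNReal.ofReal (Real.exp (-β * t)) := by fun_prop
  calc _ = ∫⁻ t in Ioi (0 : ℝ), ∫⁻ x, f x *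
        (ENNReal.ofReal (Real.exp (-β * t)) * ∫⁻ y, g y ∂H.kernel t.toNNReal x) ∂m := by
        refine lintegral_congr fun t => ?_
        have hm : Measurable fun x => (f x : ℝ≥0∞) * ∫⁻ y, g y ∂H.kernel t.toNNReal x :=
          hfm.mul (hKx t)
        rw [pairing, ← lintegral_const_mul _ hm]
        refine lintegral_congr fun x => ?_
        ring
    _ = ∫⁻ x, (∫⁻ t in Ioi (0 : ℝ), f x *
        (ENNReal.ofReal (Real.exp (-β * t)) * ∫⁻ y, g y ∂H.kernel t.toNNReal x)) ∂m := by
        rw [lintegral_lintegral_swap]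
        exact ((hfm.comp measurable_snd).mul ((he.comp measurable_fst).mul hK)).aemeasurable
    _ = _ := by
        refine lintegral_congr fun x => ?_
        have hm : Measurable fun t : ℝ => ENNReal.ofReal (Real.exp (-β * t)) *
          ∫⁻ y, g y ∂H.kernel t.toNNReal x := he.mul (hKt x)
        rw [lintegral_const_mul _ hm, potentialOp]
        simp_rw [H.semigroup_eq _ hgm]

/-- Every interval `(t, u)` has positive length, hence contains points of equality. -/
theorem eq_of_ae_eq_of_rightCont {a b : ℝ → ℝ≥0∞}
    (h : ∀ᵐ t ∂volume.restrict (Ioi (0 : ℝ)), a t = b t) {t : ℝ} (ht : 0 ≤ t)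
    (ha : ContinuousWithinAt a (Ioi t) t) (hb : ContinuousWithinAt b (Ioi t) t) : a t = b t := by
  refine tendsto_nhds_unique_of_frequently_eq ha hb fun hev => ?_
  obtain ⟨u, hu, h2⟩ := mem_nhdsGT_iff_exists_Ioo_subset.1 hev
  have h3 : volume.restrict (Ioi (0 : ℝ)) (Ioo t u) = 0 :=
    measure_mono_null (fun s hs => h2 hs) (ae_iff.1 h)
  have h4 : Ioo t u ⊆ Ioi 0 := fun s hs => ht.trans_lt hs.1
  rw [Measure.restrict_apply measurableSet_Ioo, inter_eq_left.2 h4, Real.volume_Ioo, ENNReal.ofReal_eq_zero] at h3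
  exact h3.not_gt (sub_pos.2 hu)

/-- Duality of the potential operators implies duality of the semigroups. -/
theorem kernel_dual [IsLocallyFiniteMeasure m] {H : HuntProcess X Ω} {H' : HuntProcess X Ω'}
    (hdual : AreDual m H H') (t : ℝ≥0) {f g : X → ℝ≥0∞} (hf : Measurable f) (hg : Measurable g) :
    ∫⁻ x, f x * ∫⁻ y, g y ∂H.kernel t x ∂m = ∫⁻ y, g y * ∫⁻ x, f x ∂H'.kernel t y ∂m := by
  rcases isEmpty_or_nonempty X with hX | ⟨⟨x₀⟩⟩
  · simp [Measure.eq_zero_of_isEmpty m]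
  refine duality_of_boundedSupport m x₀ _ _ (fun f g ⟨M, hM⟩ ⟨N, hN⟩ => ?_) hf hg
  have hfm : Measurable fun x => (f x : ℝ≥0∞) := f.continuous.measurable.coe_nnreal_ennreal
  have hgm : Measurable fun x => (g x : ℝ≥0∞) := g.continuous.measurable.coe_nnreal_ennreal
  have hfi := (lintegral_lt_top_of_boundedSupport m hM).ne
  have hgi := (lintegral_lt_top_of_boundedSupport m hN).ne
  -- Both pairings are bounded in `t`, and their Laplace transforms at `β` agree because the two
  -- potential operators share the density `u`.
  have hae : ∀ᵐ t ∂volume.restrict (Ioi (0 : ℝ)), H.pairing m f g t = H'.pairing m g f t := by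
    refine ae_eq_of_laplace_eq (H.measurable_pairing f g) (H'.measurable_pairing g f)
      (C := (max ((∫⁻ x, f x ∂m) * (nndist g 0 : ℝ≥0))
        ((∫⁻ x, g x ∂m) * (nndist f 0 : ℝ≥0))).toNNReal) ?_ ?_ ?_
    · intro t
      rw [ENNReal.coe_toNNReal (by finiteness)]
      exact (H.pairing_le f g t).trans (le_max_left _ _)
    · intro t
      rw [ENNReal.coe_toNNReal (by finiteness)]
      exact (H'.pairing_le g f t).trans (le_max_right _ _)
    · intro β hβ
      obtain ⟨u, hu⟩ := hdual β hβ
      have hum := hu.measurable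
      have hux : ∀ x, Measurable fun y => u x y := fun x => hum.comp measurable_prodMk_left
      have huy : ∀ y, Measurable fun x => u x y := fun y => hum.comp measurable_prodMk_right
      rw [H.laplace_pairing, H'.laplace_pairing]
      simp_rw [← hu.potential _ hgm, ← hu.dual_potential _ hfm]
      calc ∫⁻ x, f x * ∫⁻ y, u x y * g y ∂m ∂m = ∫⁻ x, ∫⁻ y, f x * (u x y * g y) ∂m ∂m := by
            refine lintegral_congr fun x => ?_
            have hm : Measurable fun y => u x y * g y := (hux x).mul hgm
            rw [lintegral_const_mul _ hm]
        _ = ∫⁻ y, ∫⁻ x, f x * (u x y * g y) ∂m ∂m := by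
            rw [lintegral_lintegral_swap]
            exact ((hfm.comp measurable_fst).mul (hum.mul (hgm.comp measurable_snd))).aemeasurable
        _ = _ := by
            refine lintegral_congr fun y => ?_
            have hm : Measurable fun x => u x y * f x := (huy y).mul hfm
            rw [← lintegral_const_mul _ hm]
            refine lintegral_congr fun x => ?_
            ring
  have h := eq_of_ae_eq_of_rightCont hae t.coe_nonneg (H.rightCont_pairing hfi t.coe_nonneg)
    (H'.rightCont_pairing hgi t.coe_nonneg)
  simpa [pairing] using h

theorem realSemigroup_indicator (t : ℝ≥0) {E : Set X} (hE : MeasurableSet E) (x : X) :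
    H.realSemigroup t (E.indicator 1) x = (H.kernel t x E).toReal := by
  have hp : MeasurableSet (H.path t ⁻¹' ((↑) '' E)) := H.filt.le t _ (H.adapted t E hE)
  rw [kernel_apply, H.law_apply x t hE, univ_inter, realSemigroup, ← measureReal_def,
    ← integral_indicator_one hp]
  refine integral_congr_ae (ae_of_all _ fun ω => ?_)
  rcases H.living_cases t ω with ⟨hl, h⟩ | ⟨hl, y, h, hy⟩
  · simp [h, indicator]
  · have hm := H.mem_preimage_path h E
    by_cases hyE : y ∈ E
    · simp only [indicator_of_mem (hm.2 hyE)]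
      simp [h, hyE]
    · simp only [indicator_of_notMem fun h' => hyE (hm.1 h')]
      simp [h, hyE]

theorem continuous_kernel_apply (hH : H.IsStrongFeller) {t : ℝ≥0} (ht : 0 < t) {E : Set X}
    (hE : MeasurableSet E) : Continuous fun x => (H.kernel t x E).toReal := by
  have h := hH t (E.indicator 1) ht (measurable_one.indicator hE)
    ⟨1, fun x => by by_cases hx : x ∈ E <;> simp [hx]⟩
  refine h.congr fun x => ?_
  exact H.realSemigroup_indicator t hE x

/-- An upper bound for the transition kernel is inherited by the strong Feller dual process. -/
theorem dual_kernel_le [IsLocallyFiniteMeasure m] [m.IsOpenPosMeasure]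
    {H : HuntProcess X Ω} {H' : HuntProcess X Ω'} {t : ℝ≥0} (ht : 0 < t)
    (hdual : ∀ f g : X → ℝ≥0∞, Measurable f → Measurable g →
      ∫⁻ x, f x * ∫⁻ y, g y ∂H.kernel t x ∂m = ∫⁻ y, g y * ∫⁻ x, f x ∂H'.kernel t y ∂m)
    (hH' : H'.IsStrongFeller) {V A : Set X} (hV : IsOpen V) (hA : MeasurableSet A) {K : ℝ≥0∞}
    (h : ∀ z ∈ A, ∀ W ⊆ V, MeasurableSet W → H.kernel t z W ≤ K * m W) {y : X} (hy : y ∈ V) :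
    H'.kernel t y A ≤ K * m A := by
  by_cases hfin : K * m A = ∞
  · rw [hfin]; exact le_top
  -- Duality bounds the integral of the dual kernel over any measurable part of `V` by `K m(A)`
  -- times the measure of that part.
  have hae : ∀ᵐ y ∂m.restrict V, H'.kernel t y A ≤ K * m A := by
    refine ae_le_of_forall_setLIntegral_le_of_sigmaFinite ((H'.kernel t).measurable_coe hA)
      fun W hW _ => ?_
    rw [Measure.restrict_restrict hW, setLIntegral_const]
    have hWV := hW.inter hV.measurableSet
    have h1 := hdual (A.indicator 1) ((W ∩ V).indicator 1) (measurable_one.indicator hA)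
      (measurable_one.indicator hWV)
    simp_rw [lintegral_indicator_one hA, lintegral_indicator_one hWV] at h1
    have hconv : ∀ (S : Set X) (u : X → ℝ≥0∞), MeasurableSet S →
        ∫⁻ x in S, u x ∂m = ∫⁻ x, S.indicator 1 x * u x ∂m := by
      intro S u hS
      rw [← lintegral_indicator hS]
      refine lintegral_congr fun x => ?_
      by_cases hx : x ∈ S <;> simp [hx]
    rw [hconv _ _ hWV, ← h1, ← hconv _ _ hA]
    calc ∫⁻ x in A, H.kernel t x (W ∩ V) ∂m ≤ ∫⁻ _ in A, K * m (W ∩ V) ∂m :=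
          setLIntegral_mono' hA fun z hz => h z hz _ inter_subset_right hWV
      _ = K * m A * m (W ∩ V) := by rw [setLIntegral_const]; ring
  rw [ae_restrict_iff' hV.measurableSet] at hae
  by_contra hlt
  -- Where the bound fails inside `V` is open by the strong Feller property, so if nonempty it would
  -- have positive measure.
  have ho : IsOpen (V ∩ {z | (K * m A).toReal < (H'.kernel t z A).toReal}) :=
    hV.inter (isOpen_lt continuous_const (H'.continuous_kernel_apply hH' ht hA))
  have hne : (V ∩ {z | (K * m A).toReal < (H'.kernel t z A).toReal}).Nonempty :=
    ⟨y, hy, (ENNReal.toReal_lt_toReal hfin (measure_ne_top _ _)).2 (not_le.1 hlt)⟩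
  refine (ho.measure_pos m hne).ne' (measure_mono_null ?_ (ae_iff.1 hae))
  rintro z ⟨hzV, hz⟩ hcon
  exact (ENNReal.toReal_mono hfin (hcon hzV)).not_gt hz

end HuntProcess

/-! ### Upper bounds for the transition kernels of both processes -/

namespace HuntProcess

variable {X Ω Ω' : Type*} [MetricSpace X] [ProperSpace X] [MeasurableSpace X] [BorelSpace X]
  [mΩ : MeasurableSpace Ω] [MeasurableSpace Ω'] (H : HuntProcess X Ω) (H' : HuntProcess X Ω')
  {m : Measure X} {n α : ℝ} {c : ℝ≥0} {r₀ : ℝ} {p : ℝ≥0 → X → X → ℝ≥0∞}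

/-- Upper bounds for the transition kernel of an `α`-stable-like process, in integrated form. -/
structure HasUpperBounds (m : Measure X) (n α : ℝ) (c : ℝ≥0) (r₀ : ℝ) : Prop where
  absolutelyContinuous : ∀ t : ℝ≥0, 0 < t → ∀ x, H.kernel t x ≪ m
  near : ∀ (t : ℝ≥0) (x : X) (A : Set X) (b : ℝ), 0 < t → (t : ℝ) < r₀ ^ α → MeasurableSet A →
    b < r₀ → (∀ z ∈ A, dist x z ≤ b) → H.kernel t x A ≤ c * (t : ℝ≥0∞) ^ (-n / α) * m A
  far : ∀ (t : ℝ≥0) (x : X) (A : Set X) (a b : ℝ), 0 < t → (t : ℝ) < r₀ ^ α → MeasurableSet A →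
    0 < a → b < r₀ → (∀ z ∈ A, a ≤ dist x z) → (∀ z ∈ A, dist x z ≤ b) →
    H.kernel t x A ≤ c * (t / ENNReal.ofReal (a / 2) ^ (n + α)) * m A

variable {H H'}

theorem kernel_apply_eq_density (hp : H.IsTransitionDensity m p) {t : ℝ≥0} (ht : 0 < t) (x : X)
    {A : Set X} (hA : MeasurableSet A) : H.kernel t x A = ∫⁻ y in A, p t x y ∂m := by
  have hA1 : Measurable (A.indicator (1 : X → ℝ≥0∞)) := measurable_one.indicator hA
  rw [← lintegral_indicator_one hA, ← H.semigroup_eq t hA1, (hp t x ht).2 _ hA1,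
    ← lintegral_indicator hA]
  refine lintegral_congr fun y => ?_
  by_cases hy : y ∈ A <;> simp [hy]

theorem kernel_le_near (hp : H.IsTransitionDensity m p) (hb : HasStableBounds n α c r₀ p)
    {t : ℝ≥0} (ht : 0 < t) (htr : (t : ℝ) < r₀ ^ α) {x : X} {A : Set X} (hA : MeasurableSet A)
    (hxA : ∀ z ∈ A, dist x z < r₀) : H.kernel t x A ≤ c * (t : ℝ≥0∞) ^ (-n / α) * m A := by
  rw [kernel_apply_eq_density hp ht x hA, ← setLIntegral_const]
  refine setLIntegral_mono' hA fun z hz => (hb t x z ht htr (hxA z hz)).2.trans ?_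
  exact mul_le_mul_right (min_le_left _ _) _

theorem kernel_le_far (hp : H.IsTransitionDensity m p) (hb : HasStableBounds n α c r₀ p)
    (hnα : 0 < n + α) {t : ℝ≥0} (ht : 0 < t) (htr : (t : ℝ) < r₀ ^ α) {x : X} {A : Set X}
    (hA : MeasurableSet A) {a : ℝ} (hxA : ∀ z ∈ A, dist x z < r₀) (haA : ∀ z ∈ A, a ≤ dist x z) :
    H.kernel t x A ≤ c * (t / ENNReal.ofReal a ^ (n + α)) * m A := by
  rw [kernel_apply_eq_density hp ht x hA, ← setLIntegral_const]
  refine setLIntegral_mono' hA fun z hz => (hb t x z ht htr (hxA z hz)).2.trans ?_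
  refine mul_le_mul_right ((min_le_right _ _).trans ?_) _
  refine ENNReal.div_le_div_left (ENNReal.rpow_le_rpow ?_ hnα.le) _
  rw [edist_dist]
  exact ENNReal.ofReal_le_ofReal (haA z hz)

theorem hasUpperBounds_of_density (hp : H.IsTransitionDensity m p)
    (hb : HasStableBounds n α c r₀ p) (hnα : 0 < n + α) : H.HasUpperBounds m n α c r₀ where
  absolutelyContinuous t ht x := by
    refine Measure.AbsolutelyContinuous.mk fun N hN hN0 => ?_
    rw [kernel_apply_eq_density hp ht x hN, Measure.restrict_eq_zero.2 hN0, lintegral_zero_measure]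
  near t x A b ht htr hA hbr hxA :=
    kernel_le_near hp hb ht htr hA fun z hz => (hxA z hz).trans_lt hbr
  far t x A a b ht htr hA ha hbr haA hxA :=
    kernel_le_far hp hb hnα ht htr hA (fun z hz => (hxA z hz).trans_lt hbr)
      fun z hz => (half_le_self ha.le).trans (haA z hz)

/-- `dual_kernel_le` needs the bound on a whole neighbourhood of `y`. Radius `r₀ - b` keeps all
distances to `A` below `r₀`, and radius at most `a / 2` keeps them above `a / 2`; this is the source
of `a / 2` in `HasUpperBounds.far`. -/
theorem hasUpperBounds_dual [IsLocallyFiniteMeasure m] [m.IsOpenPosMeasure]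
    (hp : H.IsTransitionDensity m p) (hb : HasStableBounds n α c r₀ p) (hnα : 0 < n + α)
    (hdual : AreDual m H H') (hH' : H'.IsStrongFeller) : H'.HasUpperBounds m n α c r₀ where
  absolutelyContinuous t ht y := by
    refine Measure.AbsolutelyContinuous.mk fun N hN hN0 => ?_
    -- With `K = ∞` and the convention `∞ * 0 = 0`, the inequality expresses absolute continuity.
    have := dual_kernel_le ht (fun f g hf hg => kernel_dual hdual t hf hg) hH' isOpen_univ hN
      (K := ∞) (fun z _ W _ hW => ?_) (mem_univ y)
    · simpa [hN0] using this
    · by_cases h0 : m W = 0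
      · rw [(hasUpperBounds_of_density hp hb hnα).absolutelyContinuous t ht z h0]
        exact zero_le
      · rw [ENNReal.top_mul h0]
        exact le_top
  near t y A b ht htr hA hbr hyA := by
    refine dual_kernel_le ht (fun f g hf hg => kernel_dual hdual t hf hg) hH'
      (Metric.isOpen_ball (x := y) (ε := r₀ - b)) hA (fun z hz W hWV hW => ?_)
      (Metric.mem_ball_self (sub_pos.2 hbr))
    refine kernel_le_near hp hb ht htr hW fun w hw => ?_
    have h1 := hyA z hz
    have h2 := Metric.mem_ball.1 (hWV hw)
    linarith [dist_triangle z y w, dist_comm z y, dist_comm w y]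
  far t y A a b ht htr hA ha hbr haA hyA := by
    refine dual_kernel_le ht (fun f g hf hg => kernel_dual hdual t hf hg) hH'
      (Metric.isOpen_ball (x := y) (ε := min (a / 2) (r₀ - b))) hA (fun z hz W hWV hW => ?_)
      (Metric.mem_ball_self (lt_min (half_pos ha) (sub_pos.2 hbr)))
    refine kernel_le_far hp hb hnα ht htr hW (fun w hw => ?_) fun w hw => ?_
    · have h1 := hyA z hz
      have h2 := (Metric.mem_ball.1 (hWV hw)).trans_le (min_le_right _ _)
      linarith [dist_triangle z y w, dist_comm z y, dist_comm w y]
    · have h1 := haA z hz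
      have h2 := (Metric.mem_ball.1 (hWV hw)).trans_le (min_le_left _ _)
      linarith [dist_triangle y w z, dist_comm w z, dist_comm w y]

theorem HasUpperBounds.lintegral_far (h : H.HasUpperBounds m n α c r₀) {t : ℝ≥0} (ht : 0 < t)
    (htr : (t : ℝ) < r₀ ^ α) {x : X} {A : Set X} (hA : MeasurableSet A) {a b : ℝ} (ha : 0 < a)
    (hb : b < r₀) (haA : ∀ z ∈ A, a ≤ dist x z) (hxA : ∀ z ∈ A, dist x z ≤ b) (f : X → ℝ≥0∞) :
    ∫⁻ z in A, f z ∂H.kernel t x ≤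
      c * (t / ENNReal.ofReal (a / 2) ^ (n + α)) * ∫⁻ z in A, f z ∂m := by
  rw [← smul_eq_mul ((c : ℝ≥0∞) * _), ← lintegral_smul_measure]
  refine lintegral_mono' (Measure.le_iff.2 fun E hE => ?_) le_rfl
  rw [Measure.restrict_apply hE, Measure.smul_apply, Measure.restrict_apply hE, smul_eq_mul]
  exact h.far t x _ a b ht htr (hE.inter hA) ha hb (fun z hz => haA z hz.2) fun z hz => hxA z hz.2

end HuntProcess

/-! ### Mean exit times and off-diagonal bounds of the Green function -/

namespace IsPotentialKernel

theorem swap {X : Type*} [MeasurableSpace X] {m : Measure X}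
    {S S' : ℝ≥0 → (X → ℝ≥0∞) → X → ℝ≥0∞} {β : ℝ} {D : Set X} {u : X → X → ℝ≥0∞}
    (h : IsPotentialKernel m S S' β D u) : IsPotentialKernel m S' S β D fun x y => u y x where
  measurable := h.measurable.comp measurable_swap
  eq_zero x y hxy := h.eq_zero y x hxy.symm
  potential := h.dual_potential
  dual_potential := h.potential
  excessive := h.dual_excessive
  dual_excessive := h.excessive

end IsPotentialKernel

namespace HuntProcess

variable {X Ω Ω' : Type*} [MetricSpace X] [ProperSpace X] [MeasurableSpace X] [BorelSpace X]
  [mΩ : MeasurableSpace Ω] [MeasurableSpace Ω'] (H : HuntProcess X Ω) (H' : HuntProcess X Ω')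
  {m : Measure X} {n α : ℝ} {c : ℝ≥0} {r₀ : ℝ} {F : ℕ → Set X} {D : Set X} {t₁ : ℝ≥0}

theorem gridOp_one_le (hD : MeasurableSet D) (hhalf : ∀ x ∈ D, H.kernel t₁ x D ≤ 2⁻¹) (k : ℕ)
    (x : X) : H.gridOp D t₁ k 1 x ≤ D.indicator (fun _ => (2⁻¹ : ℝ≥0∞) ^ k) x := by
  induction k generalizing x with
  | zero => exact indicator_le_indicator (by simp)
  | succ k ih =>
    by_cases hx : x ∈ D
    · simp only [gridOp, hx, indicator_of_mem]
      calc ∫⁻ y, H.gridOp D t₁ k 1 y ∂H.kernel t₁ x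
          ≤ ∫⁻ y, D.indicator (fun _ => (2⁻¹ : ℝ≥0∞) ^ k) y ∂H.kernel t₁ x := lintegral_mono ih
        _ = 2⁻¹ ^ k * H.kernel t₁ x D := lintegral_indicator_const hD _
        _ ≤ 2⁻¹ ^ k * 2⁻¹ := mul_le_mul_right (hhalf x hx) _
        _ = 2⁻¹ ^ (k + 1) := (pow_succ _ _).symm
    · simp [gridOp, hx]

theorem prob_grid_le (hD : MeasurableSet D) (hhalf : ∀ x ∈ D, H.kernel t₁ x D ≤ 2⁻¹) (k : ℕ)
    (x : X) : H.prob x (H.grid D 0 t₁ k) ≤ 2⁻¹ ^ k := by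
  have : Nonempty X := ⟨x⟩
  have h := H.lintegral_grid hD 0 t₁ k (A := univ) MeasurableSet.univ (f := 1) measurable_one x
  have hg : MeasurableSet (H.grid D 0 t₁ k) := H.filt.le _ _ (H.measurableSet_grid hD 0 t₁ k)
  rw [univ_inter, setLIntegral_univ] at h
  calc H.prob x (H.grid D 0 t₁ k)
      = ∫⁻ ω in H.grid D 0 t₁ k, extendZero (1 : X → ℝ≥0∞) (H.path (0 + k * t₁) ω) ∂H.prob x := by
        rw [← setLIntegral_one]
        refine setLIntegral_congr_fun hg fun ω hω => ?_
        obtain ⟨y, -, hy⟩ := hω k le_rfl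
        rw [← hy]
        rfl
    _ = ∫⁻ ω, extendZero (H.gridOp D t₁ k 1) (H.path 0 ω) ∂H.prob x := h
    _ ≤ 2⁻¹ ^ k := by
        refine (lintegral_mono (g := fun _ => 2⁻¹ ^ k) fun ω => extendZero_le (fun z =>
          (H.gridOp_one_le hD hhalf k z).trans (indicator_le_self _ _ _)) _).trans ?_
        simp

theorem tsum_mul_two_inv_pow (t : ℝ≥0∞) : ∑' k : ℕ, t * 2⁻¹ ^ k = 2 * t := by
  rw [ENNReal.tsum_mul_left, ENNReal.tsum_geometric, ENNReal.one_sub_inv_two, inv_inv, mul_comm]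

/-- If the process leaves `D` by time `t₁` with probability at least one half from every starting
point, then the mean exit time is at most `2 t₁`. -/
theorem meanExitTime_le (hD : MeasurableSet D) (ht₁ : 0 < t₁)
    (hhalf : ∀ x ∈ D, H.kernel t₁ x D ≤ 2⁻¹) (x : X) : H.meanExitTime D x ≤ 2 * t₁ := by
  have hg : ∀ k, MeasurableSet (H.grid D 0 t₁ k) := fun k =>
    H.filt.le _ _ (H.measurableSet_grid hD 0 t₁ k)
  -- If `k` is the first index for which the path is not in `grid D 0 t₁ k`, then it is outside `D`
  -- at a time at most `k t₁`, and exactly the indices below `k` contribute `t₁` each. If there is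
  -- no such `k`, the sum is infinite.
  have hle : ∀ ω, H.exitTime D ω ≤ ∑' k : ℕ, (H.grid D 0 t₁ k).indicator (fun _ => (t₁ : ℝ≥0∞)) ω := by
    intro ω
    by_cases hall : ∀ k, ω ∈ H.grid D 0 t₁ k
    · simp only [hall, indicator_of_mem]
      rw [ENNReal.tsum_const_eq_top_of_ne_zero (by simpa using ht₁.ne')]
      exact le_top
    · classical
      push Not at hall
      have hk := Nat.find_spec hall
      set k := Nat.find hall with hkdef
      simp only [grid, mem_ofPred_eq, not_forall] at hk
      obtain ⟨i, hik, hi⟩ := hk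
      rw [zero_add] at hi
      calc H.exitTime D ω ≤ ((i * t₁ : ℝ≥0) : ℝ≥0∞) :=
          iInf₂_le (f := fun (t : ℝ≥0) (_ : H.path t ω ∉ ((↑) '' D : Set (OnePoint X))) =>
            (t : ℝ≥0∞)) _ hi
        _ ≤ ((k * t₁ : ℝ≥0) : ℝ≥0∞) := by
            rw [ENNReal.coe_le_coe]
            gcongr
        _ = ∑ j ∈ Finset.range k, (H.grid D 0 t₁ j).indicator (fun _ => (t₁ : ℝ≥0∞)) ω := by
            rw [Finset.sum_congr rfl (g := fun _ => (t₁ : ℝ≥0∞))]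
            · simp
            · intro j hj
              have := Nat.find_min hall (Finset.mem_range.1 hj)
              exact indicator_of_mem (not_not.1 this) _
        _ ≤ _ := ENNReal.sum_le_tsum _
  calc H.meanExitTime D x
      ≤ ∫⁻ ω, ∑' k : ℕ, (H.grid D 0 t₁ k).indicator (fun _ => (t₁ : ℝ≥0∞)) ω ∂H.prob x :=
        lintegral_mono hle
    _ = ∑' k : ℕ, t₁ * H.prob x (H.grid D 0 t₁ k) := by
        rw [lintegral_tsum fun k => (measurable_const.indicator (hg k)).aemeasurable]
        simp_rw [lintegral_indicator_const (hg _)]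
    _ ≤ ∑' k : ℕ, (t₁ : ℝ≥0∞) * 2⁻¹ ^ k :=
        ENNReal.tsum_le_tsum fun k => mul_le_mul_right (H.prob_grid_le hD hhalf k x) _
    _ = 2 * t₁ := tsum_mul_two_inv_pow _

theorem killedKernel_univ_le (hF : IsExhaustion F D) (hD : MeasurableSet D)
    (hhalf : ∀ x ∈ D, H.kernel t₁ x D ≤ 2⁻¹) (x : X) {t : ℝ≥0} {k : ℕ} (hk : k * t₁ ≤ t) :
    H.killedKernel hF (t, x) univ ≤ 2⁻¹ ^ k := by
  rw [killedKernel_apply, killedLaw, H.law_apply x t MeasurableSet.univ]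
  refine (measure_mono ?_).trans (H.prob_grid_le hD hhalf k x)
  rintro ω ⟨h1, -⟩ i hi
  obtain ⟨l, hl⟩ := mem_iUnion.1 h1
  refine image_mono (hF.subset l) (hl (i * t₁) (le_trans ?_ hk))
  gcongr

theorem lintegral_killedKernel_univ_le (hF : IsExhaustion F D) (hD : MeasurableSet D)
    (ht₁ : 0 < t₁) (hhalf : ∀ x ∈ D, H.kernel t₁ x D ≤ 2⁻¹) (x : X) :
    ∫⁻ t in Ioi (0 : ℝ), H.killedKernel hF (t.toNNReal, x) univ ≤ 2 * t₁ := by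
  have hcov : Ioi (0 : ℝ) ⊆ ⋃ k : ℕ, Ico (k * (t₁ : ℝ)) ((k + 1) * t₁) := by
    intro t ht
    have ht₁' : (0 : ℝ) < t₁ := ht₁
    refine mem_iUnion.2 ⟨⌊t / t₁⌋₊, ?_, ?_⟩
    · rw [← le_div_iff₀ ht₁']
      exact Nat.floor_le (div_nonneg (le_of_lt ht) ht₁'.le)
    · rw [← div_lt_iff₀ ht₁']
      exact Nat.lt_floor_add_one _
  calc _ ≤ ∫⁻ t in ⋃ k : ℕ, Ico (k * (t₁ : ℝ)) ((k + 1) * t₁),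
        H.killedKernel hF (t.toNNReal, x) univ := lintegral_mono_set hcov
    _ ≤ ∑' k : ℕ, ∫⁻ t in Ico (k * (t₁ : ℝ)) ((k + 1) * t₁),
        H.killedKernel hF (t.toNNReal, x) univ := lintegral_iUnion_le _ _
    _ ≤ ∑' k : ℕ, (t₁ : ℝ≥0∞) * 2⁻¹ ^ k := by
        refine ENNReal.tsum_le_tsum fun k => ?_
        calc _ ≤ ∫⁻ t in Ico (k * (t₁ : ℝ)) ((k + 1) * t₁), (2⁻¹ : ℝ≥0∞) ^ k := by
              refine setLIntegral_mono' measurableSet_Ico fun t ht => ?_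
              refine H.killedKernel_univ_le hF hD hhalf x ?_
              rw [Real.le_toNNReal_iff_coe_le (le_trans (by positivity) ht.1)]
              exact_mod_cast ht.1
          _ = t₁ * 2⁻¹ ^ k := by
              rw [setLIntegral_const, Real.volume_Ico, mul_comm]
              congr 1
              rw [add_mul, one_mul, add_sub_cancel_left, ENNReal.ofReal_coe_nnreal]
    _ = 2 * t₁ := tsum_mul_two_inv_pow _

/-- The constant in the bound of the Green function at distance `2 η` from the pole. -/
def greenBound (n α : ℝ) (c t₁ : ℝ≥0) (η : ℝ) : ℝ≥0∞ :=
  t₁ * (c * (t₁ / ENNReal.ofReal (η / 2) ^ (n + α))) + 2 * t₁ * (c * (t₁ : ℝ≥0∞) ^ (-n / α))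

variable {H H'}

/-- Up to time `t₁` the off-diagonal bound applies, with `t` replaced by `t₁`. At time `s + t₁` the
process has survived up to `s` and then makes a free step of length `t₁`, whose kernel is at most `c
t₁^{-n/α} m(A)`; the survival probability integrates to at most `2 t₁`. -/
theorem lintegral_killedKernel_le (hF : IsExhaustion F D) (hD : MeasurableSet D)
    (hH : H.HasUpperBounds m n α c r₀) (ht₁ : 0 < t₁) (ht₁r : (t₁ : ℝ) < r₀ ^ α)
    (hhalf : ∀ x ∈ D, H.kernel t₁ x D ≤ 2⁻¹) {b : ℝ} (hb : b < r₀)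
    (hdiam : ∀ x ∈ D, ∀ y ∈ D, dist x y ≤ b) {x : X} (hx : x ∈ D) {A : Set X}
    (hA : MeasurableSet A) (hAD : A ⊆ D) {η : ℝ} (hη : 0 < η) (hηA : ∀ z ∈ A, η ≤ dist x z) :
    ∫⁻ t in Ioi (0 : ℝ), H.killedKernel hF (t.toNNReal, x) A ≤ greenBound n α c t₁ η * m A := by
  have hsplit : Ioi (0 : ℝ) = Ioc 0 (t₁ : ℝ) ∪ Ioi (t₁ : ℝ) :=
    (Ioc_union_Ioi_eq_Ioi t₁.coe_nonneg).symm
  rw [hsplit]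
  refine (lintegral_union_le _ _ _).trans ?_
  rw [greenBound, add_mul]
  refine add_le_add ?_ ?_
  · calc _ ≤ ∫⁻ t in Ioc 0 (t₁ : ℝ), c * (t₁ / ENNReal.ofReal (η / 2) ^ (n + α)) * m A := by
          refine setLIntegral_mono' measurableSet_Ioc fun t ht => ?_
          have htp : 0 < t.toNNReal := Real.toNNReal_pos.2 ht.1
          have htle : t.toNNReal ≤ t₁ := Real.toNNReal_le_iff_le_coe.2 ht.2
          have htr : (t.toNNReal : ℝ) < r₀ ^ α := lt_of_le_of_lt (NNReal.coe_le_coe.2 htle) ht₁r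
          refine (H.killedKernel_le_kernel hF _ x A).trans ?_
          refine (hH.far _ x A η b htp htr hA hη hb hηA fun z hz => hdiam x hx z (hAD hz)).trans ?_
          gcongr
      _ = _ := by
          rw [setLIntegral_const, Real.volume_Ioc, sub_zero, ENNReal.ofReal_coe_nnreal]
          ring
  · rw [← setLIntegral_Ioi_shift]
    calc _ ≤ ∫⁻ s in Ioi (0 : ℝ), c * (t₁ : ℝ≥0∞) ^ (-n / α) * m A *
          H.killedKernel hF (s.toNNReal, x) univ := by
          refine setLIntegral_mono' measurableSet_Ioi fun s hs => ?_
          have h1 : ((t₁ : ℝ) + s).toNNReal = s.toNNReal + t₁ := by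
            rw [Real.toNNReal_add t₁.coe_nonneg (le_of_lt hs), Real.toNNReal_coe, add_comm]
          rw [h1, ← lintegral_indicator_one hA,
            H.killedKernel_add hF _ _ _ (measurable_one.indicator hA), ← lintegral_const]
          refine lintegral_mono fun z => ?_
          rw [lintegral_indicator_one hA]
          by_cases hz : z ∈ D
          · exact (H.killedKernel_le_kernel hF _ z A).trans
              (hH.near _ z A b ht₁ ht₁r hA hb fun w hw => hdiam z hz w (hAD hw))
          · simp [H.killedKernel_eq_zero hF t₁ hz]
      _ = c * (t₁ : ℝ≥0∞) ^ (-n / α) * m A *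
          ∫⁻ s in Ioi (0 : ℝ), H.killedKernel hF (s.toNNReal, x) univ := by
          refine lintegral_const_mul _ ?_
          exact ((H.killedKernel hF).measurable_coe MeasurableSet.univ).comp
            (f := fun s : ℝ => (s.toNNReal, x)) (by fun_prop)
      _ ≤ c * (t₁ : ℝ≥0∞) ^ (-n / α) * m A * (2 * t₁) :=
          mul_le_mul_right (H.lintegral_killedKernel_univ_le hF hD ht₁ hhalf x) _
      _ = _ := by ring

theorem green_ae_le [SigmaFinite m] (hF : IsExhaustion F D) (hD : MeasurableSet D)
    (hH : H.HasUpperBounds m n α c r₀) (ht₁ : 0 < t₁) (ht₁r : (t₁ : ℝ) < r₀ ^ α)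
    (hhalf : ∀ x ∈ D, H.kernel t₁ x D ≤ 2⁻¹) {b : ℝ} (hb : b < r₀)
    (hdiam : ∀ x ∈ D, ∀ y ∈ D, dist x y ≤ b) {G : X → X → ℝ≥0∞} (hG : IsGreenFunction m H H' D G)
    {x : X} (hx : x ∈ D) {V : Set X} (hV : MeasurableSet V) (hVD : V ⊆ D) {η : ℝ} (hη : 0 < η)
    (hηV : ∀ z ∈ V, η ≤ dist x z) :
    ∀ᵐ z ∂m.restrict V, G x z ≤ greenBound n α c t₁ η := by
  have hGx : Measurable fun z => G x z := hG.measurable.comp measurable_prodMk_left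
  refine ae_le_of_forall_setLIntegral_le_of_sigmaFinite hGx fun A hA _ => ?_
  have hAV := hA.inter hV
  rw [Measure.restrict_restrict hA, setLIntegral_const, ← lintegral_indicator hAV]
  have h1 := hG.potential ((A ∩ V).indicator 1) (measurable_one.indicator hAV) x
  rw [H.potentialOp_killedSemigroup hF (measurable_one.indicator hAV)] at h1
  simp_rw [lintegral_indicator_one hAV] at h1
  have h2 : ∫⁻ z, (A ∩ V).indicator (fun z => G x z) z ∂m =
      ∫⁻ z, G x z * (A ∩ V).indicator 1 z ∂m := by
    refine lintegral_congr fun z => ?_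
    by_cases hz : z ∈ A ∩ V
    · rw [indicator_of_mem hz, indicator_of_mem hz]
      simp
    · rw [indicator_of_notMem hz, indicator_of_notMem hz]
      simp
  rw [h2, h1]
  exact lintegral_killedKernel_le hF hD hH ht₁ ht₁r hhalf hb hdiam hx hAV
    (inter_subset_right.trans hVD) hη fun z hz => hηV z hz.2

theorem lintegral_green_le (hF : IsExhaustion F D) (hD : MeasurableSet D) (ht₁ : 0 < t₁)
    (hhalf : ∀ x ∈ D, H.kernel t₁ x D ≤ 2⁻¹) {G : X → X → ℝ≥0∞}
    (hG : IsGreenFunction m H H' D G) (x : X) : ∫⁻ z, G x z ∂m ≤ 2 * t₁ := by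
  have h1 := hG.potential 1 measurable_one x
  rw [H.potentialOp_killedSemigroup hF measurable_one] at h1
  simp only [Pi.one_apply, mul_one, lintegral_one] at h1
  rw [h1]
  exact H.lintegral_killedKernel_univ_le hF hD ht₁ hhalf x

/-- The off-diagonal bound of the Green function. -/
theorem green_le [SigmaFinite m] (hF : IsExhaustion F D) (hD : MeasurableSet D) (hr₀ : 0 < r₀)
    (hH : H.HasUpperBounds m n α c r₀) (hH' : H'.HasUpperBounds m n α c r₀) (ht₁ : 0 < t₁)
    (ht₁r : (t₁ : ℝ) < r₀ ^ α) (hhalf : ∀ x ∈ D, H.kernel t₁ x D ≤ 2⁻¹) {b : ℝ} (hb : b < r₀)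
    (hdiam : ∀ x ∈ D, ∀ y ∈ D, dist x y ≤ b) {G : X → X → ℝ≥0∞} (hG : IsGreenFunction m H H' D G)
    {x y : X} (hx : x ∈ D) (hy : y ∈ D) {η : ℝ} (hη : 0 < η) (hxy : 2 * η ≤ dist x y) :
    G x y ≤ greenBound n α c t₁ η := by
  set M := greenBound n α c t₁ η with hM
  -- As `x` and `y` are at distance at least `2 η`, all of `V` is at distance at least `η` from `x`,
  -- where the almost everywhere bound holds.
  set V : Set X := D ∩ Metric.ball y η with hVdef
  have hV : MeasurableSet V := hD.inter measurableSet_ball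
  have hGx : Measurable fun z => G x z := hG.measurable.comp measurable_prodMk_left
  have hae : ∀ᵐ z ∂m.restrict V, G x z ≤ M := by
    refine green_ae_le hF hD hH ht₁ ht₁r hhalf hb hdiam hG hx hV inter_subset_left hη fun z hz => ?_
    have h1 := Metric.mem_ball.1 hz.2
    linarith [dist_triangle x z y]
  -- `t * K` bounds what a move from `y` to distance at least `η` contributes: the kernel has
  -- density at most `c t (η/2)^{-(n+α)}` there, and `G(x, ·)` has integral at most `2 t₁`.
  set K : ℝ≥0∞ := c * (2 * t₁ / ENNReal.ofReal (η / 2) ^ (n + α)) with hK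
  have hKfin : K ≠ ∞ := by
    refine ENNReal.mul_ne_top ENNReal.coe_ne_top (ENNReal.div_ne_top (by finiteness) ?_)
    exact (ENNReal.rpow_pos (ENNReal.ofReal_pos.2 (half_pos hη)) ENNReal.ofReal_ne_top).ne'
  have hbound : ∀ t : ℝ≥0, 0 < t → (t : ℝ) < r₀ ^ α →
      ENNReal.ofReal (Real.exp (-0 * t)) * H'.killedSemigroup D t (fun y => G x y) y ≤
        M + t * K := by
    intro t ht htr
    rw [H'.killedSemigroup_eq hF _ hGx]
    simp only [neg_zero, zero_mul, Real.exp_zero, ENNReal.ofReal_one, one_mul]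
    have hsupp : ∫⁻ z, G x z ∂H'.kernel t y =
        ∫⁻ z in V ∪ (D \ Metric.ball y η), G x z ∂H'.kernel t y := by
      rw [hVdef, inter_union_sdiff, setLIntegral_eq_of_support_subset]
      intro z hz
      by_contra hzD
      exact hz (hG.eq_zero x z (Or.inr hzD))
    calc ∫⁻ z, G x z ∂H'.killedKernel hF (t, y) ≤ ∫⁻ z, G x z ∂H'.kernel t y :=
          lintegral_mono' (H'.killedKernel_le_kernel hF t y) le_rfl
      _ ≤ ∫⁻ z in V, G x z ∂H'.kernel t y + ∫⁻ z in D \ Metric.ball y η, G x z ∂H'.kernel t y := by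
          rw [hsupp]
          exact lintegral_union_le _ _ _
      _ ≤ M + t * K := by
          refine add_le_add ?_ ?_
          -- Absolute continuity of the dual kernel turns the `m`-almost everywhere bound on `V`
          -- into one that holds almost everywhere for the law of the dual process at time `t`.
          · have hac : (H'.kernel t y).restrict V ≪ m.restrict V :=
              (hH'.absolutelyContinuous t ht y).restrict V
            calc ∫⁻ z in V, G x z ∂H'.kernel t y ≤ ∫⁻ _ in V, M ∂H'.kernel t y :=
                  lintegral_mono_ae (hac.ae_le hae)
              _ ≤ M := by
                  rw [setLIntegral_const]
                  exact mul_le_of_le_one_right' ((measure_mono (subset_univ _)).trans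
                    (H'.law_le_one y t univ))
          · refine (hH'.lintegral_far ht htr (hD.diff measurableSet_ball) hη hb ?_ ?_ _).trans ?_
            · intro z hz
              have := hz.2
              rw [Metric.mem_ball, not_lt, dist_comm] at this
              exact this
            · exact fun z hz => hdiam y hy z hz.1
            · calc c * (t / ENNReal.ofReal (η / 2) ^ (n + α)) *
                    ∫⁻ z in D \ Metric.ball y η, G x z ∂m
                  ≤ c * (t / ENNReal.ofReal (η / 2) ^ (n + α)) * (2 * t₁) :=
                    mul_le_mul_right ((setLIntegral_le_lintegral _ _).trans
                      (lintegral_green_le hF hD ht₁ hhalf hG x)) _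
                _ = t * K := by
                    simp only [hK, div_eq_mul_inv]
                    ring
  have hlim : Tendsto (fun t : ℝ≥0 => M + t * K) (𝓝[>] 0) (𝓝 (M + (0 : ℝ≥0) * K)) := by
    refine Tendsto.const_add M ?_
    refine ENNReal.Tendsto.mul_const ?_ (Or.inr hKfin)
    exact (ENNReal.continuous_coe.tendsto 0).mono_left nhdsWithin_le_nhds
  -- Co-excessivity recovers the value of `G(x, ·)` at the point `y` itself from averages over small
  -- times.
  have hex := (hG.dual_excessive x hx y hy).2
  have h3 := le_of_tendsto_of_tendsto hex hlim ?_
  · simpa using h3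
  · have hpos : (0 : ℝ≥0) < (r₀ ^ α).toNNReal := Real.toNNReal_pos.2 (Real.rpow_pos_of_pos hr₀ α)
    filter_upwards [self_mem_nhdsWithin, nhdsWithin_le_nhds (Iio_mem_nhds hpos)] with t ht htr
    exact hbound t ht (Real.lt_toNNReal_iff_coe_lt.1 htr)

end HuntProcess

/-! ### Balls, scaling and the choice of constants -/

theorem isExhaustion_closedBall {X : Type*} [MetricSpace X] [ProperSpace X] (x₀ : X) {R : ℝ}
    (hR : 0 < R) :
    IsExhaustion (fun k : ℕ => Metric.closedBall x₀ (R - R * (1 / ((k : ℝ) + 1))))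
      (Metric.ball x₀ R) where
  isCompact k := isCompact_closedBall _ _
  subset_interior k := by
    refine (Metric.closedBall_subset_ball ?_).trans Metric.ball_subset_interior_closedBall
    have : 1 / (((k + 1 : ℕ) : ℝ) + 1) < 1 / ((k : ℝ) + 1) := by
      push_cast
      exact one_div_lt_one_div_of_lt (by positivity) (by linarith)
    have := mul_lt_mul_of_pos_left this hR
    linarith
  iUnion_eq := by
    ext y
    simp only [mem_iUnion, Metric.mem_closedBall, Metric.mem_ball]
    constructor
    · rintro ⟨k, hk⟩
      have : 0 < R * (1 / ((k : ℝ) + 1)) := by positivity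
      linarith
    · intro hy
      obtain ⟨k, hk⟩ := exists_nat_one_div_lt (div_pos (sub_pos.2 hy) hR)
      rw [lt_div_iff₀ hR] at hk
      exact ⟨k, by linarith⟩

/-- If the ball of radius `R` were the whole space, the ball of radius `s` would give `c_A⁻¹ s^n ≤
m(X) ≤ c_A R^n`, so `R ≥ s c_A^{-2/n}`. -/
theorem compl_ball_nonempty {X : Type*} [MetricSpace X] [MeasurableSpace X]
    {m : Measure X} {n : ℝ} (hn : 0 < n) {cA : ℝ≥0} (hcA : 0 < cA) {ρ : ℝ≥0∞}
    (hm : IsLocallyAhlforsRegular m n cA ρ) {s : ℝ} (hs : 0 < s) (hsρ : ENNReal.ofReal s < ρ)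
    {R : ℝ} (hR : 0 < R) (hRs : R ≤ s) (hRs' : R < s * (cA : ℝ) ^ (-2 / n)) (x : X) :
    (Metric.ball x R)ᶜ.Nonempty := by
  have hc : (0 : ℝ) < cA := hcA
  by_contra h
  rw [not_nonempty_iff_eq_empty, compl_empty_iff] at h
  have h1 := (hm x s hs hsρ).1
  have h2 := (hm x R hR ((ENNReal.ofReal_le_ofReal hRs).trans_lt hsρ)).2
  rw [h] at h2
  have h3 := h1.trans ((measure_mono (subset_univ _)).trans h2)
  rw [← ENNReal.ofReal_coe_nnreal, ← ENNReal.ofReal_inv_of_pos hc, ENNReal.ofReal_rpow_of_pos hs,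
    ENNReal.ofReal_rpow_of_pos hR, ← ENNReal.ofReal_mul (by positivity),
    ← ENNReal.ofReal_mul (by positivity), ENNReal.ofReal_le_ofReal_iff (by positivity)] at h3
  have h4 : R ^ n < s ^ n * (cA : ℝ) ^ (-2 : ℝ) := by
    have := Real.rpow_lt_rpow hR.le hRs' hn
    rwa [Real.mul_rpow hs.le (by positivity), ← Real.rpow_mul hc.le, div_mul_cancel₀ _ hn.ne'] at this
  have h5 : (cA : ℝ) * R ^ n < cA * (s ^ n * (cA : ℝ) ^ (-2 : ℝ)) := mul_lt_mul_of_pos_left h4 hc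
  have h6 : (cA : ℝ) * (s ^ n * (cA : ℝ) ^ (-2 : ℝ)) = (cA : ℝ)⁻¹ * s ^ n := by
    rw [Real.rpow_neg hc.le, Real.rpow_two]
    field_simp
  linarith

/-- The time scale, relative to `R ^ α`, after which the process has left a ball of radius `R` with
probability at least one half. -/
def exitScale (n α : ℝ) (cA cT : ℝ≥0) : ℝ := (2 * cT * cA : ℝ) ^ (α / n)

theorem exitScale_pos {n α : ℝ} {cA cT : ℝ≥0} (hcA : 0 < cA) (hcT : 0 < cT) :
    0 < exitScale n α cA cT := by
  have : (0 : ℝ) < cA := hcA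
  have : (0 : ℝ) < cT := hcT
  exact Real.rpow_pos_of_pos (by positivity) _

theorem exitScale_rpow {n α : ℝ} (hn : 0 < n) (hα : 0 < α) (cA cT : ℝ≥0) :
    exitScale n α cA cT ^ (-n / α) = (2 * cT * cA : ℝ)⁻¹ := by
  rw [exitScale, ← Real.rpow_mul (by positivity)]
  have : α / n * (-n / α) = -1 := by field_simp
  rw [this, Real.rpow_neg_one]

namespace HuntProcess

variable {X Ω Ω' : Type*} [MetricSpace X] [ProperSpace X] [MeasurableSpace X] [BorelSpace X]
  [mΩ : MeasurableSpace Ω] [MeasurableSpace Ω'] {H : HuntProcess X Ω} {H' : HuntProcess X Ω'}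
  {m : Measure X} {n α : ℝ} {cA cT : ℝ≥0} {r₀ : ℝ} {ρ : ℝ≥0∞}

/-- Two points of the ball are less than `2 R` apart, so the kernel is at most `c_T t^{-n/α} c_A
R^n`; at `t = κ R^α` this equals `c_T c_A κ^{-n/α} = 1/2`, which dictates `exitScale`. -/
theorem kernel_ball_le_half (hn : 0 < n) (hα : 0 < α) (hcA : 0 < cA) (hcT : 0 < cT)
    (hm : IsLocallyAhlforsRegular m n cA ρ) (hH : H.HasUpperBounds m n α cT r₀) {R : ℝ}
    (hR : 0 < R) (hRr : 2 * R < r₀) (hRρ : ENNReal.ofReal R < ρ)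
    (ht : exitScale n α cA cT * R ^ α < r₀ ^ α) {x₀ x : X} (hx : x ∈ Metric.ball x₀ R) :
    H.kernel (exitScale n α cA cT * R ^ α).toNNReal x (Metric.ball x₀ R) ≤ 2⁻¹ := by
  have hκ := exitScale_pos (n := n) (α := α) hcA hcT
  have hA : (0 : ℝ) < cA := hcA
  have hT : (0 : ℝ) < cT := hcT
  have hpos : 0 < exitScale n α cA cT * R ^ α := by positivity
  refine (hH.near _ x _ (2 * R) (Real.toNNReal_pos.2 hpos) ?_ measurableSet_ball hRr
    fun z hz => ?_).trans ((mul_le_mul_right (hm x₀ R hR hRρ).2 _).trans ?_)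
  · rwa [Real.coe_toNNReal _ hpos.le]
  · have h1 := Metric.mem_ball.1 hx
    have h2 := Metric.mem_ball.1 hz
    linarith [dist_triangle x x₀ z, dist_comm x₀ z]
  · have hcoe : (((exitScale n α cA cT * R ^ α).toNNReal : ℝ≥0) : ℝ≥0∞) =
        ENNReal.ofReal (exitScale n α cA cT * R ^ α) := rfl
    rw [hcoe, ENNReal.ofReal_rpow_of_pos hpos, ENNReal.ofReal_rpow_of_pos hR,
      ← ENNReal.ofReal_coe_nnreal, ← ENNReal.ofReal_coe_nnreal (p := cA),
      ← ENNReal.ofReal_mul (by positivity), ← ENNReal.ofReal_mul (by positivity),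
      ← ENNReal.ofReal_mul (by positivity), Real.mul_rpow hκ.le (by positivity),
      exitScale_rpow hn hα, ← Real.rpow_mul hR.le]
    have h1 : α * (-n / α) = -n := by field_simp
    rw [h1, Real.rpow_neg hR.le]
    have h2 : (cT : ℝ) * ((2 * cT * cA : ℝ)⁻¹ * (R ^ n)⁻¹) * (cA * R ^ n) = 2⁻¹ := by
      have : R ^ n ≠ 0 := (Real.rpow_pos_of_pos hR n).ne'
      field_simp
    rw [h2, ENNReal.ofReal_inv_of_pos (by norm_num)]
    simp

end HuntProcess

/-- The constant in the bound of the Green function of a ball of radius `R` between the radii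
`a R` and `b R`. -/
def greenScale (n α : ℝ) (cA cT : ℝ≥0) (a b : ℝ) : ℝ :=
  cT * exitScale n α cA cT ^ 2 * ((b - a) / 4) ^ (-(n + α)) +
    2 * cT * exitScale n α cA cT * exitScale n α cA cT ^ (-n / α)

/-- With `t₁` proportional to `R^α` and `η` proportional to `R`, the two terms scale as `R^{2α -
(n+α)}` and `R^{α - n}`, which are the same power. The factor `(b - a) / 4` is `η / 2` divided by
`R`, for `η = (s - r) / 2`. -/
theorem greenBound_eq {n α : ℝ} (hα : 0 < α) {cA cT : ℝ≥0} (hcA : 0 < cA)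
    (hcT : 0 < cT) {r s R : ℝ} (hrs : r < s) (hR : 0 < R) :
    HuntProcess.greenBound n α cT (exitScale n α cA cT * R ^ α).toNNReal ((s - r) / 2) =
      (greenScale n α cA cT (r / R) (s / R)).toNNReal * ENNReal.ofReal R ^ (α - n) := by
  have hκ := exitScale_pos (n := n) (α := α) hcA hcT
  rw [HuntProcess.greenBound, greenScale]
  set κ := exitScale n α cA cT
  have hpos : 0 < κ * R ^ α := by positivity
  have hT : (0 : ℝ) < cT := hcT
  have hη : 0 < (s - r) / 2 / 2 := by linarith
  have hab : 0 < (s / R - r / R) / 4 := by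
    rw [← sub_div]
    exact div_pos (div_pos (sub_pos.2 hrs) hR) (by norm_num)
  have hηR : (s - r) / 2 / 2 = R * ((s / R - r / R) / 4) := by
    field_simp
    ring
  have hcoe : (((κ * R ^ α).toNNReal : ℝ≥0) : ℝ≥0∞) = ENNReal.ofReal (κ * R ^ α) := rfl
  have hcoe' : ∀ u : ℝ, ((u.toNNReal : ℝ≥0) : ℝ≥0∞) = ENNReal.ofReal u := fun _ => rfl
  have htwo : (2 : ℝ≥0∞) = ENNReal.ofReal 2 := by simp
  rw [hcoe, hcoe', ENNReal.ofReal_rpow_of_pos hpos, ENNReal.ofReal_rpow_of_pos hη,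
    ENNReal.ofReal_rpow_of_pos hR, ← ENNReal.ofReal_coe_nnreal,
    ← ENNReal.ofReal_div_of_pos (by positivity), ← ENNReal.ofReal_mul (by positivity),
    ← ENNReal.ofReal_mul (by positivity), ← ENNReal.ofReal_mul (by positivity), htwo,
    ← ENNReal.ofReal_mul (by positivity), ← ENNReal.ofReal_mul (by positivity),
    ← ENNReal.ofReal_add (by positivity) (by positivity), ← ENNReal.ofReal_mul (by positivity)]
  congr 1
  rw [hηR, Real.mul_rpow hR.le hab.le, Real.mul_rpow hκ.le (by positivity), ← Real.rpow_mul hR.le,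
    Real.rpow_neg hab.le, Real.rpow_sub hR, Real.rpow_add hR]
  have h1 : α * (-n / α) = -n := by field_simp
  rw [h1, Real.rpow_neg hR.le]
  have e1 : R ^ α ≠ 0 := (Real.rpow_pos_of_pos hR _).ne'
  have e2 : R ^ n ≠ 0 := (Real.rpow_pos_of_pos hR _).ne'
  have e3 : ((s / R - r / R) / 4) ^ (n + α) ≠ 0 := (Real.rpow_pos_of_pos hab _).ne'
  generalize ((s / R - r / R) / 4) ^ (n + α) = w at *
  generalize κ ^ (-n / α) = v at *
  field_simp

theorem proposition5p3 (n α : ℝ) (hn : 0 < n) (hα : 0 < α)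
    (cA : ℝ≥0) (hcA : 0 < cA) (ρ : ℝ≥0∞) (hρ : 0 < ρ)
    (cT : ℝ≥0) (hcT : 0 < cT) (r₀ : ℝ) (hr₀ : 0 < r₀) :
    ∃ (R₀ : ℝ) (Cτ : ℝ≥0) (CG : ℝ → ℝ → ℝ≥0), 0 < R₀ ∧
      ∀ (X : Type u) [MetricSpace X] [ProperSpace X] [MeasurableSpace X] [BorelSpace X]
        (m : Measure X) [IsLocallyFiniteMeasure m] [m.IsOpenPosMeasure]
        (Ω : Type v) [MeasurableSpace Ω] (Ω' : Type w) [MeasurableSpace Ω']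
        (H : HuntProcess X Ω) (H' : HuntProcess X Ω') (p : ℝ≥0 → X → X → ℝ≥0∞),
        H.IsFeller → H.IsStrongFeller → H'.IsFeller → H'.IsStrongFeller → AreDual m H H' →
        IsLocallyAhlforsRegular m n cA ρ →
        H.IsTransitionDensity m p → HasStableBounds n α cT r₀ p →
        (∀ (x : X) (r : ℝ), 0 < r → r < R₀ → (Metric.ball x (2 * r))ᶜ.Nonempty) ∧
        (∀ (x₀ : X) (r : ℝ), 0 < r → r < R₀ →
          exitConstant H H' x₀ r ≤ Cτ * ENNReal.ofReal r ^ α) ∧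
        (∀ (x₀ : X) (R : ℝ), 0 < R → R < R₀ →
          (∃ G : X → X → ℝ≥0∞, IsGreenFunction m H H' (Metric.ball x₀ R) G) ∧
          ∀ G : X → X → ℝ≥0∞, IsGreenFunction m H H' (Metric.ball x₀ R) G →
            ∀ r s : ℝ, 0 < r → r < s → s < R →
              greenConstant G x₀ r s ≤
                CG (r / R) (s / R) * ENNReal.ofReal R ^ (α - n)) := by
  -- A finite radius below `ρ`, which may be infinite.
  obtain ⟨s₀, hs₀, hs₀ρ⟩ := ENNReal.lt_iff_exists_nnreal_btwn.1 hρ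
  have hs : (0 : ℝ) < s₀ := by simpa using hs₀
  have hsρ : ENNReal.ofReal s₀ < ρ := by rwa [ENNReal.ofReal_coe_nnreal]
  have hA : (0 : ℝ) < cA := hcA
  set κ := exitScale n α cA cT with hκdef
  have hκ : 0 < κ := exitScale_pos hcA hcT
  -- The four terms ensure, in order: the diameter `2 R` is below `r₀`; the time `κ R^α` is below
  -- `r₀^α`; `2 R` is at most `s₀`; `2 R` is below `s₀ c_A^{-2/n}`. The last two allow
  -- `compl_ball_nonempty` at the doubled radius.
  refine ⟨min (min (r₀ / 2) (κ ^ (-1 / α) * r₀)) (min (s₀ / 2) (s₀ * (cA : ℝ) ^ (-2 / n) / 2)),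
    (2 * κ).toNNReal, fun a b => (greenScale n α cA cT a b).toNNReal, by positivity, ?_⟩
  intro X _ _ _ _ m _ _ Ω _ Ω' _ H H' p _ _ _ hH' hdual hm hp hpb
  have hUH : H.HasUpperBounds m n α cT r₀ :=
    HuntProcess.hasUpperBounds_of_density hp hpb (by positivity)
  have hUH' : H'.HasUpperBounds m n α cT r₀ :=
    HuntProcess.hasUpperBounds_dual hp hpb (by positivity) hdual hH'
  have hsmall : ∀ R : ℝ, 0 < R →
      R < min (min (r₀ / 2) (κ ^ (-1 / α) * r₀)) (min (s₀ / 2) (s₀ * (cA : ℝ) ^ (-2 / n) / 2)) →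
      2 * R < r₀ ∧ κ * R ^ α < r₀ ^ α ∧ 2 * R ≤ s₀ ∧ 2 * R < s₀ * (cA : ℝ) ^ (-2 / n) ∧
        ENNReal.ofReal R < ρ := by
    intro R hR hRR
    simp only [lt_min_iff] at hRR
    obtain ⟨⟨h1, h2⟩, h3, h4⟩ := hRR
    refine ⟨by linarith, ?_, by linarith, by linarith, ?_⟩
    · have := Real.rpow_lt_rpow hR.le h2 hα
      rw [Real.mul_rpow (by positivity) hr₀.le, ← Real.rpow_mul hκ.le, div_mul_cancel₀ _ hα.ne',
        Real.rpow_neg_one] at this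
      calc κ * R ^ α < κ * (κ⁻¹ * r₀ ^ α) := mul_lt_mul_of_pos_left this hκ
        _ = r₀ ^ α := by field_simp
    · exact (ENNReal.ofReal_le_ofReal (by linarith)).trans_lt hsρ
  refine ⟨fun x r hr hrR => ?_, fun x₀ r hr hrR => ?_, fun x₀ R hR hRR => ?_⟩
  · obtain ⟨-, -, h1, h2, -⟩ := hsmall r hr hrR
    exact compl_ball_nonempty hn hcA hm hs hsρ (by positivity) h1 h2 x
  · obtain ⟨h1, h2, -, -, h3⟩ := hsmall r hr hrR
    have hpos : 0 < κ * r ^ α := by positivity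
    have heq : 2 * (((κ * r ^ α).toNNReal : ℝ≥0) : ℝ≥0∞) =
        ((2 * κ).toNNReal : ℝ≥0) * ENNReal.ofReal r ^ α := by
      change 2 * ENNReal.ofReal (κ * r ^ α) = ENNReal.ofReal (2 * κ) * _
      rw [ENNReal.ofReal_rpow_of_pos hr, ← ENNReal.ofReal_mul (by positivity), mul_assoc,
        ENNReal.ofReal_mul zero_le_two, ENNReal.ofReal_ofNat]
    refine iSup₂_le fun x _ => max_le ?_ ?_
    · rw [← heq]
      exact H.meanExitTime_le measurableSet_ball (Real.toNNReal_pos.2 hpos)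
        (fun z hz => HuntProcess.kernel_ball_le_half hn hα hcA hcT hm hUH hr h1 h3 h2 hz) x
    · rw [← heq]
      exact H'.meanExitTime_le measurableSet_ball (Real.toNNReal_pos.2 hpos)
        (fun z hz => HuntProcess.kernel_ball_le_half hn hα hcA hcT hm hUH' hr h1 h3 h2 hz) x
  · obtain ⟨h1, h2, -, -, h3⟩ := hsmall R hR hRR
    have hF := isExhaustion_closedBall x₀ hR
    refine ⟨H.exists_isGreenFunction H' hF measurableSet_ball measure_ball_lt_top.ne
      hUH.absolutelyContinuous hUH'.absolutelyContinuous
      fun t _ f g hf hg => HuntProcess.kernel_dual hdual t hf hg, fun G hG r s hr hrs hsR => ?_⟩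
    have hpos : 0 < κ * R ^ α := by positivity
    have hη : 0 < (s - r) / 2 := by linarith
    have htr : ((κ * R ^ α).toNNReal : ℝ) < r₀ ^ α := by rwa [Real.coe_toNNReal _ hpos.le]
    have hdiam : ∀ x ∈ Metric.ball x₀ R, ∀ y ∈ Metric.ball x₀ R, dist x y ≤ 2 * R := by
      intro x hx y hy
      have := Metric.mem_ball.1 hx
      have := Metric.mem_ball.1 hy
      linarith [dist_triangle x x₀ y, dist_comm x₀ y]
    have hhalf := fun z hz =>
      HuntProcess.kernel_ball_le_half (x := z) (x₀ := x₀) hn hα hcA hcT hm hUH hR h1 h3 h2 hz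
    have hhalf' := fun z hz =>
      HuntProcess.kernel_ball_le_half (x := z) (x₀ := x₀) hn hα hcA hcT hm hUH' hR h1 h3 h2 hz
    rw [← greenBound_eq hα hcA hcT hrs hR]
    refine iSup₂_le fun x hx => iSup₂_le fun y hy => ?_
    have hxR : x ∈ Metric.ball x₀ R := Metric.ball_subset_ball (by linarith) hx
    by_cases hyR : y ∈ Metric.ball x₀ R
    · have hxy : 2 * ((s - r) / 2) ≤ dist x y := by
        have h4 := Metric.mem_ball.1 hx
        rw [mem_compl_iff, Metric.mem_ball, not_lt] at hy
        linarith [dist_triangle y x x₀, dist_comm y x]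
      refine max_le ?_ ?_
      · exact HuntProcess.green_le hF measurableSet_ball hr₀ hUH hUH' (Real.toNNReal_pos.2 hpos)
          htr hhalf h1 hdiam hG hxR hyR hη hxy
      -- The transposed kernel is a Green function with the two processes exchanged, and the
      -- hypotheses are symmetric in them.
      · exact HuntProcess.green_le hF measurableSet_ball hr₀ hUH' hUH (Real.toNNReal_pos.2 hpos)
          htr hhalf' h1 hdiam (IsPotentialKernel.swap hG) hxR hyR hη hxy
    · rw [hG.eq_zero x y (Or.inr hyR), hG.eq_zero y x (Or.inl hyR), max_self]
      exact zero_le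

end
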